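/- Let $[n]=\{1,\dots,n\}$. For a family $S$ of $k$-subsets of $[n]$ let $\Delta(S)$ be its shadow, i.e. the family of $(k-1)$-subsets of $[n]$ contained in some member of $S$, and let $\Delta^t(S)$ be the $t$-th iterated shadow ($\Delta^0(S)=S$). The $k$-binomial decomposition of a positive integer $m$ is the unique expression $m=\binom{a_0}{k}+\binom{a_1}{k-1}+\cdots+\binom{a_r}{k-r}$ with $a_0>a_1>\cdots>a_r\ge k-r\ge 1$. A nonempty family $S$ of $k$-subsets of $[n]$ is extremal if $|\Delta(S)|=\binom{a_0}{k-1}+\binom{a_1}{k-2}+\cdots+\binom{a_r}{k-r-1}$, where $(a_0,\dots,a_r)$ is the $k$-binomial decomposition of $|S|$ (the minimum possible by the Kruskal--Katona theorem). Initial segments of the colex order on the $r$-subsets of $[n]$ are understood up to permutations of $[n]$. Define Hamilton's numbers by $h[1]=2$ and $h[m]=2+\sum_{i=1}^{m-1}(-1)^{i+1}\binom{h[m-i]}{i+1}$ for $m>1$, and the hypotenusal numbers by $a[-1]=a[0]=1$ and $a[i]=h[i+1]-h[i]$ for $i\ge 1$ (so $a[1]=1$, $a[2]=2$, $a[3]=6$,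 $a[4]=36$). Theorem. Let $S$ be an extremal family of $k$-subsets of $[n]$, let $0\le t\le k-1$ be such that $\Delta^t(S)$ is not an initial segment of the colex order, and suppose that the $k$-binomial decomposition of $|S|$ has length $k$, $|S|=\binom{a_0}{k}+\binom{a_1}{k-1}+\cdots+\binom{a_{k-1}}{1}$. Then $$a_{k-2-t+i}-a_{k-1-t+i}\ \ge\ a[i-1]+1\quad(1\le i<t),\qquad\text{and}\qquad a_{k-2}-a_{k-1}\ \ge\ a[t-1].$$ Moreover, for every $t\ge 0$ there are $n$, $k$ and $S$ as above for which all of these inequalities are equalities. -/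

import Mathlib

open Finset
open scoped FinsetFamily

/-- `a 0 > a 1 > ⋯ > a (ℓ - 1)` (the values of `a` from `ℓ` on are irrelevant) is the `k`-binomial
decomposition, of length `ℓ`, of the positive integer `m`:
`m = C(a 0, k) + C(a 1, k - 1) + ⋯ + C(a (ℓ - 1), k - ℓ + 1)` with `1 ≤ ℓ ≤ k` and
`a (ℓ - 1) ≥ k - (ℓ - 1) ≥ 1`. -/
def IsBinomialDecomposition (k m ℓ : ℕ) (a : ℕ → ℕ) : Prop :=
  1 ≤ ℓ ∧ ℓ ≤ k ∧
  (∀ i, i + 1 < ℓ → a (i + 1) < a i) ∧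
  k - (ℓ - 1) ≤ a (ℓ - 1) ∧
  m = ∑ i ∈ range ℓ, (a i).choose (k - i)

/-- A family `S` of `k`-subsets of `[n]` is extremal if it is nonempty and, for the `k`-binomial
decomposition `m = ∑ C(a i, k - i)` of `m = |S|`, its shadow has the minimum cardinality
`∑ C(a i, k - 1 - i)` allowed by the Kruskal--Katona theorem. -/
def IsExtremal {n : ℕ} (k : ℕ) (S : Finset (Finset (Fin n))) : Prop :=
  (S : Set (Finset (Fin n))).Sized k ∧
  ∃ (ℓ : ℕ) (a : ℕ → ℕ), IsBinomialDecomposition k S.card ℓ a ∧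
    (∂ S).card = ∑ i ∈ range ℓ, (a i).choose (k - 1 - i)

/-- A family `S` of `r`-subsets of `[n]` is, up to a permutation of `[n]`, an initial segment of
the colex order on the `r`-subsets of `[n]`. -/
def IsColexInitSeg {n : ℕ} (r : ℕ) (S : Finset (Finset (Fin n))) : Prop :=
  ∃ σ : Equiv.Perm (Fin n), Finset.Colex.IsInitSeg (S.image fun s => s.image σ) r

/-- Hamilton's numbers `h[1] = 2` and
`h[n] = 2 + ∑_{i=1}^{n-1} (-1)^(i+1) * h[n-i] (h[n-i] - 1) ⋯ (h[n-i] - i) / (i+1)!` for `n > 1`,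
written here at `n + 1` and summed over `j = n - i`, so that `h[n+1-i] = h[j+1]`; the value at `0` is not used. -/
def hamilton : ℕ → ℤ
  | 0 => 1
  | n + 1 => 2 + ∑ j : Fin n,
      (-1) ^ (n - j.val + 1) * Ring.choose (hamilton (j.val + 1)) (n - j.val + 1)
termination_by n => n

/-- The hypotenusal numbers `a[i]`, `i ≥ -1`: `a[-1] = a[0] = 1` and `a[i] = h[i+1] - h[i]` for
`i > 0`. (The values at `i < -1` are not used.) -/
def hypotenusal (i : ℤ) : ℤ :=
  if i ≤ 0 then 1 else hamilton (i.toNat + 1) - hamilton i.toNat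

/-!
# Gaps in the binomial decomposition of extremal families

Let `minShadow k m` be the smallest size of the shadow of `m` sets of size `k`, so that a family is
extremal if the size of its shadow is given by this function. Let `S` be an extremal family of
`k`-sets of size `m = C(a 0, k) + ⋯ + C(a (k - 1), 1)`. By the formula for `minShadow`, this
function is constant from `m` to the point where the last entry reaches `a (k - 2)`, and then it
increases (`add_le_of_plateau`). The bound for the last gap therefore says that `m` is the start of
a long plateau of `minShadow`. The other gaps are obtained from the iterated shadows of `S`, which
are extremal as well and whose decompositions end with the entries `a (k - 2 - j)` and
`a (k - 1 - j) + 1`.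

To find plateaus, sort the points by which of them can be replaced by which others in the faces of
size `r = k - t`. If this does not exhibit the `r`-faces as an initial segment of the colex order,
there is a local obstruction: two incomparable points, or a face and a nonface in the wrong order
(`isColexInitSeg_of_not_obstructed`). For `t ≥ 1`, all extremal families with such an obstruction
start a plateau of length `hypotenusal (t - 1)`, by induction on `r` plus the number of points which
are not cone points (`plateau_of_obstructed`). Indeed, at a point which is not a cone point, an
extremal family splits into two extremal families, the deletion and the link, the sizes of the
shadows add up (`Extremal.split`), and by the subadditivity of `minShadow` a plateau of either part
gives one of the whole. Moreover, cone points may be added and the family may be saturated. In a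
minimal counterexample no deletion or link is obstructed, and this determines it almost completely:
it has three or four points besides the cone points, and its size is one of
`C(y, k) + 4 C(y, k - 1) + e C(y, k - 2)` with `2 ≤ e ≤ 4` (`IsMinimal.exists_card_eq`).

For these numbers the binomial decomposition is explicit. The identity `choose_sub_choose_eq_sum`
holds because both sides have the same differences and because it reduces to the recursion for
Hamilton's numbers at one point; it shows that the gaps are differences of consecutive Hamilton
numbers. Since these differences are nondecreasing, the smallest plateau is the one claimed. For
`e = 4` and `k = t + 2` all the gaps are as small as possible, and the corresponding families
consist of all `k`-sets which contain neither of two disjoint pairs; their `2`-faces are not an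
initial segment. For `t = 0` an ad hoc family of triples is used, as the bound `1` is trivial.

In the lemmas up to `plateau_of_obstructed` the sets have size `k + 1` with `k = r + t`, so that `t`
there is smaller by one than in the theorem.
-/

namespace KruskalKatona

/-! ### The Kruskal–Katona function -/

/-- For a monotone function `f` vanishing at `0`, and `g w = linkCount f w + f (linkCount f w)`, the
number `v = linkCount f m` is the least one such that `g (m - v) ≤ v`. For `f = minShadow k` it is
the size of the link of a cone point in an extremal family of `m` sets of size `k + 1`. As `m` grows
by one, the value either stays the same or grows by one, and this is used as a recursive definition.
The outer condition only makes the recursion well-founded: it fails for `m + 1 = 1` alone. -/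
def linkCount (f : ℕ → ℕ) : ℕ → ℕ
  | 0 => 0
  | m + 1 =>
    if _h : m + 1 - linkCount f m < m + 1 then
      if linkCount f (m + 1 - linkCount f m) + f (linkCount f (m + 1 - linkCount f m))
          ≤ linkCount f m then linkCount f m
      else linkCount f m + 1
    else 1
termination_by m => m

/-- The smallest size of the shadow of `m` sets of size `k`, defined without reference to binomial
decompositions: for a cone with apex `x` the shadow consists of the link of `x` and of the sets
`insert x B` with `B` in the shadow of this link. -/
def minShadow : ℕ → ℕ → ℕ
  | 0 => fun _ => 0
  | k + 1 => fun m => linkCount (minShadow k) m + minShadow k (linkCount (minShadow k) m)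

section LinkCount

variable {f : ℕ → ℕ}

@[simp] lemma linkCount_zero : linkCount f 0 = 0 := by rw [linkCount]

lemma linkCount_one : linkCount f 1 = 1 := by
  rw [linkCount]; simp

lemma linkCount_pos_le (m : ℕ) : 1 ≤ linkCount f (m + 1) ∧ linkCount f (m + 1) ≤ m + 1 := by
  induction m with
  | zero => simp [linkCount_one]
  | succ m ih =>
    rw [linkCount]
    split_ifs <;> omega

lemma linkCount_le (m : ℕ) : linkCount f m ≤ m := by
  cases m with
  | zero => simp
  | succ m => exact (linkCount_pos_le m).2

lemma linkCount_succ_of_le {m : ℕ} (hm : 1 ≤ m)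
    (h : linkCount f (m + 1 - linkCount f m) + f (linkCount f (m + 1 - linkCount f m))
      ≤ linkCount f m) : linkCount f (m + 1) = linkCount f m := by
  obtain ⟨m, rfl⟩ : ∃ n, m = n + 1 := ⟨m - 1, by omega⟩
  have := linkCount_pos_le (f := f) m
  rw [linkCount, dif_pos (by omega), if_pos h]

lemma linkCount_succ_of_lt {m : ℕ}
    (h : linkCount f m < linkCount f (m + 1 - linkCount f m)
      + f (linkCount f (m + 1 - linkCount f m))) :
    linkCount f (m + 1) = linkCount f m + 1 := by
  rw [linkCount]
  split_ifs with h1 h2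
  · omega
  · rfl
  · cases m with
    | zero => simp
    | succ m =>
      have := linkCount_pos_le (f := f) m
      omega

lemma linkCount_succ_cases (m : ℕ) :
    linkCount f (m + 1) = linkCount f m ∨ linkCount f (m + 1) = linkCount f m + 1 := by
  rcases Nat.eq_zero_or_pos m with rfl | hm
  · right; simp [linkCount_one]
  · rcases le_or_gt (linkCount f (m + 1 - linkCount f m)
      + f (linkCount f (m + 1 - linkCount f m))) (linkCount f m) with h | h
    · exact Or.inl (linkCount_succ_of_le hm h)
    · exact Or.inr (linkCount_succ_of_lt h)

lemma linkCount_mono : Monotone (linkCount f) :=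
  monotone_nat_of_le_succ fun m => by
    rcases linkCount_succ_cases (f := f) m with h | h <;> omega

lemma sub_linkCount_mono : Monotone fun m => m - linkCount f m :=
  monotone_nat_of_le_succ fun m => by
    have := linkCount_le (f := f) m
    rcases linkCount_succ_cases (f := f) m with h | h <;> simp only [h] <;> omega

/-- The property which characterises `linkCount f m` as the least `v` with
`linkCount f (m - v) + f (linkCount f (m - v)) ≤ v`. -/
lemma linkCount_spec (hf : Monotone f) (h0 : f 0 = 0) (m : ℕ) :
    linkCount f (m - linkCount f m) + f (linkCount f (m - linkCount f m)) ≤ linkCount f m ∧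
    ∀ w, m - linkCount f m < w → linkCount f m ≤ linkCount f w + f (linkCount f w) := by
  have hG : Monotone fun w => linkCount f w + f (linkCount f w) :=
    fun a b hab => add_le_add (linkCount_mono hab) (hf (linkCount_mono hab))
  induction m with
  | zero => simp [h0]
  | succ m ih =>
    rcases Nat.eq_zero_or_pos m with rfl | hm
    · simp only [zero_add, linkCount_one, Nat.sub_self, linkCount_zero, h0]
      refine ⟨by omega, fun w hw => ?_⟩
      have := linkCount_mono (f := f) (show 1 ≤ w from hw)
      rw [linkCount_one] at this
      omega
    rcases le_or_gt (linkCount f (m + 1 - linkCount f m)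
      + f (linkCount f (m + 1 - linkCount f m))) (linkCount f m) with h | h
    · rw [linkCount_succ_of_le hm h]
      exact ⟨h, fun w hw => ih.2 w (by omega)⟩
    · rw [linkCount_succ_of_lt h]
      refine ⟨?_, fun w hw => ?_⟩
      · rw [show m + 1 - (linkCount f m + 1) = m - linkCount f m by omega]
        exact ih.1.trans (Nat.le_succ _)
      · have h1 := hG (show m + 1 - linkCount f m ≤ w by omega)
        simp only at h1
        omega

end LinkCount

@[simp] lemma minShadow_zero_left (m : ℕ) : minShadow 0 m = 0 := rfl

lemma minShadow_succ (k m : ℕ) :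
    minShadow (k + 1) m = linkCount (minShadow k) m + minShadow k (linkCount (minShadow k) m) :=
  rfl

lemma minShadow_mono_zero (k : ℕ) : Monotone (minShadow k) ∧ minShadow k 0 = 0 := by
  induction k with
  | zero => exact ⟨fun _ _ _ => le_rfl, rfl⟩
  | succ k ih =>
    refine ⟨fun a b hab => ?_, ?_⟩
    · exact add_le_add (linkCount_mono hab) (ih.1 (linkCount_mono hab))
    · simp [minShadow_succ, ih.2]

lemma minShadow_mono (k : ℕ) : Monotone (minShadow k) := (minShadow_mono_zero k).1

@[simp] lemma minShadow_zero_right (k : ℕ) : minShadow k 0 = 0 := (minShadow_mono_zero k).2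

lemma minShadow_sub_linkCount (k m : ℕ) :
    minShadow (k + 1) (m - linkCount (minShadow k) m) ≤ linkCount (minShadow k) m :=
  (linkCount_spec (minShadow_mono k) (minShadow_zero_right k) m).1

lemma linkCount_le_minShadow {k m w : ℕ} (h : m - linkCount (minShadow k) m < w) :
    linkCount (minShadow k) m ≤ minShadow (k + 1) w :=
  (linkCount_spec (minShadow_mono k) (minShadow_zero_right k) m).2 w h

lemma linkCount_eq {k m v : ℕ} (hv : v ≤ m) (h1 : minShadow (k + 1) (m - v) ≤ v)
    (h2 : v ≤ minShadow (k + 1) (m - v + 1)) : linkCount (minShadow k) m = v := by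
  refine le_antisymm ?_ ?_
  · by_contra! h
    have := linkCount_le_minShadow (k := k) (m := m) (w := m - v)
      (by have := linkCount_le (f := minShadow k) m; omega)
    omega
  · by_contra! h
    have h3 := minShadow_mono (k + 1)
      (show m - v + 1 ≤ m - linkCount (minShadow k) m by omega)
    have h4 := minShadow_sub_linkCount k m
    omega

/-- The link of a cone point in the shadow is the shadow of the link. -/
lemma linkCount_minShadow (k m : ℕ) :
    linkCount (minShadow k) (minShadow (k + 1 + 1) m)
      = minShadow (k + 1) (linkCount (minShadow (k + 1)) m) := by
  have h := minShadow_succ (k + 1) m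
  have h' : minShadow (k + 1 + 1) m - minShadow (k + 1) (linkCount (minShadow (k + 1)) m)
      = linkCount (minShadow (k + 1)) m := by omega
  refine linkCount_eq (by omega) ?_ ?_
  · rw [h']
  · rw [h']; exact minShadow_mono _ (Nat.le_succ _)

lemma minShadow_one_le (m : ℕ) : minShadow 1 m ≤ 1 := by
  rw [minShadow_succ, minShadow_zero_left, add_zero]
  induction m with
  | zero => simp
  | succ m ih =>
    rcases Nat.eq_zero_or_pos m with rfl | hm
    · simp [linkCount_one]
    obtain ⟨m, rfl⟩ : ∃ n, m = n + 1 := ⟨m - 1, by omega⟩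
    have h1 := linkCount_pos_le (f := minShadow 0) m
    rw [linkCount_succ_of_le (by omega)]
    · exact ih
    · have h2 : linkCount (minShadow 0) (m + 1) = 1 := by omega
      rw [h2]; simp only [minShadow_zero_left, add_zero]
      simpa using h2.le

/-- The subadditivity of `minShadow` behind the Kruskal–Katona theorem: `u` and `v` are the sizes of
the deletion and of the link of a point. -/
theorem minShadow_add_le (k u v : ℕ) :
    minShadow (k + 1) (u + v) ≤ minShadow k v + max v (minShadow (k + 1) u) := by
  induction k generalizing u v with
  | zero =>
    rcases Nat.eq_zero_or_pos v with rfl | hv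
    · simp
    · have := minShadow_one_le (u + v)
      have := le_max_left v (minShadow (0 + 1) u)
      simp only [zero_add, minShadow_zero_left] at *
      omega
  | succ k ih =>
    induction hm : u + v using Nat.strong_induction_on generalizing u v with
    | _ m IH =>
    subst hm
    set m := u + v with hm
    -- If `v` is small, decompose both `u` and `v` once more; otherwise monotonicity is enough.
    rcases le_or_gt v (minShadow (k + 1 + 1) u) with hv | hv
    · rw [max_eq_right hv]
      have hvu : linkCount (minShadow k) v
        ≤ minShadow (k + 1) (linkCount (minShadow (k + 1)) u) := by
        rw [← linkCount_minShadow]; exact linkCount_mono hv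
      have hd : linkCount (minShadow (k + 1)) m
          ≤ linkCount (minShadow (k + 1)) u + linkCount (minShadow k) v := by
        by_contra! hlt
        have hmpos : 0 < m := by
          by_contra! h0
          rw [Nat.le_zero.1 h0] at hlt; simp at hlt
        have hu1 := linkCount_le (f := minShadow (k + 1)) u
        have hv1 := linkCount_le (f := minShadow k) v
        have hmm1 := linkCount_le (f := minShadow (k + 1)) m
        have hs : 1 ≤ linkCount (minShadow (k + 1)) u + linkCount (minShadow k) v := by
          rcases Nat.eq_zero_or_pos u with h0 | h0
          · have := linkCount_pos_le (f := minShadow k) (v - 1)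
            rw [show v - 1 + 1 = v by omega] at this; omega
          · have := linkCount_pos_le (f := minShadow (k + 1)) (u - 1)
            rw [show u - 1 + 1 = u by omega] at this; omega
        have h1 := linkCount_le_minShadow (k := k + 1) (m := m)
          (w := (u - linkCount (minShadow (k + 1)) u) + (v - linkCount (minShadow k) v))
          (by omega)
        have h2 := IH ((u - linkCount (minShadow (k + 1)) u) + (v - linkCount (minShadow k) v))
          (by omega) _ _ rfl
        have h3 := minShadow_sub_linkCount k v
        have h4 := minShadow_sub_linkCount (k + 1) u
        have h5 : v - linkCount (minShadow k) v ≤ linkCount (minShadow (k + 1)) u := by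
          have := sub_linkCount_mono (f := minShadow k) hv
          simp only [linkCount_minShadow] at this
          have h6 := minShadow_succ (k + 1) u
          omega
        have h7 := max_le h5 h4
        omega
      have h1 := ih (linkCount (minShadow (k + 1)) u) (linkCount (minShadow k) v)
      rw [max_eq_right hvu] at h1
      have h2 := minShadow_mono (k + 1) hd
      have e1 := minShadow_succ (k + 1) m
      have e2 := minShadow_succ (k + 1) u
      have e3 := minShadow_succ k v
      omega
    · rw [max_eq_left hv.le]
      have hmle := linkCount_le (f := minShadow (k + 1)) m
      rcases le_or_gt (linkCount (minShadow (k + 1)) m) v with h | h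
      · have := minShadow_mono (k + 1) h
        rw [minShadow_succ (k + 1) m]; omega
      · have := linkCount_le_minShadow (k := k + 1) (m := m) (w := u) (by omega)
        omega

lemma minShadow_add_le_of_le {k u v : ℕ} (h : v ≤ minShadow (k + 1) u) :
    minShadow (k + 1) (u + v) ≤ minShadow k v + minShadow (k + 1) u := by
  simpa [max_eq_right h] using minShadow_add_le k u v

lemma linkCount_add_le {k u v : ℕ} (hv : v ≤ minShadow (k + 1 + 1) u) :
    linkCount (minShadow (k + 1)) (u + v)
      ≤ linkCount (minShadow (k + 1)) u + linkCount (minShadow k) v := by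
  by_contra! hlt
  have hu1 := linkCount_le (f := minShadow (k + 1)) u
  have hv1 := linkCount_le (f := minShadow k) v
  have hmm1 := linkCount_le (f := minShadow (k + 1)) (u + v)
  have h1 := linkCount_le_minShadow (k := k + 1) (m := u + v)
    (w := (u - linkCount (minShadow (k + 1)) u) + (v - linkCount (minShadow k) v))
    (by omega)
  have h2 := minShadow_add_le (k + 1) (u - linkCount (minShadow (k + 1)) u)
    (v - linkCount (minShadow k) v)
  have h3 := minShadow_sub_linkCount k v
  have h4 := minShadow_sub_linkCount (k + 1) u
  have h5 : v - linkCount (minShadow k) v ≤ linkCount (minShadow (k + 1)) u := by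
    have := sub_linkCount_mono (f := minShadow k) hv
    simp only [linkCount_minShadow] at this
    have h6 := minShadow_succ (k + 1) u
    omega
  have h7 := max_le h5 h4
  omega

lemma minShadow_succ_minShadow (k m : ℕ) :
    minShadow (k + 1) (minShadow (k + 1 + 1) m)
      = minShadow (k + 1) (linkCount (minShadow (k + 1)) m)
        + minShadow k (minShadow (k + 1) (linkCount (minShadow (k + 1)) m)) := by
  rw [minShadow_succ k, linkCount_minShadow]

/-- Equality in the subadditivity of `minShadow` is inherited by the shadows. This is the numerical
form of the fact that shadows of extremal families are extremal. -/
theorem minShadow_minShadow_add {k u v : ℕ} (hv : v ≤ minShadow (k + 1) u)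
    (h : minShadow (k + 1) u + minShadow k v = minShadow (k + 1) (u + v)) :
    minShadow k (minShadow (k + 1) u) + minShadow (k - 1) (minShadow k v)
      = minShadow k (minShadow (k + 1) (u + v)) := by
  induction k generalizing u v with
  | zero => simp
  | succ k ih =>
    have hd := linkCount_add_le hv
    have hvu : linkCount (minShadow k) v
        ≤ minShadow (k + 1) (linkCount (minShadow (k + 1)) u) := by
      rw [← linkCount_minShadow]; exact linkCount_mono hv
    have h1 := minShadow_add_le_of_le hvu
    have h2 := minShadow_mono (k + 1) hd
    have e1 := minShadow_succ (k + 1) (u + v)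
    have e2 := minShadow_succ (k + 1) u
    have e3 := minShadow_succ k v
    have hdd : linkCount (minShadow (k + 1)) u + linkCount (minShadow k) v
      = linkCount (minShadow (k + 1)) (u + v) := by omega
    have h3 := ih hvu (by rw [hdd]; rw [hdd] at h1; omega)
    rw [hdd] at h3 h1
    rw [minShadow_succ_minShadow, minShadow_succ_minShadow, ← h3, Nat.add_sub_cancel]
    have e4 : minShadow k (minShadow (k + 1) v)
        = minShadow k (linkCount (minShadow k) v)
          + minShadow (k - 1) (minShadow k (linkCount (minShadow k) v)) := by
      cases k with
      | zero => simp
      | succ k => exact minShadow_succ_minShadow k v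
    omega

/-- The size of a cone over an extremal family of `m` sets starts a plateau of `minShadow` only if
`m` does. -/
lemma plateau_of_cone {k m g : ℕ}
    (h : minShadow (k + 1) (m + minShadow (k + 1) m + g)
      ≤ minShadow (k + 1) (m + minShadow (k + 1) m)) :
    minShadow (k + 1) (m + g) ≤ minShadow (k + 1) m := by
  have e : linkCount (minShadow k) (m + minShadow (k + 1) m) = minShadow (k + 1) m :=
    linkCount_eq (by omega) (by simp) (by simpa using minShadow_mono (k + 1) (Nat.le_succ m))
  have h1 := linkCount_mono (f := minShadow k)
    (show m + minShadow (k + 1) m ≤ m + minShadow (k + 1) m + g by omega)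
  have h2 := minShadow_mono k h1
  rw [minShadow_succ k (m + minShadow (k + 1) m + g),
    minShadow_succ k (m + minShadow (k + 1) m)] at h
  have h3 : linkCount (minShadow k) (m + minShadow (k + 1) m + g) = minShadow (k + 1) m := by
    omega
  have h4 := minShadow_sub_linkCount k (m + minShadow (k + 1) m + g)
  rw [h3] at h4
  rwa [show m + minShadow (k + 1) m + g - minShadow (k + 1) m = m + g by omega] at h4

/-! ### Binomial decompositions -/

lemma linkCount_pos {f : ℕ → ℕ} {m : ℕ} (hm : 1 ≤ m) : 1 ≤ linkCount f m := by
  obtain ⟨m, rfl⟩ : ∃ n, m = n + 1 := ⟨m - 1, by omega⟩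
  exact (linkCount_pos_le m).1

lemma minShadow_choose_of_add {k : ℕ}
    (h : ∀ a m', k ≤ a → 1 ≤ m' → m' ≤ a.choose k →
      minShadow (k + 1) (a.choose (k + 1) + m') = a.choose k + minShadow k m')
    (h' : ∀ a, k ≤ a → 1 ≤ k → minShadow k (a.choose k) = a.choose (k - 1))
    {a : ℕ} (ha : k + 1 ≤ a) : minShadow (k + 1) (a.choose (k + 1)) = a.choose k := by
  obtain ⟨b, rfl⟩ : ∃ b, a = b + 1 := ⟨a - 1, by omega⟩
  rw [Nat.choose_succ_succ, add_comm (b.choose k),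
    h b _ (by omega) (Nat.choose_pos (by omega)) le_rfl]
  cases k with
  | zero => simp
  | succ k =>
    rw [h' b (by omega) (by omega), Nat.choose_succ_succ, add_comm, Nat.add_sub_cancel]

/-- One step of the greedy computation of `minShadow`, proved together with its value at a binomial
coefficient by induction on `k`, and for each `k` by induction on `a`. -/
theorem minShadow_choose_add_and (k : ℕ) :
    (∀ a m', k ≤ a → 1 ≤ m' → m' ≤ a.choose k →
      minShadow (k + 1) (a.choose (k + 1) + m') = a.choose k + minShadow k m') ∧
    (∀ a, k + 1 ≤ a → minShadow (k + 1) (a.choose (k + 1)) = a.choose k) := by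
  induction k with
  | zero =>
    have h : ∀ a m', 0 ≤ a → 1 ≤ m' → m' ≤ a.choose 0 →
        minShadow (0 + 1) (a.choose (0 + 1) + m') = a.choose 0 + minShadow 0 m' := by
      intro a m' _ h1 _
      have h2 := minShadow_one_le (a.choose (0 + 1) + m')
      have h3 := linkCount_pos (f := minShadow 0) (show 1 ≤ a.choose (0 + 1) + m' by omega)
      have h4 := minShadow_succ 0 (a.choose (0 + 1) + m')
      simp only [zero_add, Nat.choose_zero_right, minShadow_zero_left] at *
      omega
    exact ⟨h, fun a ha => minShadow_choose_of_add h (by simp) ha⟩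
  | succ k ih =>
    obtain ⟨ih1, ih2⟩ := ih
    have hlink : ∀ b, k + 1 ≤ b →
        linkCount (minShadow k) ((b + 1).choose (k + 1)) = b.choose k := by
      intro b hb
      have e := Nat.choose_succ_succ b k
      simp only [Nat.succ_eq_add_one] at e
      refine linkCount_eq (by omega) ?_ ?_
      · rw [e, Nat.add_sub_cancel_left]; exact (ih2 b hb).le
      · rw [e, Nat.add_sub_cancel_left]
        exact (ih2 b hb).ge.trans (minShadow_mono _ (Nat.le_succ _))
    have h : ∀ a, minShadow (k + 1 + 1) (a.choose (k + 1 + 1)) ≤ a.choose (k + 1) ∧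
        ∀ m', k + 1 ≤ a → 1 ≤ m' → m' ≤ a.choose (k + 1) →
          minShadow (k + 1 + 1) (a.choose (k + 1 + 1) + m')
            = a.choose (k + 1) + minShadow (k + 1) m' := by
      intro a
      induction a with
      | zero => exact ⟨by simp, fun m' h => by omega⟩
      | succ b IH =>
        obtain ⟨hzero, IH⟩ := IH
        refine ⟨?_, ?_⟩
        · rcases Nat.lt_or_ge b (k + 1) with hb | hb
          · rw [Nat.choose_eq_zero_of_lt (by omega)]; simp
          · rw [Nat.choose_succ_succ b (k + 1), add_comm (b.choose (k + 1)),
              IH _ hb (Nat.choose_pos hb) le_rfl, ih2 b hb, Nat.choose_succ_succ b k, add_comm]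
        intro m' hb h1 h2
        rcases Nat.lt_or_ge b (k + 1) with hb' | hb'
        · obtain rfl : b = k := by omega
          have hm : m' = 1 := by simp at h2; omega
          subst hm
          rw [Nat.choose_eq_zero_of_lt (by omega : b + 1 < b + 1 + 1), zero_add, minShadow_succ,
            linkCount_one, Nat.choose_self]
        · have hl := hlink b hb'
          have e := Nat.choose_succ_succ b k
          have e1 := Nat.choose_succ_succ b (k + 1)
          simp only [Nat.succ_eq_add_one] at e e1
          have hs := linkCount_mono (f := minShadow k) h2
          rw [hl] at hs
          have ht := sub_linkCount_mono (f := minShadow k) h2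
          simp only [hl] at ht
          have hsl := linkCount_le (f := minShadow k) m'
          have hsp := linkCount_pos (f := minShadow k) h1
          have hF1 := minShadow_sub_linkCount k m'
          have hF2 := linkCount_le_minShadow (k := k) (m := m')
            (w := m' - linkCount (minShadow k) m' + 1) (by omega)
          -- Pascal's rule splits off the link of a cone point from both summands.
          have key : linkCount (minShadow (k + 1)) ((b + 1).choose (k + 1 + 1) + m')
              = b.choose (k + 1) + linkCount (minShadow k) m' := by
            have e2 : (b + 1).choose (k + 1 + 1) + m'
                - (b.choose (k + 1) + linkCount (minShadow k) m')
                = b.choose (k + 1 + 1) + (m' - linkCount (minShadow k) m') := by omega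
            refine linkCount_eq (by omega) ?_ ?_
            · rw [e2]
              rcases Nat.eq_zero_or_pos (m' - linkCount (minShadow k) m') with h0 | h0
              · rw [h0, add_zero]; omega
              · rw [IH _ hb' h0 (by omega)]; omega
            · rw [e2, add_assoc (b.choose _)]
              rcases Nat.lt_or_ge (m' - linkCount (minShadow k) m') (b.choose (k + 1)) with h0 | h0
              · rw [IH _ hb' (by omega) h0, Nat.succ_eq_add_one]; omega
              · have h3 := IH _ hb' (Nat.choose_pos hb') le_rfl
                rw [ih2 b hb'] at h3
                have h4 := minShadow_mono (k + 1 + 1)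
                  (show b.choose (k + 1 + 1) + b.choose (k + 1)
                    ≤ b.choose (k + 1 + 1) + (m' - linkCount (minShadow k) m' + 1) by omega)
                omega
          rw [minShadow_succ (k + 1), key, ih1 b _ (by omega) hsp hs, minShadow_succ k m']
          omega
    exact ⟨fun a => (h a).2, fun a ha =>
      minShadow_choose_of_add (fun a => (h a).2) (fun a ha _ => ih2 a ha) ha⟩

lemma minShadow_choose_add {k a m : ℕ} (ha : k ≤ a) (h1 : 1 ≤ m) (h2 : m ≤ a.choose k) :
    minShadow (k + 1) (a.choose (k + 1) + m) = a.choose k + minShadow k m :=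
  (minShadow_choose_add_and k).1 a m ha h1 h2

lemma minShadow_choose {k a : ℕ} (ha : k + 1 ≤ a) :
    minShadow (k + 1) (a.choose (k + 1)) = a.choose k :=
  (minShadow_choose_add_and k).2 a ha

/-- The Kruskal–Katona formula for `minShadow`. The last two of the entries `a i` are allowed to be
equal if the decomposition has length `k`, since `C(a, 2) + C(a, 1) = C(a + 1, 2)`. -/
theorem minShadow_sum_choose (ℓ : ℕ) : ∀ (k : ℕ) (a : ℕ → ℕ), 1 ≤ ℓ → ℓ ≤ k →
    (∀ i, i + 1 < ℓ → a (i + 1) < a i ∨ (i + 2 = k ∧ a (i + 1) ≤ a i)) →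
    k - (ℓ - 1) ≤ a (ℓ - 1) →
    k ≤ a 0 + 1 ∧ 1 ≤ ∑ i ∈ range ℓ, (a i).choose (k - i) ∧
    ∑ i ∈ range ℓ, (a i).choose (k - i) ≤ (a 0 + 1).choose k ∧
    minShadow k (∑ i ∈ range ℓ, (a i).choose (k - i))
      = ∑ i ∈ range ℓ, (a i).choose (k - 1 - i) := by
  induction ℓ with
  | zero => intro k a h; omega
  | succ ℓ ih =>
    intro k a _ hk hdec hlast
    obtain ⟨k, rfl⟩ : ∃ j, k = j + 1 := ⟨k - 1, by omega⟩
    rcases Nat.eq_zero_or_pos ℓ with rfl | hℓ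
    · simp only [zero_add, sum_range_one, Nat.sub_zero, Nat.sub_self, Nat.add_sub_cancel] at *
      exact ⟨by omega, Nat.choose_pos hlast, Nat.choose_le_succ _ _, minShadow_choose hlast⟩
    · obtain ⟨h0, h1, h2, h3⟩ := ih k (fun i => a (i + 1)) hℓ (by omega)
        (fun i hi => by
          rcases hdec (i + 1) (by omega) with h | ⟨h, h'⟩
          · exact Or.inl h
          · exact Or.inr ⟨by omega, h'⟩)
        (by simp only [Nat.sub_add_cancel hℓ]; simp only [Nat.add_sub_cancel] at hlast; omega)
      rw [sum_range_succ', sum_range_succ']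
      simp only [Nat.sub_zero, Nat.add_sub_cancel, Nat.add_sub_add_right] at hlast h1 h2 h3 ⊢
      simp only [zero_add] at h0 h2
      have h4 : ∑ i ∈ range ℓ, (a (i + 1)).choose (k - (i + 1))
          = ∑ i ∈ range ℓ, (a (i + 1)).choose (k - 1 - i) :=
        sum_congr rfl fun i _ => by rw [Nat.sub_sub, add_comm 1]
      rw [h4]
      have hle : ∑ i ∈ range ℓ, (a (i + 1)).choose (k - i) ≤ (a 0).choose k := by
        rcases hdec 0 (by omega) with h | ⟨h, h'⟩
        · exact h2.trans (Nat.choose_le_choose _ h)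
        · obtain rfl : ℓ = 1 := by omega
          obtain rfl : k = 1 := by omega
          simpa using h'
      have hk0 : k ≤ a 0 := by
        rcases hdec 0 (by omega) with h | ⟨h, h'⟩
        · simp only [zero_add] at h; omega
        · simp only [zero_add] at h'
          obtain rfl : k = 1 := by omega
          obtain rfl : ℓ = 1 := by omega
          simp at hlast
          omega
      refine ⟨by omega, by omega, ?_, ?_⟩
      · rw [Nat.choose_succ_succ (a 0) k]; simp only [Nat.succ_eq_add_one]; omega
      · rw [add_comm _ ((a 0).choose (k + 1)), minShadow_choose_add hk0 h1 hle, h3, add_comm]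

lemma two_le_minShadow_one {k : ℕ} : 2 ≤ minShadow (k + 1 + 1) 1 := by
  have h : 1 ≤ minShadow (k + 1) 1 := by
    rw [minShadow_succ, linkCount_one]; omega
  rw [minShadow_succ, linkCount_one]; omega

/-- Raising the last entry of a decomposition of full length above the previous one forces a carry,
which makes `minShadow` larger. -/
lemma sum_choose_lt_minShadow (k : ℕ) : ∀ a : ℕ → ℕ, (∀ i < k, a (i + 1) < a i) → 1 ≤ a k →
    ∑ i ∈ range (k + 1), (a i).choose (k + 1 - i) + 2
      ≤ minShadow (k + 1 + 1) (∑ i ∈ range (k + 1), (a i).choose (k + 1 + 1 - i) + a k + 1) := by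
  induction k with
  | zero =>
    intro a _ h
    have e := Nat.choose_succ_succ (a 0) 1
    simp only [Nat.succ_eq_add_one, Nat.choose_one_right] at e
    have h1 := minShadow_choose_add (k := 1) (a := a 0 + 1) (m := 1) (by omega) le_rfl (by simp)
    have h2 : minShadow 1 1 = 1 := by simp [minShadow_succ, linkCount_one]
    simp only [zero_add, sum_range_one, Nat.sub_zero, Nat.choose_one_right] at *
    rw [e, h2] at h1
    rw [show (a 0).choose (1 + 1) + a 0 + 1 = a 0 + (a 0).choose (1 + 1) + 1 by omega, h1]
  | succ k ih =>
    intro a hdec hlast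
    have h1 := ih (fun i => a (i + 1)) (fun i hi => hdec (i + 1) (by omega)) hlast
    rw [sum_range_succ', sum_range_succ' _ (k + 1)]
    simp only [Nat.sub_zero, Nat.add_sub_add_right] at *
    set R := ∑ i ∈ range (k + 1), (a (i + 1)).choose (k + 1 + 1 - i) + a (k + 1) + 1 with hR
    have hmono : ∀ i ≤ k + 1, a (k + 1) + (k + 1 - i) ≤ a i := by
      intro i hi
      induction hj : k + 1 - i generalizing i with
      | zero => obtain rfl : i = k + 1 := by omega
                simp
      | succ j IHj =>
        have := IHj (i + 1) (by omega) (by omega)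
        have := hdec i (by omega)
        omega
    have h0 := hmono 0 (by omega)
    have hw := minShadow_sum_choose (k + 1 + 1) (k + 1 + 1) (fun i => a (min (i + 1) (k + 1)))
      (by omega) le_rfl (fun i hi => by
        rcases Nat.lt_or_ge i k with h | h
        · left
          simp only [show min (i + 1) (k + 1) = i + 1 by omega,
            show min (i + 1 + 1) (k + 1) = i + 1 + 1 by omega]
          exact hdec _ (by omega)
        · right
          simp [show min (i + 1) (k + 1) = k + 1 by omega,
            show min (i + 1 + 1) (k + 1) = k + 1 by omega]
          omega) (by
        simp only [Nat.add_sub_cancel, show min (k + 1 + 1) (k + 1) = k + 1 by omega]; omega)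
    have hu := minShadow_sum_choose (k + 1) (k + 1) (fun i => a (i + 1)) (by omega) le_rfl
      (fun i hi => Or.inl (hdec (i + 1) (by omega)))
      (by simp only [Nat.add_sub_cancel]; omega)
    have e : ∑ i ∈ range (k + 1 + 1), (a (min (i + 1) (k + 1))).choose (k + 1 + 1 - i) + 1 = R := by
      rw [sum_range_succ, hR, show min (k + 1 + 1) (k + 1) = k + 1 by omega,
        show k + 1 + 1 - (k + 1) = 1 by omega, Nat.choose_one_right]
      congr 2
      exact sum_congr rfl fun i hi => by
        rw [mem_range] at hi; rw [show min (i + 1) (k + 1) = i + 1 by omega]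
    have hR1 : R ≤ (a 0).choose (k + 1 + 1) + 1 := by
      have h2 := hw.2.2.1
      have h3 : (a (min (0 + 1) (k + 1)) + 1).choose (k + 1 + 1) ≤ (a 0).choose (k + 1 + 1) :=
        Nat.choose_le_choose _ (by
          rw [show min (0 + 1) (k + 1) = 0 + 1 by omega]; exact hdec 0 (by omega))
      omega
    -- The carry may propagate up to the first entry; then the sum is `C(a 0 + 1, k + 3) + 1`.
    rcases Nat.lt_or_ge ((a 0).choose (k + 1 + 1)) R with h | h
    · have h2 := hu.2.2.1
      have h3 : (a (0 + 1) + 1).choose (k + 1) ≤ (a 0).choose (k + 1) :=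
        Nat.choose_le_choose _ (hdec 0 (by omega))
      have h4 := minShadow_choose_add (k := k + 1 + 1) (a := a 0 + 1) (m := 1) (by omega) le_rfl
        (Nat.choose_pos (by omega))
      have h5 := two_le_minShadow_one (k := k)
      have e1 : (a 0 + 1).choose (k + 1 + 1 + 1)
        = (a 0).choose (k + 1 + 1) + (a 0).choose (k + 1 + 1 + 1) := Nat.choose_succ_succ _ _
      have e2 : (a 0 + 1).choose (k + 1 + 1)
        = (a 0).choose (k + 1) + (a 0).choose (k + 1 + 1) := Nat.choose_succ_succ _ _
      rw [show ∑ i ∈ range (k + 1), (a (i + 1)).choose (k + 1 + 1 - i)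
        + (a 0).choose (k + 1 + 1 + 1) + a (k + 1) + 1 = (a 0 + 1).choose (k + 1 + 1 + 1) + 1 by
          omega, h4]
      omega
    · have h4 := minShadow_choose_add (k := k + 1 + 1) (a := a 0) (m := R) (by omega) (by omega) h
      rw [show ∑ i ∈ range (k + 1), (a (i + 1)).choose (k + 1 + 1 - i)
        + (a 0).choose (k + 1 + 1 + 1) + a (k + 1) + 1 = (a 0).choose (k + 1 + 1 + 1) + R by
          omega, h4]
      omega

/-- For decompositions of full length, `minShadow` does not depend on the last entry. -/
lemma minShadow_sum_choose_add {k w : ℕ} {a : ℕ → ℕ} (ha : ∀ i < k, a (i + 1) < a i) (h1 : 1 ≤ w)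
    (hw : w ≤ a k) :
    minShadow (k + 1 + 1) (∑ i ∈ range (k + 1), (a i).choose (k + 1 + 1 - i) + w)
      = ∑ i ∈ range (k + 1), (a i).choose (k + 1 - i) + 1 := by
  have h := (minShadow_sum_choose (k + 1 + 1) (k + 1 + 1)
    (fun i => if i = k + 1 then w else a i) (by omega) le_rfl (fun i hi => by
      rcases Nat.lt_or_ge i k with h | h
      · left; simp only [show i ≠ k + 1 by omega, show i + 1 ≠ k + 1 by omega, if_false]
        exact ha i h
      · right
        obtain rfl : i = k := by omega
        simpa using hw) (by simp; omega)).2.2.2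
  have e : ∀ j, ∑ i ∈ range (k + 1), ((if i = k + 1 then w else a i)).choose (j - i)
      = ∑ i ∈ range (k + 1), (a i).choose (j - i) := fun j =>
    sum_congr rfl fun i hi => by
      rw [mem_range] at hi; rw [if_neg (by omega)]
  rw [sum_range_succ, sum_range_succ _ (k + 1), e, e] at h
  simpa using h

/-- A plateau that starts at a number with a decomposition of full length ends, at the latest, when
the last entry reaches the previous one. -/
theorem add_le_of_plateau {k w g : ℕ} {a : ℕ → ℕ} (ha : ∀ i < k, a (i + 1) < a i) (h1 : 1 ≤ w)
    (hw : w ≤ a k)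
    (h : minShadow (k + 1 + 1) (∑ i ∈ range (k + 1), (a i).choose (k + 1 + 1 - i) + w + g)
      ≤ minShadow (k + 1 + 1) (∑ i ∈ range (k + 1), (a i).choose (k + 1 + 1 - i) + w)) :
    w + g ≤ a k := by
  by_contra! hlt
  rw [minShadow_sum_choose_add ha h1 hw] at h
  have h2 := sum_choose_lt_minShadow k a ha (by omega)
  have h3 := minShadow_mono (k + 1 + 1)
    (show ∑ i ∈ range (k + 1), (a i).choose (k + 1 + 1 - i) + a k + 1
      ≤ ∑ i ∈ range (k + 1), (a i).choose (k + 1 + 1 - i) + w + g by omega)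
  omega

/-! ### Vertex deletion, links and the shadow -/

section

variable {S : Finset (Finset ℕ)} {A B g : Finset ℕ} {k x y : ℕ}

lemma memberSubfamily_shadow (x : ℕ) (S : Finset (Finset ℕ)) :
    (∂ S).memberSubfamily x = ∂ (S.memberSubfamily x) := by
  ext s
  simp only [mem_memberSubfamily, mem_shadow_iff_insert_mem, mem_insert, not_or]
  constructor
  · rintro ⟨⟨a, ⟨hax, has⟩, h⟩, hx⟩
    exact ⟨a, has, by rwa [Finset.insert_comm], fun h => hax h.symm, hx⟩
  · rintro ⟨a, has, h, hxa, hx⟩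
    exact ⟨⟨a, ⟨fun h => hxa h.symm, has⟩, by rwa [Finset.insert_comm]⟩, hx⟩

lemma nonMemberSubfamily_shadow (x : ℕ) (S : Finset (Finset ℕ)) :
    (∂ S).nonMemberSubfamily x = S.memberSubfamily x ∪ ∂ (S.nonMemberSubfamily x) := by
  ext s
  simp only [mem_union, mem_memberSubfamily, mem_nonMemberSubfamily, mem_shadow_iff_insert_mem,
    mem_insert, not_or]
  constructor
  · rintro ⟨⟨a, has, h⟩, hx⟩
    by_cases hax : a = x
    · subst hax; exact Or.inl ⟨h, hx⟩
    · exact Or.inr ⟨a, has, h, fun h => hax h.symm, hx⟩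
  · rintro (⟨h, hx⟩ | ⟨a, has, h, -, hx⟩)
    · exact ⟨⟨x, hx, h⟩, hx⟩
    · exact ⟨⟨a, has, h⟩, hx⟩

lemma card_shadow (x : ℕ) (S : Finset (Finset ℕ)) :
    #(∂ S) = #(∂ (S.memberSubfamily x)) + #(S.memberSubfamily x ∪ ∂ (S.nonMemberSubfamily x)) := by
  rw [← card_memberSubfamily_add_card_nonMemberSubfamily x (∂ S), memberSubfamily_shadow,
    nonMemberSubfamily_shadow]

lemma sized_memberSubfamily (hS : (S : Set (Finset ℕ)).Sized (k + 1)) (x : ℕ) :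
    (S.memberSubfamily x : Set (Finset ℕ)).Sized k := by
  intro A hA
  rw [mem_coe, mem_memberSubfamily] at hA
  have := hS (mem_coe.2 hA.1)
  rw [card_insert_of_notMem hA.2] at this
  omega

lemma sized_nonMemberSubfamily (hS : (S : Set (Finset ℕ)).Sized k) (x : ℕ) :
    (S.nonMemberSubfamily x : Set (Finset ℕ)).Sized k := by
  intro A hA
  rw [mem_coe, mem_nonMemberSubfamily] at hA
  exact hS hA.1

lemma card_nonMemberSubfamily_lt (hA : A ∈ S) (hx : x ∈ A) : #(S.nonMemberSubfamily x) < #S := by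
  refine card_lt_card ⟨fun B hB => (mem_nonMemberSubfamily.1 hB).1, fun h => ?_⟩
  exact (mem_nonMemberSubfamily.1 (h hA)).2 hx

lemma card_eq_add (x : ℕ) (S : Finset (Finset ℕ)) :
    #S = #(S.nonMemberSubfamily x) + #(S.memberSubfamily x) := by
  rw [add_comm, card_memberSubfamily_add_card_nonMemberSubfamily]

/-- **Kruskal–Katona theorem**, in terms of `minShadow`. -/
theorem minShadow_le_card_shadow (k : ℕ) (S : Finset (Finset ℕ))
    (hS : (S : Set (Finset ℕ)).Sized k) : minShadow k #S ≤ #(∂ S) := by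
  induction k generalizing S with
  | zero => simp
  | succ k ih =>
    induction hn : #S using Nat.strong_induction_on generalizing S with
    | _ n IH =>
    subst hn
    rcases S.eq_empty_or_nonempty with rfl | ⟨A, hA⟩
    · simp
    obtain ⟨x, hx⟩ : A.Nonempty := by rw [← card_pos, hS hA]; omega
    have h1 := ih _ (sized_memberSubfamily hS x)
    have h2 := IH _ (card_nonMemberSubfamily_lt hA hx) _ (sized_nonMemberSubfamily hS x) rfl
    have h3 := minShadow_add_le k #(S.nonMemberSubfamily x) #(S.memberSubfamily x)
    rw [← card_eq_add] at h3
    rw [card_shadow x]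
    have h4 := card_le_card
      (subset_union_left (s₁ := S.memberSubfamily x) (s₂ := ∂ (S.nonMemberSubfamily x)))
    have h5 := card_le_card
      (subset_union_right (s₁ := S.memberSubfamily x) (s₂ := ∂ (S.nonMemberSubfamily x)))
    have h6 := max_le h4 (h2.trans h5)
    omega

/-! ### Extremal families, faces and cone points -/

/-- A `k`-uniform family whose shadow is as small as the Kruskal–Katona theorem allows. The empty
family is included. -/
def Extremal (k : ℕ) (S : Finset (Finset ℕ)) : Prop :=
  (S : Set (Finset ℕ)).Sized k ∧ #(∂ S) = minShadow k #S

/-- `g` is a face of the simplicial complex generated by `S`. For a `k`-uniform family, the faces of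
size `k - t` are the members of the `t`-th iterated shadow. -/
def Face (S : Finset (Finset ℕ)) (g : Finset ℕ) : Prop := ∃ A ∈ S, g ⊆ A

/-- `x` is a cone point of the uniform family `S`: every element of a member of `S` can be exchanged
for `x`. -/
def Cone (S : Finset (Finset ℕ)) (x : ℕ) : Prop :=
  ∀ A ∈ S, x ∉ A → ∀ a ∈ A, insert x (A.erase a) ∈ S

lemma Face.mono {h : Finset ℕ} (hg : Face S g) (hh : h ⊆ g) : Face S h :=
  let ⟨A, hA, hgA⟩ := hg; ⟨A, hA, hh.trans hgA⟩

lemma face_of_mem (hA : A ∈ S) : Face S A := ⟨A, hA, Subset.rfl⟩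

lemma face_iff_mem (hS : (S : Set (Finset ℕ)).Sized k) (hg : #g = k) : Face S g ↔ g ∈ S := by
  refine ⟨fun ⟨A, hA, h⟩ => ?_, face_of_mem⟩
  rwa [eq_of_subset_of_card_le h (by rw [hS hA, hg])]

lemma Face.exists_insert (hS : (S : Set (Finset ℕ)).Sized k) (h : Face S g) (hg : #g < k) :
    ∃ a ∉ g, Face S (insert a g) := by
  obtain ⟨A, hA, hgA⟩ := h
  obtain ⟨a, ha, hag⟩ : ∃ a ∈ A, a ∉ g := by
    by_contra! hc
    have := card_le_card (show A ⊆ g from hc)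
    rw [hS hA] at this; omega
  exact ⟨a, hag, A, hA, insert_subset ha hgA⟩

lemma Face.exists_superset (hS : (S : Set (Finset ℕ)).Sized k) (h : Face S g) {n : ℕ}
    (hg : #g ≤ n) (hn : n ≤ k) : ∃ g', g ⊆ g' ∧ #g' = n ∧ Face S g' := by
  obtain ⟨A, hA, hgA⟩ := h
  obtain ⟨g', h1, h2, h3⟩ := exists_subsuperset_card_eq hgA hg (by rw [hS hA]; exact hn)
  exact ⟨g', h1, h3, A, hA, h2⟩

lemma mem_shadow_iff_face (hS : (S : Set (Finset ℕ)).Sized (k + 1)) :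
    g ∈ ∂ S ↔ #g = k ∧ Face S g := by
  rw [mem_shadow_iff_insert_mem]
  constructor
  · rintro ⟨a, ha, h⟩
    have := hS (mem_coe.2 h)
    rw [card_insert_of_notMem ha] at this
    exact ⟨by omega, _, h, subset_insert _ _⟩
  · rintro ⟨hg, h⟩
    obtain ⟨a, ha, h⟩ := h.exists_insert hS (by omega)
    exact ⟨a, ha, (face_iff_mem hS (by rw [card_insert_of_notMem ha, hg])).1 h⟩

lemma face_shadow_iff (hS : (S : Set (Finset ℕ)).Sized (k + 1)) (hg : #g ≤ k) :
    Face (∂ S) g ↔ Face S g := by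
  constructor
  · rintro ⟨A, hA, h⟩
    exact ((mem_shadow_iff_face hS).1 hA).2.mono h
  · intro h
    obtain ⟨g', h1, h2, h3⟩ := h.exists_superset hS hg (Nat.le_succ k)
    exact ⟨g', (mem_shadow_iff_face hS).2 ⟨h2, h3⟩, h1⟩

lemma Cone.face_insert (hS : (S : Set (Finset ℕ)).Sized k) (hx : Cone S x) (h : Face S g)
    (hg : #g < k) : Face S (insert x g) := by
  obtain ⟨A, hA, hgA⟩ := h
  by_cases hxA : x ∈ A
  · exact ⟨A, hA, insert_subset hxA hgA⟩
  · obtain ⟨a, ha, hag⟩ : ∃ a ∈ A, a ∉ g := by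
      by_contra! hc
      have := card_le_card (show A ⊆ g from hc)
      rw [hS hA] at this; omega
    refine ⟨_, hx A hA hxA a ha, insert_subset_insert _ fun b hb => mem_erase.2 ⟨?_, hgA hb⟩⟩
    rintro rfl; exact hag hb

lemma Cone.face_union (hS : (S : Set (Finset ℕ)).Sized k) {Y : Finset ℕ} (hY : ∀ y ∈ Y, Cone S y)
    (h : Face S g) (hg : #(g ∪ Y) ≤ k) : Face S (g ∪ Y) := by
  induction Y using Finset.induction_on with
  | empty => simpa using h
  | insert y Y hy ih =>
    rw [union_insert] at hg ⊢
    by_cases hm : y ∈ g ∪ Y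
    · rw [insert_eq_of_mem hm] at hg ⊢
      exact ih (fun z hz => hY z (mem_insert_of_mem hz)) hg
    · rw [card_insert_of_notMem hm] at hg
      exact (hY y (mem_insert_self _ _)).face_insert hS
        (ih (fun z hz => hY z (mem_insert_of_mem hz)) (by omega)) (by omega)

/-- Faces may be modified freely by cone points, as long as they do not become too large. -/
lemma Face.of_sdiff_cone (hS : (S : Set (Finset ℕ)).Sized k) {Y g' : Finset ℕ}
    (hY : ∀ y ∈ Y, Cone S y) (h : Face S g) (hg : #g' ≤ k) (hsub : g' \ Y ⊆ g) : Face S g' := by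
  have h1 := Cone.face_union (Y := g' ∩ Y) hS (fun y hy => hY y (mem_inter.1 hy).2) (h.mono hsub)
    (by rwa [sdiff_union_inter])
  rwa [sdiff_union_inter] at h1

lemma Extremal.card_memberSubfamily_le (hS : Extremal (k + 1) S) (x : ℕ) :
    #(S.memberSubfamily x) ≤ linkCount (minShadow k) #S := by
  by_contra! h
  have h1 := minShadow_le_card_shadow k _ (sized_memberSubfamily hS.1 x)
  have h2 := minShadow_mono k h.le
  have h3 := card_shadow x S
  have h4 := card_le_card
    (subset_union_left (s₁ := S.memberSubfamily x) (s₂ := ∂ (S.nonMemberSubfamily x)))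
  rw [hS.2, minShadow_succ] at h3
  omega

lemma Cone.shadow_subset (hx : Cone S x) :
    ∂ (S.nonMemberSubfamily x) ⊆ S.memberSubfamily x := by
  intro B hB
  obtain ⟨A, hA, a, ha, rfl⟩ := mem_shadow_iff.1 hB
  rw [mem_nonMemberSubfamily] at hA
  exact mem_memberSubfamily.2 ⟨hx A hA.1 hA.2 a ha, fun h => hA.2 (mem_of_mem_erase h)⟩

lemma cone_of_shadow_subset (h : ∂ (S.nonMemberSubfamily x) ⊆ S.memberSubfamily x) : Cone S x := by
  intro A hA hx a ha
  exact (mem_memberSubfamily.1 (h (mem_shadow_iff.2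
    ⟨A, mem_nonMemberSubfamily.2 ⟨hA, hx⟩, a, ha, rfl⟩))).1

lemma Extremal.card_memberSubfamily_of_cone (hS : Extremal (k + 1) S) (hx : Cone S x) :
    #(S.memberSubfamily x) = linkCount (minShadow k) #S := by
  refine le_antisymm (hS.card_memberSubfamily_le x) ?_
  by_contra! h
  have h1 := minShadow_le_card_shadow _ _ (sized_nonMemberSubfamily hS.1 x)
  have h2 := card_le_card hx.shadow_subset
  have h3 := card_eq_add x S
  have h4 := linkCount_le (f := minShadow k) #S
  have h5 := linkCount_le_minShadow (k := k) (m := #S) (w := #(S.nonMemberSubfamily x)) (by omega)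
  omega

lemma Extremal.memberSubfamily_of_cone (hS : Extremal (k + 1) S) (hx : Cone S x) :
    Extremal k (S.memberSubfamily x) := by
  refine ⟨sized_memberSubfamily hS.1 x, ?_⟩
  have h1 := card_shadow x S
  rw [union_eq_left.2 hx.shadow_subset, hS.2, minShadow_succ,
    ← hS.card_memberSubfamily_of_cone hx] at h1
  omega

/-- At a point which is not a cone point, an extremal family splits into two extremal families, and
the sizes of the shadows add up. -/
theorem Extremal.split (hS : Extremal (k + 1) S) (hx : ¬ Cone S x) :
    Extremal (k + 1) (S.nonMemberSubfamily x) ∧ Extremal k (S.memberSubfamily x) ∧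
    S.memberSubfamily x ⊆ ∂ (S.nonMemberSubfamily x) ∧
    #(S.memberSubfamily x) < minShadow (k + 1) #(S.nonMemberSubfamily x) ∧
    minShadow (k + 1) #(S.nonMemberSubfamily x) + minShadow k #(S.memberSubfamily x)
      = minShadow (k + 1) #S := by
  have hle := hS.card_memberSubfamily_le x
  have hm := card_eq_add x S
  have hsh := card_shadow x S
  have h1 := minShadow_le_card_shadow _ _ (sized_nonMemberSubfamily hS.1 x)
  have h2 := minShadow_le_card_shadow k _ (sized_memberSubfamily hS.1 x)
  rcases hle.eq_or_lt with heq | hlt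
  · refine (hx (cone_of_shadow_subset ?_)).elim
    rw [hS.2, minShadow_succ, ← heq] at hsh
    have h3 : #(S.memberSubfamily x ∪ ∂ (S.nonMemberSubfamily x)) ≤ #(S.memberSubfamily x) := by
      omega
    have h4 := eq_of_subset_of_card_le subset_union_left h3
    exact union_eq_left.1 h4.symm
  · have h3 := linkCount_le (f := minShadow k) #S
    have h4 := linkCount_le_minShadow (k := k) (m := #S) (w := #(S.nonMemberSubfamily x)) (by omega)
    have h5 := minShadow_add_le_of_le (hlt.le.trans h4)
    have h6 := card_le_card
      (subset_union_right (s₁ := S.memberSubfamily x) (s₂ := ∂ (S.nonMemberSubfamily x)))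
    rw [← hm] at h5
    rw [hS.2] at hsh
    refine ⟨⟨sized_nonMemberSubfamily hS.1 x, by omega⟩, ⟨sized_memberSubfamily hS.1 x, by omega⟩,
      ?_, by omega, by omega⟩
    have h7 := eq_of_subset_of_card_le (s := ∂ (S.nonMemberSubfamily x)) (t :=
      S.memberSubfamily x ∪ ∂ (S.nonMemberSubfamily x)) subset_union_right (by omega)
    exact union_eq_right.1 h7.symm

/-- Shadows of extremal families are extremal, by induction along `Extremal.split` or along the link
of a cone point. -/
theorem Extremal.shadow (hS : Extremal (k + 1) S) : Extremal k (∂ S) := by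
  refine ⟨hS.1.shadow, ?_⟩
  induction k generalizing S with
  | zero =>
    have : (∂ S : Set (Finset ℕ)).Sized 0 := hS.1.shadow
    rw [minShadow_zero_left, card_eq_zero, eq_empty_iff_forall_notMem]
    intro B hB
    obtain ⟨A, hA, a, ha, -⟩ := mem_shadow_iff.1 hB
    rw [card_eq_zero.1 (this hA)] at ha
    simp at ha
  | succ k ih =>
    induction hn : #S using Nat.strong_induction_on generalizing S with
    | _ n IH =>
    subst hn
    rcases S.eq_empty_or_nonempty with rfl | ⟨A, hA⟩
    · simp
    obtain ⟨x, hx⟩ : A.Nonempty := by rw [← card_pos, hS.1 hA]; omega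
    have hsh := card_shadow x (∂ S)
    rw [memberSubfamily_shadow, nonMemberSubfamily_shadow] at hsh
    by_cases hc : Cone S x
    · have h1 := hS.memberSubfamily_of_cone hc
      rw [union_eq_left.2 hc.shadow_subset, union_self, ih h1, h1.2,
        hS.card_memberSubfamily_of_cone hc] at hsh
      rw [hS.2, minShadow_succ_minShadow, hsh, add_comm]
    · obtain ⟨h0, h1, h2, h3, h4⟩ := hS.split hc
      have h5 := IH _ (card_nonMemberSubfamily_lt hA hx) h0 rfl
      have h6 := ih h1
      rw [union_eq_right.2 h2, union_eq_right.2 (shadow_mono h2), h5, h6, h0.2, h1.2] at hsh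
      have h7 := minShadow_minShadow_add (k := k + 1) h3.le (by rw [h4, ← card_eq_add])
      rw [← card_eq_add, Nat.add_sub_cancel] at h7
      rw [hS.2, hsh, ← h7, add_comm]

end

/-! ### The core of a family -/

section

variable {S : Finset (Finset ℕ)} {A B g : Finset ℕ} {k m x y : ℕ}

/-- The points covered by a family. -/
def vertices (S : Finset (Finset ℕ)) : Finset ℕ := S.biUnion id

lemma mem_vertices : x ∈ vertices S ↔ ∃ A ∈ S, x ∈ A := by simp [vertices]

lemma mem_vertices_iff_face : x ∈ vertices S ↔ Face S {x} := by
  simp [mem_vertices, Face]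

lemma Face.subset_vertices (h : Face S g) : g ⊆ vertices S := fun _ hx =>
  let ⟨A, hA, hgA⟩ := h; mem_vertices.2 ⟨A, hA, hgA hx⟩

open Classical in
/-- The points covered by the family which are not cone points. -/
noncomputable def core (S : Finset (Finset ℕ)) : Finset ℕ := {x ∈ vertices S | ¬ Cone S x}

lemma mem_core : x ∈ core S ↔ x ∈ vertices S ∧ ¬ Cone S x := by simp [core]

lemma cone_of_notMem_core (hx : x ∈ vertices S) (h : x ∉ core S) : Cone S x := by
  by_contra hc; exact h (mem_core.2 ⟨hx, hc⟩)

lemma cone_of_mem_sdiff (hx : x ∈ vertices S \ core S) : Cone S x :=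
  cone_of_notMem_core (mem_sdiff.1 hx).1 (mem_sdiff.1 hx).2

/-- The function `minShadow k`, which is monotone, is constant between `m` and `m + d`. -/
def Plateau (k m d : ℕ) : Prop := minShadow k (m + d) ≤ minShadow k m

/-- A `k`-uniform family is saturated if it contains every `k`-set all of whose facets are faces. -/
def Saturated (k : ℕ) (S : Finset (Finset ℕ)) : Prop :=
  ∀ A, #A = k → (∀ a ∈ A, Face S (A.erase a)) → A ∈ S

/-! ### Deletion and link at a point which is not a cone point -/

lemma face_memberSubfamily (hx : x ∉ g) : Face (S.memberSubfamily x) g ↔ Face S (insert x g) := by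
  constructor
  · rintro ⟨A, hA, h⟩
    exact ⟨_, (mem_memberSubfamily.1 hA).1, insert_subset_insert _ h⟩
  · rintro ⟨A, hA, h⟩
    obtain ⟨h1, h2⟩ := insert_subset_iff.1 h
    refine ⟨A.erase x, mem_memberSubfamily.2 ⟨by rwa [insert_erase h1], notMem_erase _ _⟩, ?_⟩
    exact subset_erase.2 ⟨h2, hx⟩

lemma Face.notMem_of_memberSubfamily (h : Face (S.memberSubfamily x) g) : x ∉ g := by
  obtain ⟨A, hA, h⟩ := h
  exact fun hx => (mem_memberSubfamily.1 hA).2 (h hx)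

lemma Face.notMem_of_nonMemberSubfamily (h : Face (S.nonMemberSubfamily x) g) : x ∉ g := by
  obtain ⟨A, hA, h⟩ := h
  exact fun hx => (mem_nonMemberSubfamily.1 hA).2 (h hx)

lemma Face.of_nonMemberSubfamily (h : Face (S.nonMemberSubfamily x) g) : Face S g := by
  obtain ⟨A, hA, h⟩ := h
  exact ⟨A, (mem_nonMemberSubfamily.1 hA).1, h⟩

/-- Deleting a point which is not a cone point loses no face avoiding this point: the link is
contained in the shadow of the deletion. -/
lemma Extremal.face_nonMemberSubfamily (hS : Extremal (k + 1) S) (hc : ¬ Cone S x) (hx : x ∉ g) :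
    Face (S.nonMemberSubfamily x) g ↔ Face S g := by
  refine ⟨Face.of_nonMemberSubfamily, ?_⟩
  rintro ⟨A, hA, h⟩
  by_cases hxA : x ∈ A
  · have h1 : A.erase x ∈ S.memberSubfamily x :=
      mem_memberSubfamily.2 ⟨by rwa [insert_erase hxA], notMem_erase _ _⟩
    obtain ⟨C, hC, h2⟩ := exists_subset_of_mem_shadow ((hS.split hc).2.2.1 h1)
    exact ⟨C, hC, (subset_erase.2 ⟨h, hx⟩).trans h2⟩
  · exact ⟨A, mem_nonMemberSubfamily.2 ⟨hA, hxA⟩, h⟩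

lemma Cone.nonMemberSubfamily (hy : Cone S y) (hxy : x ≠ y) :
    Cone (S.nonMemberSubfamily x) y := by
  intro A hA hyA a ha
  rw [mem_nonMemberSubfamily] at hA ⊢
  refine ⟨hy A hA.1 hyA a ha, ?_⟩
  rw [mem_insert, not_or]
  exact ⟨hxy, fun h => hA.2 (mem_of_mem_erase h)⟩

lemma Cone.memberSubfamily (hy : Cone S y) (hxy : x ≠ y) : Cone (S.memberSubfamily x) y := by
  intro A hA hyA a ha
  rw [mem_memberSubfamily] at hA ⊢
  have hax : a ≠ x := by rintro rfl; exact hA.2 ha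
  have h := hy _ hA.1 (by rw [mem_insert, not_or]; exact ⟨hxy.symm, hyA⟩) a
    (mem_insert_of_mem ha)
  refine ⟨?_, ?_⟩
  · rwa [erase_insert_of_ne hax.symm, Finset.insert_comm] at h
  · rw [mem_insert, not_or]
    exact ⟨hxy, fun h => hA.2 (mem_of_mem_erase h)⟩

lemma core_nonMemberSubfamily_subset : core (S.nonMemberSubfamily x) ⊆ (core S).erase x := by
  intro y hy
  rw [mem_core] at hy
  have hyx : x ≠ y := by
    rintro rfl
    exact (mem_vertices_iff_face.1 hy.1).notMem_of_nonMemberSubfamily (mem_singleton_self _)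
  refine mem_erase.2 ⟨hyx.symm, mem_core.2 ⟨?_, fun h => hy.2 (h.nonMemberSubfamily hyx)⟩⟩
  exact mem_vertices_iff_face.2 (mem_vertices_iff_face.1 hy.1).of_nonMemberSubfamily

lemma core_memberSubfamily_subset : core (S.memberSubfamily x) ⊆ (core S).erase x := by
  intro y hy
  rw [mem_core] at hy
  have hyx : x ≠ y := by
    rintro rfl
    exact (mem_vertices_iff_face.1 hy.1).notMem_of_memberSubfamily (mem_singleton_self _)
  refine mem_erase.2 ⟨hyx.symm, mem_core.2 ⟨?_, fun h => hy.2 (h.memberSubfamily hyx)⟩⟩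
  have := (face_memberSubfamily (by simpa using hyx)).1 (mem_vertices_iff_face.1 hy.1)
  exact mem_vertices_iff_face.2 (this.mono (subset_insert _ _))

lemma Extremal.plateau_of_nonMemberSubfamily (hS : Extremal (k + 1) S) (hc : ¬ Cone S x) {d : ℕ}
    (h : Plateau (k + 1) #(S.nonMemberSubfamily x) d) : Plateau (k + 1) #S d := by
  obtain ⟨-, -, -, h1, h2⟩ := hS.split hc
  unfold Plateau at *
  rw [← h2, card_eq_add x S, add_right_comm]
  have h3 := minShadow_add_le k (#(S.nonMemberSubfamily x) + d) #(S.memberSubfamily x)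
  have h4 := max_le h1.le h
  omega

/-- Plateaus of the link pass to the family, if a face `g` of codimension at least two cannot be
extended by `x`. The shadow of the link is then smaller than the second shadow of the deletion, so
that a plateau of the link ends before the link could exceed the shadow of the deletion. -/
lemma Extremal.plateau_of_memberSubfamily (hS : Extremal (k + 1) S) (hc : ¬ Cone S x) {d : ℕ}
    (hg : #g + 1 ≤ k) (hxg : x ∉ g) (h1 : Face S g) (h2 : ¬ Face S (insert x g))
    (h : Plateau k #(S.memberSubfamily x) d) : Plateau (k + 1) #S d := by
  obtain ⟨s0, s1, s2, s3, s4⟩ := hS.split hc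
  obtain ⟨k, rfl⟩ : ∃ j, k = j + 1 := ⟨k - 1, by omega⟩
  unfold Plateau at *
  rcases le_or_gt (#(S.memberSubfamily x) + d)
    (minShadow (k + 1 + 1) #(S.nonMemberSubfamily x)) with h3 | h3
  · rw [← s4, card_eq_add x S, add_assoc #(S.nonMemberSubfamily x)]
    have h4 := minShadow_add_le_of_le h3
    omega
  · exfalso
    -- The link and the shadow of the deletion would have the same shadow, contrary to `g`.
    have h4 := (minShadow_mono (k + 1) h3.le).trans h
    rw [← s0.2, ← s1.2, ← s0.shadow.2] at h4
    have h5 := eq_of_subset_of_card_le (shadow_mono s2) h4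
    have h6 := (hS.face_nonMemberSubfamily hc hxg).2 h1
    rw [← face_shadow_iff s0.1 (by omega), ← face_shadow_iff s0.1.shadow (by omega), ← h5,
      face_shadow_iff s1.1 (by omega), face_memberSubfamily hxg] at h6
    exact h2 h6

/-! ### Adding cone points -/

/-- The cone over `S` with apex `y`, as a uniform family. -/
def addCone (y : ℕ) (S : Finset (Finset ℕ)) : Finset (Finset ℕ) := S ∪ (∂ S).image (insert y)

lemma notMem_of_mem_shadow (hy : y ∉ vertices S) (hB : B ∈ ∂ S) : y ∉ B := by
  obtain ⟨A, hA, h⟩ := exists_subset_of_mem_shadow hB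
  exact fun hyB => hy (mem_vertices.2 ⟨A, hA, h hyB⟩)

lemma nonMemberSubfamily_addCone (hy : y ∉ vertices S) :
    (addCone y S).nonMemberSubfamily y = S := by
  ext A
  simp only [addCone, mem_nonMemberSubfamily, mem_union, mem_image]
  constructor
  · rintro ⟨h | ⟨B, -, rfl⟩, hA⟩
    · exact h
    · exact (hA (mem_insert_self _ _)).elim
  · exact fun h => ⟨Or.inl h, fun hyA => hy (mem_vertices.2 ⟨A, h, hyA⟩)⟩

lemma memberSubfamily_addCone (hy : y ∉ vertices S) : (addCone y S).memberSubfamily y = ∂ S := by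
  ext A
  simp only [addCone, mem_memberSubfamily, mem_union, mem_image]
  constructor
  · rintro ⟨h | ⟨B, hB, h⟩, hA⟩
    · exact (hy (mem_vertices.2 ⟨_, h, mem_insert_self _ _⟩)).elim
    · have := notMem_of_mem_shadow hy hB
      rwa [← erase_insert hA, ← h, erase_insert this]
  · exact fun h => ⟨Or.inr ⟨A, h, rfl⟩, notMem_of_mem_shadow hy h⟩

lemma Extremal.addCone (hS : Extremal (k + 1) S) (hy : y ∉ vertices S) :
    Extremal (k + 1) (addCone y S) ∧
      #(KruskalKatona.addCone y S) = #S + minShadow (k + 1) #S := by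
  have hcard : #(KruskalKatona.addCone y S) = #S + minShadow (k + 1) #S := by
    rw [card_eq_add y, nonMemberSubfamily_addCone hy, memberSubfamily_addCone hy, hS.2]
  refine ⟨⟨?_, ?_⟩, hcard⟩
  · intro A hA
    rw [KruskalKatona.addCone, mem_coe, mem_union, mem_image] at hA
    rcases hA with h | ⟨B, hB, rfl⟩
    · exact hS.1 h
    · rw [card_insert_of_notMem (notMem_of_mem_shadow hy hB), ((mem_shadow_iff_face hS.1).1 hB).1]
  · have e : linkCount (minShadow k) (#S + minShadow (k + 1) #S) = minShadow (k + 1) #S :=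
      linkCount_eq (by omega) (by simp) (by simpa using minShadow_mono (k + 1) (Nat.le_succ _))
    rw [card_shadow y, nonMemberSubfamily_addCone hy, memberSubfamily_addCone hy, union_self,
      hcard, minShadow_succ, e, hS.shadow.2, hS.2, add_comm]

lemma face_addCone (hS : (S : Set (Finset ℕ)).Sized (k + 1))
    (hg : #g ≤ k + 1) : Face (addCone y S) g ↔ Face S (g.erase y) := by
  constructor
  · rintro ⟨A, hA, h⟩
    rw [KruskalKatona.addCone, mem_union, mem_image] at hA
    rcases hA with hA | ⟨B, hB, rfl⟩
    · exact ⟨A, hA, (erase_subset _ _).trans h⟩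
    · obtain ⟨A, hA, h1⟩ := exists_subset_of_mem_shadow hB
      exact ⟨A, hA, (subset_insert_iff.1 h).trans h1⟩
  · intro h
    by_cases hyg : y ∈ g
    · have hc := card_erase_of_mem hyg
      obtain ⟨B, hB, h1⟩ := (face_shadow_iff hS (by omega)).2 h
      refine ⟨insert y B, mem_union_right _ (mem_image_of_mem _ hB), ?_⟩
      exact subset_insert_iff.2 h1
    · rw [erase_eq_of_notMem hyg] at h
      obtain ⟨A, hA, h⟩ := h
      exact ⟨A, mem_union_left _ hA, h⟩

lemma cone_addCone (hy : y ∉ vertices S) : Cone (addCone y S) y := by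
  apply cone_of_shadow_subset
  rw [nonMemberSubfamily_addCone hy, memberSubfamily_addCone hy]

lemma Cone.addCone (hS : Extremal (k + 1) S) (hy : y ∉ vertices S) (hx : Cone S x) :
    Cone (addCone y S) x := by
  intro A hA hxA a ha
  rcases eq_or_ne x y with rfl | hxy
  · exact cone_addCone hy A hA hxA a ha
  have hS' := (hS.addCone hy).1
  have hAk := hS'.1 hA
  have hac := card_erase_add_one ha
  have hcard : #(insert x (A.erase a)) = k + 1 := by
    rw [card_insert_of_notMem (fun h => hxA (mem_of_mem_erase h))]; omega
  rw [← face_iff_mem hS'.1 hcard, face_addCone hS.1 (by omega), erase_insert_of_ne hxy]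
  have h1 := (face_addCone hS.1 (by omega)).1 (face_of_mem hA)
  by_cases hyA : y ∈ A
  · have h2 := card_erase_add_one hyA
    refine hx.face_insert hS.1 (h1.mono ?_) ?_
    · rw [erase_right_comm]; exact erase_subset _ _
    · have h3 := card_le_card (erase_subset a (A.erase y))
      rw [erase_right_comm] at h3; omega
  · rw [erase_eq_of_notMem hyA] at h1
    rw [erase_eq_of_notMem (fun h => hyA (mem_of_mem_erase h))]
    exact hx.face_insert hS.1 (h1.mono (erase_subset _ _)) (by omega)

lemma core_addCone_subset (hS : Extremal (k + 1) S) (hy : y ∉ vertices S) :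
    core (addCone y S) ⊆ core S := by
  intro x hx
  rw [mem_core] at hx ⊢
  have hxy : x ≠ y := by
    rintro rfl; exact hx.2 (cone_addCone hy)
  refine ⟨?_, fun h => hx.2 (h.addCone hS hy)⟩
  have := (face_addCone hS.1 (by simp)).1 (mem_vertices_iff_face.1 hx.1)
  rw [erase_eq_of_notMem (by simpa using hxy.symm)] at this
  exact mem_vertices_iff_face.2 this

/-! ### Saturation -/

/-- All `k`-subsets of the vertex set whose facets lie in the shadow of `S`. -/
def saturation (k : ℕ) (S : Finset (Finset ℕ)) : Finset (Finset ℕ) :=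
  {A ∈ (vertices S).powersetCard k | ∀ a ∈ A, A.erase a ∈ ∂ S}

lemma mem_saturation :
    A ∈ saturation k S ↔ (A ⊆ vertices S ∧ #A = k) ∧ ∀ a ∈ A, A.erase a ∈ ∂ S := by
  simp [saturation, mem_powersetCard]

lemma subset_saturation (hS : (S : Set (Finset ℕ)).Sized k) : S ⊆ saturation k S := fun _ hA =>
  mem_saturation.2 ⟨⟨(face_of_mem hA).subset_vertices, hS hA⟩, fun _ ha => erase_mem_shadow hA ha⟩

lemma sized_saturation : (saturation k S : Set (Finset ℕ)).Sized k := fun _ hA =>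
  (mem_saturation.1 hA).1.2

lemma shadow_saturation (hS : (S : Set (Finset ℕ)).Sized k) : ∂ (saturation k S) = ∂ S := by
  refine Subset.antisymm (fun B hB => ?_) (shadow_mono (subset_saturation hS))
  obtain ⟨A, hA, a, ha, rfl⟩ := mem_shadow_iff.1 hB
  exact (mem_saturation.1 hA).2 a ha

lemma Extremal.saturation (hS : Extremal k S) :
    Extremal k (saturation k S) ∧
      minShadow k #(KruskalKatona.saturation k S) = minShadow k #S := by
  have h1 := minShadow_le_card_shadow k _ (sized_saturation (k := k) (S := S))
  have h2 := minShadow_mono k (card_le_card (subset_saturation hS.1))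
  rw [shadow_saturation hS.1, hS.2] at h1
  refine ⟨⟨sized_saturation, ?_⟩, by omega⟩
  rw [shadow_saturation hS.1, hS.2]; omega

lemma face_saturation (hS : (S : Set (Finset ℕ)).Sized (k + 1)) (hg : #g ≤ k) :
    Face (saturation (k + 1) S) g ↔ Face S g := by
  rw [← face_shadow_iff hS hg, ← face_shadow_iff sized_saturation hg, shadow_saturation hS]

lemma saturated_saturation (hS : (S : Set (Finset ℕ)).Sized (k + 1)) (hk : 1 ≤ k) :
    Saturated (k + 1) (saturation (k + 1) S) := by
  intro A hA h
  have h1 : ∀ a ∈ A, A.erase a ∈ ∂ S := fun a ha => by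
    have hc := card_erase_of_mem ha
    rw [mem_shadow_iff_face hS, ← face_saturation hS (by omega)]
    exact ⟨by omega, h a ha⟩
  refine mem_saturation.2 ⟨⟨fun x hx => ?_, hA⟩, h1⟩
  obtain ⟨a, ha, hax⟩ : ∃ a ∈ A, a ≠ x := exists_mem_ne (by omega) x
  exact ((mem_shadow_iff_face hS).1 (h1 a ha)).2.subset_vertices (mem_erase.2 ⟨hax.symm, hx⟩)

lemma Cone.saturation (hS : (S : Set (Finset ℕ)).Sized (k + 1)) (hx : Cone S x) :
    Cone (saturation (k + 1) S) x := by
  intro A hA hxA a ha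
  have hcA := sized_saturation hA
  have hc := card_erase_add_one ha
  rw [mem_saturation] at hA
  have hxa : x ∉ A.erase a := fun h => hxA (mem_of_mem_erase h)
  have h1 := ((mem_shadow_iff_face hS).1 (hA.2 a ha)).2
  have h2 := hx.face_insert hS h1 (by omega)
  refine mem_saturation.2 ⟨⟨h2.subset_vertices, by rw [card_insert_of_notMem hxa]; omega⟩, ?_⟩
  intro b hb
  rw [mem_shadow_iff_face hS]
  have h3 := card_erase_add_one hb
  rw [card_insert_of_notMem hxa] at h3
  refine ⟨by omega, h2.mono (erase_subset _ _)⟩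

lemma core_saturation_subset (hS : (S : Set (Finset ℕ)).Sized (k + 1)) (hk : 1 ≤ k) :
    core (saturation (k + 1) S) ⊆ core S := by
  intro x hx
  rw [mem_core] at hx ⊢
  refine ⟨?_, fun h => hx.2 (h.saturation hS)⟩
  rw [mem_vertices_iff_face] at hx ⊢
  exact (face_saturation hS (by simpa using hk)).1 hx.1

/-- In a saturated family, a point is recognised as not being a cone point by a face of
codimension at least two. -/
lemma Saturated.exists_face (hS : (S : Set (Finset ℕ)).Sized (k + 1)) (hsat : Saturated (k + 1) S)
    (hx : ¬ Cone S x) : ∃ h, #h + 1 ≤ k ∧ x ∉ h ∧ Face S h ∧ ¬ Face S (insert x h) := by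
  unfold Cone at hx
  push Not at hx
  obtain ⟨A, hA, hxA, a, ha, hB⟩ := hx
  have hc := card_erase_add_one ha
  have hAk := hS hA
  have hxa : x ∉ A.erase a := fun h => hxA (mem_of_mem_erase h)
  by_contra! hcon
  refine hB (hsat _ (by rw [card_insert_of_notMem hxa]; omega) fun b hb => ?_)
  rcases mem_insert.1 hb with rfl | hb'
  · rw [erase_insert hxa]; exact (face_of_mem hA).mono (erase_subset _ _)
  · have hbx : b ≠ x := fun h => hxa (h ▸ hb')
    rw [erase_insert_of_ne hbx.symm]
    have hc2 := card_erase_add_one hb'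
    refine hcon _ (by omega) (fun h => hxa (mem_of_mem_erase h)) ?_
    exact (face_of_mem hA).mono ((erase_subset _ _).trans (erase_subset _ _))

/-! ### Reduction to saturated families with many cone points -/

/-- Any number of cone points `Y` can be added to an extremal family, outside a given finite set
`W`, without enlarging the core and without gaining plateaus. -/
lemma exists_many_cones (hS : Extremal (k + 1) S) (W : Finset ℕ) (N : ℕ) :
    ∃ (T : Finset (Finset ℕ)) (Y : Finset ℕ), Extremal (k + 1) T ∧ #Y = N ∧ Disjoint Y W ∧
      (∀ y ∈ Y, Cone T y) ∧ core T ⊆ core S ∧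
      (∀ d, Plateau (k + 1) #T d → Plateau (k + 1) #S d) ∧
      ∀ g, #g ≤ k + 1 → (Face T g ↔ Face S (g \ Y)) := by
  induction N with
  | zero => exact ⟨S, ∅, hS, rfl, disjoint_empty_left _, by simp, Subset.rfl, fun _ h => h, by simp⟩
  | succ N ih =>
    obtain ⟨T, Y, h1, h2, h3, h4, h5, h6, h7⟩ := ih
    obtain ⟨y, hy⟩ := Infinite.exists_notMem_finset (vertices T ∪ (Y ∪ W))
    simp only [mem_union, not_or] at hy
    obtain ⟨hyT, hyY, hyW⟩ := hy
    obtain ⟨h8, h9⟩ := h1.addCone hyT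
    refine ⟨addCone y T, insert y Y, h8, by rw [card_insert_of_notMem hyY, h2], ?_, ?_,
      (core_addCone_subset h1 hyT).trans h5, fun d h => h6 d ?_, fun g hg => ?_⟩
    · rw [disjoint_insert_left]; exact ⟨hyW, h3⟩
    · intro z hz
      rcases mem_insert.1 hz with rfl | hz
      · exact cone_addCone hyT
      · exact (h4 z hz).addCone h1 hyT
    · unfold Plateau at h
      rw [h9] at h
      exact plateau_of_cone h
    · rw [face_addCone h1.1 hg, h7 _ ((card_le_card (erase_subset _ _)).trans hg)]
      rw [show g.erase y \ Y = g \ insert y Y by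
        ext; simp only [mem_sdiff, mem_erase, mem_insert]; tauto]

/-- An extremal family can be replaced by a saturated one with many cone points. -/
lemma exists_saturated (hS : Extremal (k + 1) S) (hk : 1 ≤ k) (W : Finset ℕ) (N : ℕ) :
    ∃ (T : Finset (Finset ℕ)) (Y : Finset ℕ), Extremal (k + 1) T ∧ Saturated (k + 1) T ∧ #Y = N ∧
      Disjoint Y W ∧ (∀ y ∈ Y, Cone T y) ∧ core T ⊆ core S ∧
      (∀ d, Plateau (k + 1) #T d → Plateau (k + 1) #S d) ∧
      ∀ g, #g ≤ k → (Face T g ↔ Face S (g \ Y)) := by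
  obtain ⟨T, Y, h1, h2, h3, h4, h5, h6, h7⟩ := exists_many_cones hS W N
  obtain ⟨h8, h9⟩ := h1.saturation
  refine ⟨saturation (k + 1) T, Y, h8, saturated_saturation h1.1 hk, h2, h3,
    fun y hy => (h4 y hy).saturation h1.1, (core_saturation_subset h1.1 hk).trans h5,
    fun d h => h6 d ?_, fun g hg => ?_⟩
  · unfold Plateau at *
    rw [h9] at h
    refine (minShadow_mono _ ?_).trans h
    have := card_le_card (subset_saturation h1.1)
    omega
  · rw [face_saturation h1.1 hg, h7 g (by omega)]

end

/-! ### Obstructions to being an initial segment -/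

section

variable {S T : Finset (Finset ℕ)} {A B G H Y g : Finset ℕ} {k r t d n x y z b i j : ℕ}

/-- In every `r`-face which contains `z` but not `b`, the point `z` may be replaced by `b`. -/
def Dominates (r : ℕ) (S : Finset (Finset ℕ)) (z b : ℕ) : Prop :=
  ∀ G, #G + 1 = r → z ∉ G → b ∉ G → Face S (insert z G) → Face S (insert b G)

/-- Two points are incomparable for domination, as witnessed by `A` and `B`. -/
structure IsCrossing (r : ℕ) (S : Finset (Finset ℕ)) (i j : ℕ) (A B : Finset ℕ) : Prop where
  card_left : #A + 1 = r
  card_right : #B + 1 = r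
  left_left : i ∉ A
  right_left : j ∉ A
  left_right : i ∉ B
  right_right : j ∉ B
  face_left : Face S (insert i A)
  not_face_left : ¬ Face S (insert j A)
  face_right : Face S (insert j B)
  not_face_right : ¬ Face S (insert i B)

/-- A face `A` and a nonface `B` which are in the wrong order for every colex order that refines
domination: the points of `B \ A` all precede `z ∈ A \ B`. -/
structure IsInversion (r : ℕ) (S : Finset (Finset ℕ)) (A B : Finset ℕ) (z : ℕ) : Prop where
  card_left : #A = r
  card_right : #B = r
  face : Face S A
  not_face : ¬ Face S B
  mem_left : z ∈ A
  notMem_right : z ∉ B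
  dominates : ∀ b ∈ B, b ∉ A → Dominates r S z b

/-- There is a local obstruction to the `r`-faces being an initial segment of colex, up to a
permutation of the points. -/
def Obstructed (r : ℕ) (S : Finset (Finset ℕ)) : Prop :=
  (∃ i j A B, IsCrossing r S i j A B) ∨ ∃ A B z, IsInversion r S A B z

lemma Dominates.face (hS : (S : Set (Finset ℕ)).Sized k) (hr : r ≤ k) (h : Dominates r S z b)
    (hG : #G + 1 ≤ r) (hz : z ∉ G) (hf : Face S (insert z G)) :
    Face S (insert b G) := by
  obtain ⟨g', h1, h2, h3⟩ := hf.exists_superset hS (n := r)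
    (by rw [card_insert_of_notMem hz]; exact hG) hr
  obtain ⟨h4, h5⟩ := insert_subset_iff.1 h1
  by_cases hbg : b ∈ g'
  · exact h3.mono (insert_subset hbg h5)
  · have h6 := card_erase_add_one h4
    have h7 := h (g'.erase z) (by omega) (notMem_erase _ _) (fun h => hbg (mem_of_mem_erase h))
      (by rwa [insert_erase h4])
    exact h7.mono (insert_subset_insert _ (subset_erase.2 ⟨h5, hz⟩))

/-- An obstruction survives the addition of cone points away from a finite set. -/
lemma Obstructed.exists_finset (hS : (S : Set (Finset ℕ)).Sized (k + 1)) (hr : r ≤ k)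
    (h : Obstructed r S) : ∃ W : Finset ℕ, ∀ (T : Finset (Finset ℕ)) (Y : Finset ℕ),
      Disjoint Y W → (∀ g, #g ≤ k → (Face T g ↔ Face S (g \ Y))) → Obstructed r T := by
  rcases h with ⟨i, j, A, B, h⟩ | ⟨A, B, z, h⟩
  · refine ⟨insert i (insert j (A ∪ B)), fun T Y hY hT => Or.inl ⟨i, j, A, B, ?_⟩⟩
    have key : ∀ g, #g = r → g ⊆ insert i (insert j (A ∪ B)) → (Face T g ↔ Face S g) := by
      intro g hg hsub
      rw [hT g (by omega), sdiff_eq_self_of_disjoint]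
      exact (disjoint_of_subset_right hsub hY).symm
    obtain ⟨h1, h2, h3, h4, h5, h6, h7, h8, h9, h10⟩ := h
    refine ⟨h1, h2, h3, h4, h5, h6, ?_, ?_, ?_, ?_⟩
    · rwa [key _ (by rw [card_insert_of_notMem h3, h1]) (by grind)]
    · rwa [key _ (by rw [card_insert_of_notMem h4, h1]) (by grind)]
    · rwa [key _ (by rw [card_insert_of_notMem h6, h2]) (by grind)]
    · rwa [key _ (by rw [card_insert_of_notMem h5, h2]) (by grind)]
  · refine ⟨A ∪ B, fun T Y hY hT => Or.inr ⟨A, B, z, ?_⟩⟩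
    obtain ⟨h1, h2, h3, h4, h5, h6, h7⟩ := h
    have hdA : A \ Y = A := sdiff_eq_self_of_disjoint
      (disjoint_of_subset_right subset_union_left hY).symm
    have hdB : B \ Y = B := sdiff_eq_self_of_disjoint
      (disjoint_of_subset_right subset_union_right hY).symm
    refine ⟨h1, h2, ?_, ?_, h5, h6, fun b hb hbA G hG hzG hbG hf => ?_⟩
    · rwa [hT A (by omega), hdA]
    · rwa [hT B (by omega), hdB]
    · have hzY : z ∉ Y := fun h => (mem_sdiff.1 (hdA.symm ▸ h5)).2 h
      have hbY : b ∉ Y := fun h => (mem_sdiff.1 (hdB.symm ▸ hb)).2 h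
      rw [hT _ (by rw [card_insert_of_notMem hzG]; omega), insert_sdiff_of_notMem _ hzY] at hf
      rw [hT _ (by rw [card_insert_of_notMem hbG]; omega), insert_sdiff_of_notMem _ hbY]
      have hc := card_le_card (sdiff_subset (s := G) (t := Y))
      exact (h7 b hb hbA).face hS (by omega) (by omega) (fun h => hzG (mem_sdiff.1 h).1) hf

lemma dominates_total (h : ¬ Obstructed r S) (i j : ℕ) : Dominates r S i j ∨ Dominates r S j i := by
  by_contra! hc
  obtain ⟨h1, h2⟩ := hc
  unfold Dominates at h1 h2
  push Not at h1 h2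
  obtain ⟨A, a1, a2, a3, a4, a5⟩ := h1
  obtain ⟨B, b1, b2, b3, b4, b5⟩ := h2
  exact h (Or.inl ⟨i, j, A, B, a1, b1, a2, a3, b3, b2, a4, a5, b4, b5⟩)

lemma Dominates.trans {a c : ℕ} (h1 : Dominates r S a b) (h2 : Dominates r S b c) :
    Dominates r S a c := by
  rcases eq_or_ne a b with rfl | hab
  · exact h2
  rcases eq_or_ne b c with rfl | hbc
  · exact h1
  rcases eq_or_ne a c with rfl | hac
  · exact fun _ _ _ _ h => h
  intro G hG ha hc hf
  by_cases hb : b ∈ G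
  · have hcard := card_erase_add_one hb
    have e1 : insert b (insert a (G.erase b)) = insert a G := by
      rw [Finset.insert_comm, insert_erase hb]
    have e2 : insert c (insert a (G.erase b)) = insert a (insert c (G.erase b)) :=
      Finset.insert_comm _ _ _
    have e3 : insert b (insert c (G.erase b)) = insert c G := by
      rw [Finset.insert_comm, insert_erase hb]
    have f1 := h2 (insert a (G.erase b)) (by
      rw [card_insert_of_notMem (fun h => ha (mem_of_mem_erase h))]; omega)
      (by simp [hab.symm]) (by simp [hac.symm, hc]) (by rwa [e1])
    rw [e2] at f1
    have f2 := h1 (insert c (G.erase b)) (by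
      rw [card_insert_of_notMem (fun h => hc (mem_of_mem_erase h))]; omega)
      (by simp [hac, ha]) (by simp [hbc]) f1
    rwa [e3] at f2
  · exact h2 G hG hb hc (h1 G hG ha hb hf)

/-- If every vertex is avoided by some nonface, there is an obstruction: otherwise domination is a
total preorder, so some vertex can be replaced by all others, and a nonface avoiding it gives an
inversion. -/
lemma obstructed_of_nonfaces (hS : (S : Set (Finset ℕ)).Sized k) (hr : r ≤ k) (hr1 : 1 ≤ r)
    (hne : (vertices S).Nonempty)
    (h : ∀ z ∈ vertices S, ∃ G ⊆ vertices S, #G = r ∧ z ∉ G ∧ ¬ Face S G) : Obstructed r S := by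
  by_contra hu
  have hmin : ∀ V : Finset ℕ, V.Nonempty → ∃ z ∈ V, ∀ b ∈ V, Dominates r S z b := by
    intro V hV
    induction hV using Finset.Nonempty.cons_induction with
    | singleton a => exact ⟨a, mem_singleton_self _, fun b hb => by
        rw [mem_singleton.1 hb]; exact fun _ _ _ _ h => h⟩
    | cons a V ha hV ih =>
      obtain ⟨z, hz, hzb⟩ := ih
      rcases dominates_total hu a z with h1 | h1
      · refine ⟨a, mem_cons_self _ _, fun b hb => ?_⟩
        rcases mem_cons.1 hb with rfl | hb
        · exact fun _ _ _ _ h => h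
        · exact h1.trans (hzb b hb)
      · refine ⟨z, mem_cons.2 (Or.inr hz), fun b hb => ?_⟩
        rcases mem_cons.1 hb with rfl | hb
        · exact h1
        · exact hzb b hb
  obtain ⟨z, hz, hzb⟩ := hmin _ hne
  obtain ⟨G, hG, hGr, hzG, hGf⟩ := h z hz
  obtain ⟨A, h1, h2, h3⟩ := (mem_vertices_iff_face.1 hz).exists_superset hS (n := r)
    (by simpa using hr1) hr
  exact hu (Or.inr ⟨A, G, z, h2, hGr, h3, hGf, h1 (mem_singleton_self _), hzG,
    fun b hb _ => hzb b (hG hb)⟩)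

/-! ### Descending obstructions to deletions and links -/

lemma IsCrossing.nonMemberSubfamily (hS : Extremal (k + 1) S) (hx : ¬ Cone S x)
    (h : IsCrossing r S i j A B) (hi : x ≠ i) (hj : x ≠ j) (hA : x ∉ A) (hB : x ∉ B) :
    IsCrossing r (S.nonMemberSubfamily x) i j A B := by
  obtain ⟨h1, h2, h3, h4, h5, h6, h7, h8, h9, h10⟩ := h
  refine ⟨h1, h2, h3, h4, h5, h6, ?_, ?_, ?_, ?_⟩ <;>
    rwa [hS.face_nonMemberSubfamily hx (by simp [*])]

lemma IsCrossing.memberSubfamily (h : IsCrossing (r + 1) S i j A B) (hA : x ∈ A) (hB : x ∈ B) :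
    IsCrossing r (S.memberSubfamily x) i j (A.erase x) (B.erase x) := by
  obtain ⟨h1, h2, h3, h4, h5, h6, h7, h8, h9, h10⟩ := h
  have hi : x ≠ i := by rintro rfl; exact h3 hA
  have hj : x ≠ j := by rintro rfl; exact h4 hA
  have e : ∀ (l : ℕ) (C : Finset ℕ), x ∈ C → insert x (insert l (C.erase x)) = insert l C :=
    fun l C hC => by
    rw [Finset.insert_comm, insert_erase hC]
  have c1 := card_erase_add_one hA
  have c2 := card_erase_add_one hB
  refine ⟨by omega, by omega, fun h => h3 (mem_of_mem_erase h), fun h => h4 (mem_of_mem_erase h),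
    fun h => h5 (mem_of_mem_erase h), fun h => h6 (mem_of_mem_erase h), ?_, ?_, ?_, ?_⟩ <;>
  · rw [face_memberSubfamily (by simp [hi, hj]), e _ _ (by assumption)]
    assumption

lemma IsInversion.nonMemberSubfamily (hS : Extremal (k + 1) S) (hx : ¬ Cone S x)
    (h : IsInversion r S A B z) (hA : x ∉ A) (hB : x ∉ B) :
    IsInversion r (S.nonMemberSubfamily x) A B z := by
  obtain ⟨h1, h2, h3, h4, h5, h6, h7⟩ := h
  refine ⟨h1, h2, ?_, ?_, h5, h6, fun b hb hbA G hG hzG hbG hf => ?_⟩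
  · rwa [hS.face_nonMemberSubfamily hx hA]
  · rwa [hS.face_nonMemberSubfamily hx hB]
  · have hxG := hf.notMem_of_nonMemberSubfamily
    rw [mem_insert, not_or] at hxG
    have hxb : x ≠ b := by rintro rfl; exact hB hb
    rw [hS.face_nonMemberSubfamily hx (by simp [hxb, hxG.2])]
    exact h7 b hb hbA G hG hzG hbG hf.of_nonMemberSubfamily

lemma IsInversion.memberSubfamily (h : IsInversion (r + 1) S A B z) (hA : x ∈ A) (hB : x ∈ B) :
    IsInversion r (S.memberSubfamily x) (A.erase x) (B.erase x) z := by
  obtain ⟨h1, h2, h3, h4, h5, h6, h7⟩ := h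
  have hzx : z ≠ x := by rintro rfl; exact h6 hB
  have c1 := card_erase_add_one hA
  have c2 := card_erase_add_one hB
  refine ⟨by omega, by omega, ?_, ?_, mem_erase.2 ⟨hzx, h5⟩, fun h => h6 (mem_of_mem_erase h),
    fun b hb hbA G hG hzG hbG hf => ?_⟩
  · rwa [face_memberSubfamily (notMem_erase _ _), insert_erase hA]
  · rwa [face_memberSubfamily (notMem_erase _ _), insert_erase hB]
  · rw [mem_erase] at hb hbA
    have hbA' : b ∉ A := fun h => hbA ⟨hb.1, h⟩
    have hxG := hf.notMem_of_memberSubfamily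
    rw [face_memberSubfamily hxG, Finset.insert_comm] at hf
    rw [mem_insert, not_or] at hxG
    rw [face_memberSubfamily (by simp [hb.1.symm, hxG.2]), Finset.insert_comm]
    exact h7 b hb.2 hbA' _ (by rw [card_insert_of_notMem hxG.2]; omega) (by simp [hzx, hzG])
      (by simp [hb.1, hbG]) hf

/-! ### The induction -/

/-- The plateau statement for all obstructed extremal families for which `r + #(core S)` is less
than `n`. -/
def PlateauBelow (t d n : ℕ) : Prop :=
  ∀ k r S, k = r + t → Extremal (k + 1) S → Obstructed r S → r + #(core S) < n →
    Plateau (k + 1) #S d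

/-- Plateaus of an obstructed deletion pass to the family. -/
lemma PlateauBelow.deletion (ih : PlateauBelow t d n) (hk : k = r + t) (hS : Extremal (k + 1) S)
    (hx : x ∈ core S) (hn : r + #(core S) ≤ n) (h : Obstructed r (S.nonMemberSubfamily x)) :
    Plateau (k + 1) #S d := by
  have hc := (mem_core.1 hx).2
  refine hS.plateau_of_nonMemberSubfamily hc (ih k r _ hk (hS.split hc).1 h ?_)
  have h1 := card_le_card (core_nonMemberSubfamily_subset (S := S) (x := x))
  have h2 := card_erase_add_one hx
  omega

/-- Plateaus of an obstructed link pass to the family, if a face `g` of codimension at least two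
cannot be extended by `x`. -/
lemma PlateauBelow.link (ih : PlateauBelow t d n) (hk : k = r + t) (hS : Extremal (k + 1 + 1) S)
    (hg : #g ≤ k) (hxg : x ∉ g) (h1 : Face S g) (h2 : ¬ Face S (insert x g))
    (hn : r + #((core S).erase x) < n) (h : Obstructed r (S.memberSubfamily x)) :
    Plateau (k + 1 + 1) #S d := by
  have hc : ¬ Cone S x := fun hc => h2 (hc.face_insert hS.1 h1 (by omega))
  refine hS.plateau_of_memberSubfamily hc (g := g) (by omega) hxg h1 h2
    (ih k r _ hk (hS.split hc).2.1 h ?_)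
  have h3 := card_le_card (core_memberSubfamily_subset (S := S) (x := x))
  omega

/-- A link is obstructed if its small nonfaces have no common point: cone points may be added to
these nonfaces to give them the right size. -/
lemma obstructed_memberSubfamily (hS : (S : Set (Finset ℕ)).Sized (k + 1)) (hr : r + 1 ≤ k)
    (hr1 : 1 ≤ r) (hY : ∀ y ∈ Y, Cone S y) (hYr : 2 * r + 2 ≤ #Y) (hxY : x ∉ Y) (hx : Face S {x})
    (h : ∀ z, ∃ H, #H ≤ r ∧ z ∉ H ∧ x ∉ H ∧ (∀ h ∈ H, Face S {x, h}) ∧ ¬ Face S (insert x H)) :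
    Obstructed r (S.memberSubfamily x) := by
  have hvY : Y ⊆ vertices (S.memberSubfamily x) := by
    intro y hy
    have hyx : x ≠ y := by rintro rfl; exact hxY hy
    rw [mem_vertices_iff_face, face_memberSubfamily (by simpa using hyx), pair_comm]
    exact (hY y hy).face_insert hS hx (by simp; omega)
  refine obstructed_of_nonfaces (sized_memberSubfamily hS x) (by omega) hr1 ?_ ?_
  · have : Y.Nonempty := by rw [← card_pos]; omega
    exact this.mono hvY
  · intro z _
    obtain ⟨H, h1, h2, h3, h4, h5⟩ := h z
    have hcard : r - #H ≤ #(Y \ insert z H) := by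
      have c1 := le_card_sdiff (insert z H) Y
      have c2 := card_insert_le z H
      omega
    obtain ⟨Y', hY', hc⟩ := exists_subset_card_eq hcard
    have hdisj : Disjoint H Y' := disjoint_left.2 fun a ha ha' =>
      (mem_sdiff.1 (hY' ha')).2 (mem_insert_of_mem ha)
    have hxY' : x ∉ Y' := fun h => hxY (mem_sdiff.1 (hY' h)).1
    refine ⟨H ∪ Y', union_subset (fun a ha => ?_) (fun a ha => hvY (mem_sdiff.1 (hY' ha)).1),
      by rw [card_union_of_disjoint hdisj]; omega, ?_, ?_⟩
    · have hax : x ≠ a := by rintro rfl; exact h3 ha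
      rw [mem_vertices_iff_face, face_memberSubfamily (by simpa using hax)]
      exact h4 a ha
    · rw [mem_union, not_or]
      exact ⟨h2, fun h => (mem_sdiff.1 (hY' h)).2 (mem_insert_self _ _)⟩
    · rw [face_memberSubfamily (by simp [h3, hxY'])]
      exact fun h => h5 (h.mono (insert_subset_insert _ subset_union_left))

/-- A saturated extremal family `S` with at least `N` cone points, whose size does not start a
plateau of length `d`, while this holds for all obstructed families with a smaller value of
`r + #(core S)`. If `S` itself is obstructed, it is a minimal counterexample. -/
structure IsMinimal (t d N k r : ℕ) (S : Finset (Finset ℕ)) : Prop where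
  hk : k = r + t
  ext : Extremal (k + 1) S
  sat : Saturated (k + 1) S
  large : N ≤ #(vertices S \ core S)
  not_plateau : ¬ Plateau (k + 1) #S d
  below : PlateauBelow t d (r + #(core S))

namespace IsMinimal

variable {N : ℕ}

/-- Whether a set of vertices is a face depends only on its intersection with the core. -/
lemma face_of_inter_core (h : IsMinimal t d N k r S) (hg : #g ≤ k + 1) (hv : g ⊆ vertices S)
    {g' : Finset ℕ} (hf : Face S g') (hsub : g ∩ core S ⊆ g') : Face S g := by
  refine hf.of_sdiff_cone h.ext.1 (Y := vertices S \ core S)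
    (fun _ hy => cone_of_mem_sdiff hy) hg ?_
  intro a ha
  rw [mem_sdiff, mem_sdiff] at ha
  exact hsub (mem_inter.2 ⟨ha.1, by have := hv ha.1; tauto⟩)

lemma not_obstructed_deletion (h : IsMinimal t d N k r S) (hx : x ∈ core S) :
    ¬ Obstructed r (S.nonMemberSubfamily x) := fun ho =>
  h.not_plateau (h.below.deletion h.hk h.ext hx le_rfl ho)

lemma not_obstructed_link (h : IsMinimal t d N k (r + 1) S) (hx : x ∈ core S) :
    ¬ Obstructed r (S.memberSubfamily x) := by
  intro ho
  obtain ⟨k, rfl⟩ : ∃ j, k = j + 1 := ⟨k - 1, by have := h.hk; omega⟩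
  obtain ⟨g, h1, h2, h3, h4⟩ := h.sat.exists_face h.ext.1 (mem_core.1 hx).2
  refine h.not_plateau (h.below.link (r := r) (by have := h.hk; omega) h.ext (by omega) h2 h3 h4
    ?_ ho)
  have := card_erase_add_one hx
  omega

end IsMinimal

end

/-! ### Crossings -/

section

variable {S T : Finset (Finset ℕ)} {A B G H Y g α β : Finset ℕ} {k r t d n N x y z b i j : ℕ}

/-- A crossing inside the core: the sets may be smaller than in `IsCrossing`, because they can be
completed by cone points. -/
structure IsCoreCrossing (r : ℕ) (S : Finset (Finset ℕ)) (i j : ℕ) (α β : Finset ℕ) : Prop where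
  mem_left : i ∈ core S
  mem_right : j ∈ core S
  subset_left : α ⊆ core S
  subset_right : β ⊆ core S
  card_left : #α + 1 ≤ r
  card_right : #β + 1 ≤ r
  left_left : i ∉ α
  right_left : j ∉ α
  left_right : i ∉ β
  right_right : j ∉ β
  face_left : Face S (insert i α)
  not_face_left : ¬ Face S (insert j α)
  face_right : Face S (insert j β)
  not_face_right : ¬ Face S (insert i β)

namespace IsCoreCrossing

lemma symm (h : IsCoreCrossing r S i j α β) : IsCoreCrossing r S j i β α :=
  ⟨h.mem_right, h.mem_left, h.subset_right, h.subset_left, h.card_right, h.card_left,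
    h.right_right, h.left_right, h.right_left, h.left_left, h.face_right, h.not_face_right,
    h.face_left, h.not_face_left⟩

lemma ne (h : IsCoreCrossing r S i j α β) : i ≠ j := by
  rintro rfl; exact h.not_face_left h.face_left

lemma card_left_pos (h : IsCoreCrossing r S i j α β) : 1 ≤ #α := by
  rw [Nat.one_le_iff_ne_zero, Ne, card_eq_zero]
  rintro rfl
  exact h.not_face_left (mem_vertices_iff_face.1 (mem_core.1 h.mem_right).1)

end IsCoreCrossing

lemma core_subset_vertices : core S ⊆ vertices S := fun _ hx => (mem_core.1 hx).1

namespace IsMinimal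

lemma exists_coreCrossing (h : IsMinimal t d N k r S) (hc : IsCrossing r S i j A B) :
    IsCoreCrossing r S i j (A ∩ core S) (B ∩ core S) := by
  obtain ⟨h1, h2, h3, h4, h5, h6, h7, h8, h9, h10⟩ := hc
  have hk := h.hk
  have hA : A ⊆ vertices S := (h7.mono (subset_insert _ _)).subset_vertices
  have hB : B ⊆ vertices S := (h9.mono (subset_insert _ _)).subset_vertices
  have hiv : i ∈ vertices S := h7.subset_vertices (mem_insert_self _ _)
  have hjv : j ∈ vertices S := h9.subset_vertices (mem_insert_self _ _)
  have hi : i ∈ core S := by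
    rw [mem_core]
    exact ⟨hiv, fun hc => h10 (hc.face_insert h.ext.1 (h9.mono (subset_insert _ _)) (by omega))⟩
  have hj : j ∈ core S := by
    rw [mem_core]
    exact ⟨hjv, fun hc => h8 (hc.face_insert h.ext.1 (h7.mono (subset_insert _ _)) (by omega))⟩
  refine ⟨hi, hj, inter_subset_right, inter_subset_right,
    by have := card_le_card (inter_subset_left : A ∩ core S ⊆ A); omega,
    by have := card_le_card (inter_subset_left : B ∩ core S ⊆ B); omega,
    by simp [h3], by simp [h4], by simp [h5], by simp [h6],
    h7.mono (insert_subset_insert _ inter_subset_left), fun hf => h8 ?_,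
    h9.mono (insert_subset_insert _ inter_subset_left), fun hf => h10 ?_⟩
  · refine h.face_of_inter_core ?_ (insert_subset hjv hA) hf (by grind)
    rw [card_insert_of_notMem h4]; omega
  · refine h.face_of_inter_core ?_ (insert_subset hiv hB) hf (by grind)
    rw [card_insert_of_notMem h5]; omega

/-- A subset of the core completed by cone points to a set of a given size. -/
lemma exists_completion (h : IsMinimal t d N k r S) (hN : r ≤ N) (hα : #α + 1 ≤ r) :
    ∃ A, α ⊆ A ∧ #A + 1 = r ∧ ∀ x ∈ A, x ∉ α → x ∈ vertices S \ core S := by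
  have hl := h.large
  obtain ⟨A, h1, h2, h3⟩ := exists_subsuperset_card_eq (s := α) (t := α ∪ (vertices S \ core S))
    (n := r - 1) subset_union_left (by omega)
    (by have := card_le_card (subset_union_right (s₁ := α) (s₂ := vertices S \ core S)); omega)
  refine ⟨A, h1, by omega, fun x hx hxα => ?_⟩
  have := h2 hx
  rw [mem_union] at this
  tauto

/-- The core is the disjoint union of `{i, j}`, `α` and `β`: otherwise the crossing would pass to a
deletion or to a link. -/
lemma mem_iff_of_coreCrossing (h : IsMinimal t d N k r S) (hN : r ≤ N)
    (hc : IsCoreCrossing r S i j α β) (hx : x ∈ core S) (hxi : x ≠ i) (hxj : x ≠ j) :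
    x ∈ α ↔ x ∉ β := by
  have hk := h.hk
  obtain ⟨A, a1, a2, a3⟩ := h.exists_completion hN hc.card_left
  obtain ⟨B, b1, b2, b3⟩ := h.exists_completion hN hc.card_right
  have hA : ∀ x ∈ core S, x ∈ A → x ∈ α := fun x hx hxA => by
    by_contra hxα
    exact (mem_sdiff.1 (a3 x hxA hxα)).2 hx
  have hB : ∀ x ∈ core S, x ∈ B → x ∈ β := fun x hx hxB => by
    by_contra hxβ
    exact (mem_sdiff.1 (b3 x hxB hxβ)).2 hx
  have hAv : A ⊆ vertices S := fun x hxA => by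
    by_cases hxα : x ∈ α
    · exact core_subset_vertices (hc.subset_left hxα)
    · exact (mem_sdiff.1 (a3 x hxA hxα)).1
  have hBv : B ⊆ vertices S := fun x hxB => by
    by_cases hxβ : x ∈ β
    · exact core_subset_vertices (hc.subset_right hxβ)
    · exact (mem_sdiff.1 (b3 x hxB hxβ)).1
  have hi := hc.mem_left
  have hj := hc.mem_right
  have hcr : IsCrossing r S i j A B := by
    refine ⟨a2, b2, fun h => hc.left_left (hA _ hi h), fun h => hc.right_left (hA _ hj h),
      fun h => hc.left_right (hB _ hi h), fun h => hc.right_right (hB _ hj h), ?_,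
      fun hf => hc.not_face_left (hf.mono (insert_subset_insert _ a1)), ?_,
      fun hf => hc.not_face_right (hf.mono (insert_subset_insert _ b1))⟩
    · refine h.face_of_inter_core ?_ (insert_subset (core_subset_vertices hi) hAv) hc.face_left ?_
      · rw [card_insert_of_notMem (fun h => hc.left_left (hA _ hi h))]; omega
      · intro x; have := hA x; grind
    · refine h.face_of_inter_core ?_ (insert_subset (core_subset_vertices hj) hBv) hc.face_right ?_
      · rw [card_insert_of_notMem (fun h => hc.right_right (hB _ hj h))]; omega
      · intro x; have := hB x; grind
  by_contra hcon
  by_cases hxα : x ∈ α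
  · have hxβ : x ∈ β := by tauto
    obtain ⟨r, rfl⟩ : ∃ s, r = s + 1 := ⟨r - 1, by omega⟩
    exact h.not_obstructed_link hx (Or.inl ⟨i, j, _, _, hcr.memberSubfamily (a1 hxα) (b1 hxβ)⟩)
  · have hxβ : x ∉ β := by tauto
    exact h.not_obstructed_deletion hx (Or.inl ⟨i, j, _, _, hcr.nonMemberSubfamily h.ext
      (mem_core.1 hx).2 hxi hxj (fun h => hxα (hA x hx h)) (fun h => hxβ (hB x hx h))⟩)

/-- The set `β` determines `α`, so `i` and `j` form no other crossing with `β` on the right. -/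
lemma face_insert_of_face_insert (h : IsMinimal t d N k r S) (hN : r ≤ N)
    (hc : IsCoreCrossing r S i j α β) (hg : #g + 1 ≤ r) (hgc : g ⊆ core S) (hi : i ∉ g)
    (hj : j ∉ g) (hgα : g ≠ α) (hf : Face S (insert i g)) : Face S (insert j g) := by
  by_contra hf'
  have hc' : IsCoreCrossing r S i j g β := ⟨hc.mem_left, hc.mem_right, hgc, hc.subset_right, hg,
    hc.card_right, hi, hj, hc.left_right, hc.right_right, hf, hf', hc.face_right, hc.not_face_right⟩
  refine hgα ?_
  ext x
  by_cases hx : x ∈ core S ∧ x ≠ i ∧ x ≠ j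
  · rw [h.mem_iff_of_coreCrossing hN hc' hx.1 hx.2.1 hx.2.2,
      h.mem_iff_of_coreCrossing hN hc hx.1 hx.2.1 hx.2.2]
  · have h1 : x ∉ g := fun hxg => hx ⟨hgc hxg, by rintro rfl; exact hi hxg,
      by rintro rfl; exact hj hxg⟩
    have h2 : x ∉ α := fun hxg => hx ⟨hc.subset_left hxg, by rintro rfl; exact hc.left_left hxg,
      by rintro rfl; exact hc.right_left hxg⟩
    tauto

lemma face_insert_iff (h : IsMinimal t d N k r S) (hN : r ≤ N)
    (hc : IsCoreCrossing r S i j α β) (hg : #g + 1 ≤ r) (hgc : g ⊆ core S) (hi : i ∉ g)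
    (hj : j ∉ g) (hgα : g ≠ α) (hgβ : g ≠ β) : Face S (insert i g) ↔ Face S (insert j g) :=
  ⟨h.face_insert_of_face_insert hN hc hg hgc hi hj hgα,
    h.face_insert_of_face_insert hN hc.symm hg hgc hj hi hgβ⟩

/-- A crossing in which exactly one of the two sets is a singleton contradicts minimality: either
the link of some `b ∈ β` or the link of `i` is obstructed. -/
lemma not_coreCrossing_singleton (h : IsMinimal t d N k r S) (hN : 2 * r ≤ N) {a : ℕ}
    (hc : IsCoreCrossing r S i j {a} β) (hβ : 2 ≤ #β) : False := by
  have hk := h.hk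
  have hr := hc.card_right
  have ha : a ∈ core S := hc.subset_left (mem_singleton_self a)
  have hia : i ≠ a := by simpa using hc.left_left
  have hja : j ≠ a := by simpa using hc.right_left
  have haβ : a ∉ β := (h.mem_iff_of_coreCrossing (by omega) hc ha hia.symm hja.symm).1 (by simp)
  have hij := hc.ne
  have hne : ∀ b ∈ β, b ≠ a ∧ b ≠ i ∧ b ≠ j := fun b hb =>
    ⟨by rintro rfl; exact haβ hb, by rintro rfl; exact hc.left_right hb,
      by rintro rfl; exact hc.right_right hb⟩
  -- `{i, a, b}` is a nonface, because `{j, a}` is one.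
  have htriple : ∀ b ∈ β, ¬ Face S (insert i {a, b}) := by
    intro b hb hf
    obtain ⟨h1, h2, h3⟩ := hne b hb
    rw [h.face_insert_iff (by omega) hc (by rw [card_pair h1.symm]; omega)
      (by simp [insert_subset_iff, ha, hc.subset_right hb]) (by simp [hia, h2.symm])
      (by simp [hja, h3.symm])
      (by intro he; have := congrArg card he; simp [card_pair h1.symm] at this)
      (by rintro rfl; simp at haβ)] at hf
    exact hc.not_face_left (hf.mono (by grind))
  have hbj : ∀ b ∈ β, Face S {b, j} := fun b hb => hc.face_right.mono (by grind)
  have hbi : ∀ b ∈ β, Face S {b, i} := by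
    intro b hb
    obtain ⟨h1, h2, h3⟩ := hne b hb
    have := (h.face_insert_iff (g := {b}) (by omega) hc (by simp; omega)
      (by simp [hc.subset_right hb]) (by simpa using h2.symm) (by simpa using h3.symm)
      (by simpa using h1) (by rintro rfl; simp at hβ)).2 (by rw [pair_comm]; exact hbj b hb)
    rwa [pair_comm]
  obtain ⟨s, rfl⟩ : ∃ s, r = s + 1 := ⟨r - 1, by omega⟩
  have hl := h.large
  by_cases hex : ∃ b ∈ β, Face S {a, b}
  · obtain ⟨b, hb, hab⟩ := hex
    obtain ⟨h1, h2, h3⟩ := hne b hb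
    have hbc := hc.subset_right hb
    refine h.not_obstructed_link hbc (obstructed_memberSubfamily h.ext.1 (by omega) (by omega)
      (Y := vertices S \ core S) (fun _ hy => cone_of_mem_sdiff hy) (by omega)
      (fun hh => (mem_sdiff.1 hh).2 hbc) ((hbj b hb).mono (by simp)) fun z => ?_)
    rcases eq_or_ne z a with rfl | hza
    · refine ⟨insert i (β.erase b), ?_, by simp [haβ, hia.symm], by simp [h2], ?_, ?_⟩
      · have := card_erase_add_one hb
        rw [card_insert_of_notMem (fun h => hc.left_right (mem_of_mem_erase h))]; omega
      · intro x hx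
        rcases mem_insert.1 hx with rfl | hx
        · exact hbi b hb
        · exact hc.face_right.mono (by grind)
      · rw [Finset.insert_comm, insert_erase hb]; exact hc.not_face_right
    rcases eq_or_ne z j with rfl | hzj
    · refine ⟨{a, i}, by rw [card_pair hia.symm]; omega, by simp [hja, hij.symm],
        by simp [h1, h2], ?_, ?_⟩
      · intro x hx
        rcases mem_insert.1 hx with rfl | hx
        · rwa [pair_comm]
        · rw [mem_singleton.1 hx]; exact hbi b hb
      · intro hf; exact htriple b hb (hf.mono (by grind))
    · refine ⟨{a, j}, by rw [card_pair hja.symm]; omega, by simp [hza, hzj],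
        by simp [h1, h3], ?_, ?_⟩
      · intro x hx
        rcases mem_insert.1 hx with rfl | hx
        · rwa [pair_comm]
        · rw [mem_singleton.1 hx]; exact hbj b hb
      · intro hf; exact hc.not_face_left (hf.mono (by grind))
  · have hic := hc.mem_left
    refine h.not_obstructed_link hic (obstructed_memberSubfamily h.ext.1 (by omega) (by omega)
      (Y := vertices S \ core S) (fun _ hy => cone_of_mem_sdiff hy) (by omega)
      (fun hh => (mem_sdiff.1 hh).2 hic) (hc.face_left.mono (by simp)) fun z => ?_)
    rcases eq_or_ne z a with rfl | hza
    · refine ⟨β, by omega, haβ, hc.left_right, fun b hb => ?_, hc.not_face_right⟩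
      rw [pair_comm]; exact hbi b hb
    · obtain ⟨b, hb, hbz⟩ := exists_mem_ne (by omega : 1 < #β) z
      obtain ⟨h1, h2, h3⟩ := hne b hb
      refine ⟨{a, b}, by rw [card_pair h1.symm]; omega, by simp [hza, hbz.symm],
        by simp [hia, h2.symm], ?_, fun hf => hex ⟨b, hb, hf.mono (subset_insert _ _)⟩⟩
      intro x hx
      rcases mem_insert.1 hx with rfl | hx
      · exact hc.face_left
      · rw [mem_singleton.1 hx, pair_comm]; exact hbi b hb

end IsMinimal

/-! ### Compressing one point onto another -/

lemma compress_of_mem (hi : i ∈ A) (hj : j ∉ A) :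
    UV.compress {j} {i} A = insert j (A.erase i) := by
  have hij : i ≠ j := by rintro rfl; exact hj hi
  rw [UV.compress, if_pos ⟨by simpa using hj, by simpa using hi⟩]
  ext x
  simp only [sup_eq_union, mem_sdiff, mem_union, mem_singleton, mem_insert, mem_erase]
  grind

lemma compress_of_not (h : ¬ (i ∈ A ∧ j ∉ A)) : UV.compress {j} {i} A = A := by
  rw [UV.compress, if_neg]
  rintro ⟨h1, h2⟩
  exact h ⟨by simpa using h2, by simpa using h1⟩

lemma mem_compression (hij : i ≠ j) : A ∈ UV.compression {j} {i} S ↔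
    (i ∈ A ∧ j ∉ A ∧ A ∈ S ∧ insert j (A.erase i) ∈ S) ∨
    (j ∈ A ∧ i ∉ A ∧ (A ∈ S ∨ insert i (A.erase j) ∈ S)) ∨ ((i ∈ A ↔ j ∈ A) ∧ A ∈ S) := by
  rw [UV.mem_compression]
  have key : (A ∉ S ∧ ∃ b ∈ S, UV.compress {j} {i} b = A) ↔
      (A ∉ S ∧ j ∈ A ∧ i ∉ A ∧ insert i (A.erase j) ∈ S) := by
    refine and_congr_right fun hA => ⟨?_, ?_⟩
    · rintro ⟨b, hb, h⟩
      by_cases hc : i ∈ b ∧ j ∉ b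
      · rw [compress_of_mem hc.1 hc.2] at h
        subst h
        refine ⟨mem_insert_self _ _, by simp [hij], ?_⟩
        rw [erase_insert (by simp [hc.2]), insert_erase hc.1]
        exact hb
      · rw [compress_of_not hc] at h
        exact (hA (h ▸ hb)).elim
    · rintro ⟨hj, hi, h⟩
      refine ⟨_, h, ?_⟩
      rw [compress_of_mem (mem_insert_self _ _) (by simp [hij.symm]), erase_insert (by simp [hi]),
        insert_erase hj]
  rw [key]
  by_cases hi : i ∈ A <;> by_cases hj : j ∈ A
  · rw [compress_of_not (by simp [hj])]; tauto
  · rw [compress_of_mem hi hj]; tauto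
  · rw [compress_of_not (by simp [hi])]; tauto
  · rw [compress_of_not (by simp [hi])]; tauto

/-- Compression preserves the size and does not enlarge the shadow. -/
lemma Extremal.compression (hS : Extremal k S) : Extremal k (UV.compression {j} {i} S) := by
  have h1 : (UV.compression {j} {i} S : Set (Finset ℕ)).Sized k := hS.1.uvCompression (by simp)
  refine ⟨h1, le_antisymm ?_ (minShadow_le_card_shadow k _ h1)⟩
  rw [UV.card_compression, ← hS.2]
  refine UV.card_shadow_compression_le _ _ fun x hx => ⟨i, mem_singleton_self i, ?_⟩
  rw [mem_singleton.1 hx, erase_singleton, erase_singleton]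
  exact UV.isCompressed_self _ _

/-- After compressing `i` onto `j`, a face containing `i` must have been a face with `i` and with
`j`. -/
lemma Face.of_compression (hij : i ≠ j) (hi : i ∈ g) (hf : Face (UV.compression {j} {i} S) g) :
    Face S g ∧ Face S (insert j (g.erase i)) := by
  obtain ⟨A, hA, h⟩ := hf
  rcases (mem_compression hij).1 hA with ⟨h1, h2, h3, h4⟩ | ⟨h1, h2, -⟩ | ⟨h1, h2⟩
  · exact ⟨⟨A, h3, h⟩, ⟨_, h4, insert_subset_insert _ (erase_subset_erase _ h)⟩⟩
  · exact (h2 (h hi)).elim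
  · exact ⟨⟨A, h2, h⟩, ⟨A, h2, insert_subset (h1.1 (h hi)) ((erase_subset _ _).trans h)⟩⟩

lemma vertices_compression_subset (hij : i ≠ j) (hj : j ∈ vertices S) :
    vertices (UV.compression {j} {i} S) ⊆ vertices S := by
  intro x hx
  obtain ⟨A, hA, hxA⟩ := mem_vertices.1 hx
  rcases (mem_compression hij).1 hA with ⟨-, -, h, -⟩ | ⟨-, -, h | h⟩ | ⟨-, h⟩
  · exact mem_vertices.2 ⟨A, h, hxA⟩
  · exact mem_vertices.2 ⟨A, h, hxA⟩
  · rcases eq_or_ne x j with rfl | hxj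
    · exact hj
    · exact mem_vertices.2 ⟨_, h, mem_insert_of_mem (mem_erase.2 ⟨hxj, hxA⟩)⟩
  · exact mem_vertices.2 ⟨A, h, hxA⟩

lemma Cone.compression (hS : (S : Set (Finset ℕ)).Sized k) (hij : i ≠ j) (hyi : y ≠ i) (hyj : y ≠ j)
    (hy : Cone S y) : Cone (UV.compression {j} {i} S) y := by
  have fc : ∀ A ∈ S, ∀ B, #B = k → B \ {y} ⊆ A → B ∈ S := fun A hA B hB hsub =>
    (face_iff_mem hS hB).1 ((face_of_mem hA).of_sdiff_cone hS (Y := {y}) (by simpa using hy) hB.le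
      hsub)
  intro A hA hyA a ha
  have hAk : #A = k := (show (UV.compression {j} {i} S : Set (Finset ℕ)).Sized k from
    hS.uvCompression (by simp)) hA
  set B := insert y (A.erase a) with hB
  have hBk : #B = k := by
    rw [hB, card_insert_of_notMem (fun h => hyA (mem_of_mem_erase h)), card_erase_add_one ha, hAk]
  have hswap : ∀ u v, u ∈ B → v ∉ B → #(insert v (B.erase u)) = k := fun u v hu hv => by
    rw [card_insert_of_notMem (fun h => hv (mem_of_mem_erase h)), card_erase_add_one hu, hBk]
  rw [mem_compression hij] at hA ⊢
  have e1 : i ∈ B ↔ i ∈ A ∧ i ≠ a := by grind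
  have e2 : j ∈ B ↔ j ∈ A ∧ j ≠ a := by grind
  have f0 : A ∈ S → B ∈ S := fun h => fc A h B hBk (by grind)
  by_cases hi : i ∈ B <;> by_cases hj : j ∈ B
  · right; right
    refine ⟨by tauto, f0 (by tauto)⟩
  · left
    refine ⟨hi, hj, f0 (by tauto), ?_⟩
    rcases hA with ⟨h1, h2, h3, h4⟩ | ⟨h1, h2, -⟩ | ⟨h1, h2⟩
    · exact fc _ h4 _ (hswap _ _ hi hj) (by grind)
    · tauto
    · exact fc _ h2 _ (hswap _ _ hi hj) (by grind)
  · right; left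
    refine ⟨hj, hi, ?_⟩
    rcases hA with ⟨h1, h2, h3, h4⟩ | ⟨h1, h2, h3 | h3⟩ | ⟨h1, h2⟩
    · tauto
    · exact Or.inl (f0 h3)
    · exact Or.inr (fc _ h3 _ (hswap _ _ hj hi) (by grind))
    · exact Or.inl (f0 h2)
  · right; right
    refine ⟨by tauto, ?_⟩
    rcases hA with ⟨h1, h2, h3, h4⟩ | ⟨h1, h2, h3 | h3⟩ | ⟨h1, h2⟩
    · exact f0 h3
    · exact f0 h3
    · exact fc _ h3 _ hBk (by grind)
    · exact f0 h2

lemma core_compression_subset (hS : (S : Set (Finset ℕ)).Sized k) (hi : i ∈ core S)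
    (hj : j ∈ core S) (hij : i ≠ j) : core (UV.compression {j} {i} S) ⊆ core S := by
  intro x hx
  rw [mem_core] at hx
  by_contra hxc
  have hxv := vertices_compression_subset hij (core_subset_vertices hj) hx.1
  refine hx.2 ((cone_of_notMem_core hxv hxc).compression hS hij ?_ ?_)
  · rintro rfl; exact hxc hi
  · rintro rfl; exact hxc hj

namespace IsMinimal

/-- A crossing between two sets with at least two elements contradicts minimality: compressing `i`
onto `j` makes both sets nonfaces of the link of `i`. -/
lemma not_coreCrossing_of_two_le (h : IsMinimal t d N k r S) (hN : 2 * r + k + 1 ≤ N)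
    (hc : IsCoreCrossing r S i j α β) (hα : 2 ≤ #α) (hβ : 2 ≤ #β) : False := by
  have hk := h.hk
  have hr := hc.card_right
  have hrα := hc.card_left
  have hl := h.large
  have hij := hc.ne
  have hC := h.ext.compression (i := i) (j := j)
  have hcore := core_compression_subset h.ext.1 hc.mem_left hc.mem_right hij
  have hiv := core_subset_vertices hc.mem_left
  have hjv := core_subset_vertices hc.mem_right
  obtain ⟨s, rfl⟩ : ∃ s, r = s + 1 := ⟨r - 1, by omega⟩
  obtain ⟨k, rfl⟩ : ∃ j, k = j + 1 := ⟨k - 1, by omega⟩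
  set C := UV.compression {j} {i} S with hCdef
  have hconeC : ∀ y ∈ vertices S \ core S, Cone C y := by
    intro y hy
    have hyc := (mem_sdiff.1 hy).2
    refine (cone_of_mem_sdiff hy).compression h.ext.1 hij ?_ ?_
    · rintro rfl; exact hyc hc.mem_left
    · rintro rfl; exact hyc hc.mem_right
  have hnα : ¬ Face C (insert i α) := fun hf => by
    have := (hf.of_compression hij (mem_insert_self _ _)).2
    rw [erase_insert hc.left_left] at this
    exact hc.not_face_left this
  have hnβ : ¬ Face C (insert i β) := fun hf =>
    hc.not_face_right (hf.of_compression hij (mem_insert_self _ _)).1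
  -- sets of the form `g ∪ Y'` with `Y'` consisting of cone points
  have hext : ∀ g ⊆ core S, #g ≤ k + 1 + 1 → ∃ A, #A = k + 1 + 1 ∧ g ⊆ A ∧ A ⊆ vertices S ∧
      A ∩ core S ⊆ g := by
    intro g hg hgk
    obtain ⟨A, h1, h2, h3⟩ := exists_subsuperset_card_eq (s := g) (t := g ∪ (vertices S \ core S))
      (n := k + 1 + 1) subset_union_left hgk
      (by have := card_le_card (subset_union_right (s₁ := g) (s₂ := vertices S \ core S)); omega)
    refine ⟨A, h3, h1, fun x hx => ?_, fun x hx => ?_⟩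
    · have := h2 hx
      have := core_subset_vertices (S := S) (x := x)
      grind
    · have := h2 (mem_inter.1 hx).1
      grind
  -- The compression keeps `α` a face, but makes `insert i α` a nonface.
  have hfα : Face C α := by
    obtain ⟨A, a1, a2, a3, a4⟩ := hext α hc.subset_left (by omega)
    refine ⟨A, (mem_compression hij).2 (Or.inr (Or.inr ⟨?_, ?_⟩)), a2⟩
    · have hi : i ∉ A := fun hi => hc.left_left (a4 (mem_inter.2 ⟨hi, hc.mem_left⟩))
      have hj : j ∉ A := fun hj => hc.right_left (a4 (mem_inter.2 ⟨hj, hc.mem_right⟩))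
      tauto
    · exact (face_iff_mem h.ext.1 a1).1 (h.face_of_inter_core (by omega) a3
        (hc.face_left.mono (subset_insert _ _)) a4)
  have hpair : ∀ x ∈ core S, x ≠ i → x ≠ j → Face S {i, x} → Face S {j, x} → Face C {i, x} := by
    intro x hx hxi hxj h1 h2
    obtain ⟨A, a1, a2, a3, a4⟩ := hext {i, x} (by simp [insert_subset_iff, hx, hc.mem_left])
      (by rw [card_pair hxi.symm]; omega)
    have hi : i ∈ A := a2 (by simp)
    have hj : j ∉ A := fun hj => by
      have := a4 (mem_inter.2 ⟨hj, hc.mem_right⟩)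
      simp [hij.symm, hxj.symm] at this
    have hcard : #(insert j (A.erase i)) = k + 1 + 1 := by
      rw [card_insert_of_notMem (fun h => hj (mem_of_mem_erase h)), card_erase_add_one hi, a1]
    refine ⟨A, (mem_compression hij).2 (Or.inl ⟨hi, hj, ?_, ?_⟩), a2⟩
    · exact (face_iff_mem h.ext.1 a1).1 (h.face_of_inter_core (by omega) a3 h1 a4)
    · refine (face_iff_mem h.ext.1 hcard).1 (h.face_of_inter_core (by omega)
        (insert_subset hjv ((erase_subset _ _).trans a3)) h2 ?_)
      intro w hw
      have := @a4 w
      grind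
  have hsing : ∀ x ∈ core S, x ≠ i → x ≠ j → (Face S {i, x} ↔ Face S {j, x}) := by
    intro x hx hxi hxj
    exact h.face_insert_iff (g := {x}) (by omega) hc (by simp; omega) (by simpa using hx)
      (by simpa using hxi.symm) (by simpa using hxj.symm) (by rintro rfl; simp at hα)
      (by rintro rfl; simp at hβ)
  have hpairα : ∀ x ∈ α, Face C {i, x} := by
    intro x hx
    have hxi : x ≠ i := by rintro rfl; exact hc.left_left hx
    have hxj : x ≠ j := by rintro rfl; exact hc.right_left hx
    have h1 : Face S {i, x} := hc.face_left.mono (by grind)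
    exact hpair x (hc.subset_left hx) hxi hxj h1
      ((hsing x (hc.subset_left hx) hxi hxj).1 h1)
  have hpairβ : ∀ x ∈ β, Face C {i, x} := by
    intro x hx
    have hxi : x ≠ i := by rintro rfl; exact hc.left_right hx
    have hxj : x ≠ j := by rintro rfl; exact hc.right_right hx
    have h1 : Face S {j, x} := hc.face_right.mono (by grind)
    exact hpair x (hc.subset_right hx) hxi hxj ((hsing x (hc.subset_right hx) hxi hxj).2 h1) h1
  have hdisj : ∀ x ∈ α, x ∉ β := by
    intro x hx
    refine (h.mem_iff_of_coreCrossing (by omega) hc (hc.subset_left hx) ?_ ?_).1 hx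
    · rintro rfl; exact hc.left_left hx
    · rintro rfl; exact hc.right_left hx
  obtain ⟨x, hx⟩ : α.Nonempty := by rw [← card_pos]; omega
  have hpl := h.below.link (r := s) (S := C) (x := i) (g := α) (k := k) (by omega) hC (by omega)
    hc.left_left hfα hnα (by
      have := card_le_card ((erase_subset i _).trans hcore); omega)
    (obstructed_memberSubfamily hC.1 (by omega) (by omega) hconeC (by omega)
      (fun hh => (mem_sdiff.1 hh).2 hc.mem_left) ((hpairα x hx).mono (by simp)) fun z => by
        by_cases hz : z ∈ α
        · exact ⟨β, by omega, hdisj z hz, hc.left_right, hpairβ, hnβ⟩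
        · exact ⟨α, by omega, hz, hc.left_left, hpairα, hnα⟩)
  rw [hCdef, UV.card_compression] at hpl
  exact h.not_plateau hpl

/-- In a minimal counterexample, all crossings are between singletons. -/
lemma card_of_coreCrossing (h : IsMinimal t d N k r S) (hN : 2 * r + k + 1 ≤ N)
    (hc : IsCoreCrossing r S i j α β) : #α = 1 ∧ #β = 1 := by
  have h1 := hc.card_left_pos
  have h2 := hc.symm.card_left_pos
  rcases h1.eq_or_lt with h1 | h1 <;> rcases h2.eq_or_lt with h2 | h2
  · exact ⟨h1.symm, h2.symm⟩
  · obtain ⟨a, rfl⟩ := card_eq_one.1 h1.symm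
    exact (h.not_coreCrossing_singleton (by omega) hc h2).elim
  · obtain ⟨b, rfl⟩ := card_eq_one.1 h2.symm
    exact (h.not_coreCrossing_singleton (by omega) hc.symm h1).elim
  · exact (h.not_coreCrossing_of_two_le hN hc h1 h2).elim

end IsMinimal

end

/-! ### Inversions -/

section

variable {S T : Finset (Finset ℕ)} {A B G H J Y g α β : Finset ℕ} {k r t d n N x y z b i j : ℕ}

namespace IsMinimal

/-- Otherwise the inversion would pass to a deletion. -/
lemma core_subset_of_inversion (h : IsMinimal t d N k r S) (hI : IsInversion r S A B z)
    (hx : x ∈ core S) : x ∈ A ∨ x ∈ B := by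
  by_contra! hc
  exact h.not_obstructed_deletion hx
    (Or.inr ⟨A, B, z, hI.nonMemberSubfamily h.ext (mem_core.1 hx).2 hc.1 hc.2⟩)

/-- Otherwise the inversion would pass to a link. -/
lemma notMem_of_inversion (h : IsMinimal t d N k r S) (hI : IsInversion r S A B z)
    (hx : x ∈ core S) (hA : x ∈ A) : x ∉ B := by
  intro hB
  obtain ⟨r, rfl⟩ : ∃ s, r = s + 1 := ⟨r - 1, by
    have := hI.card_left; have := card_pos.2 ⟨x, hA⟩; omega⟩
  exact h.not_obstructed_link hx (Or.inr ⟨_, _, z, hI.memberSubfamily hA hB⟩)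

/-- In a minimal counterexample with an inversion, the core consists of a minimal nonface `J` and
one more point `z` which spans no edge with `J`. -/
lemma exists_core_eq_insert (h : IsMinimal t d N k r S) (hN : 2 * r + 1 ≤ N)
    (hI : IsInversion r S A B z) : ∃ (J : Finset ℕ) (z : ℕ), z ∉ J ∧ core S = insert z J ∧
      2 ≤ #J ∧ #J ≤ r ∧ ¬ Face S J ∧ (∀ b ∈ J, Face S (J.erase b)) ∧
      ∀ b ∈ J, ¬ Face S {z, b} := by
  classical
  -- choose an inversion with `#(A \ B)` minimal
  have hex : ∃ n A B z, IsInversion r S A B z ∧ #(A \ B) = n := ⟨_, A, B, z, hI, rfl⟩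
  obtain ⟨A, B, z, hI, hn⟩ := Nat.find_spec hex
  have hmin : ∀ A' B' z', IsInversion r S A' B' z' → #(A \ B) ≤ #(A' \ B') := by
    intro A' B' z' hI'
    rw [hn]
    exact Nat.find_min' hex ⟨A', B', z', hI', rfl⟩
  clear hn hex
  have hk := h.hk
  obtain ⟨cA, cB, fA, fB, zA, zB, dom⟩ := id hI
  have hAv := fA.subset_vertices
  have hsd : #(A \ B) = #(B \ A) := by
    have h1 := card_sdiff_add_card_inter A B
    have h2 := card_sdiff_add_card_inter B A
    rw [inter_comm] at h2; omega
  -- Exchanging a point of `A \ B` other than `z` with a point of `B \ A` would give an inversion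
  -- with fewer points in `A \ B`, so it turns `A` into a nonface and `B` into a face.
  have hswapA : ∀ a ∈ A, a ≠ z → a ∉ B → ∀ b ∈ B, b ∉ A → ¬ Face S (insert b (A.erase a)) := by
    intro a ha haz haB b hb hbA hf
    have hI' : IsInversion r S (insert b (A.erase a)) B z := by
      refine ⟨?_, cB, hf, fB, mem_insert_of_mem (mem_erase.2 ⟨haz.symm, zA⟩), zB,
        fun b' hb' hb'A => dom b' hb' ?_⟩
      · rw [card_insert_of_notMem (fun h => hbA (mem_of_mem_erase h)), card_erase_add_one ha, cA]
      · intro h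
        exact hb'A (mem_insert_of_mem (mem_erase.2 ⟨by rintro rfl; exact haB hb', h⟩))
    have h1 := hmin _ _ _ hI'
    have h2 : insert b (A.erase a) \ B ⊂ A \ B := by
      refine ⟨by intro x; grind, fun hs => ?_⟩
      have := hs (mem_sdiff.2 ⟨ha, haB⟩)
      have hab : a ≠ b := by rintro rfl; exact hbA ha
      simp [hab] at this
    exact absurd (card_lt_card h2) (by omega)
  have hswapB : ∀ a ∈ A, a ≠ z → a ∉ B → ∀ b ∈ B, b ∉ A → Face S (insert a (B.erase b)) := by
    intro a ha haz haB b hb hbA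
    by_contra hf
    have hI' : IsInversion r S A (insert a (B.erase b)) z := by
      refine ⟨cA, ?_, fA, hf, zA, by simp [haz.symm, zB], fun b' hb' hb'A => dom b' ?_ hb'A⟩
      · rw [card_insert_of_notMem (fun h => haB (mem_of_mem_erase h)), card_erase_add_one hb, cB]
      · rcases mem_insert.1 hb' with rfl | hb'
        · exact (hb'A ha).elim
        · exact mem_of_mem_erase hb'
    have h1 := hmin _ _ _ hI'
    have h2 : A \ insert a (B.erase b) ⊂ A \ B := by
      refine ⟨by intro x; grind, fun hs => ?_⟩
      have := hs (mem_sdiff.2 ⟨ha, haB⟩)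
      simp at this
    exact absurd (card_lt_card h2) (by omega)
  have hbv : ∀ b ∈ B, b ∉ A → b ∈ vertices S := by
    intro b hb hbA
    have := dom b hb hbA (A.erase z) (by rw [card_erase_add_one zA, cA]) (notMem_erase _ _)
      (fun h => hbA (mem_of_mem_erase h)) (by rwa [insert_erase zA])
    exact this.subset_vertices (mem_insert_self _ _)
  have hBv : B ⊆ vertices S := fun b hb => by
    by_cases hbA : b ∈ A
    · exact hAv hbA
    · exact hbv b hb hbA
  -- `A \ B` contains a point besides `z`
  have hzAB : z ∈ A \ B := mem_sdiff.2 ⟨zA, zB⟩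
  have htwo : 2 ≤ #(A \ B) := by
    by_contra! hlt
    have h1 : #(A \ B) = 1 := by have := card_pos.2 ⟨z, hzAB⟩; omega
    obtain ⟨b, hb⟩ := card_eq_one.1 (hsd ▸ h1)
    obtain ⟨z', hz'⟩ := card_eq_one.1 h1
    rw [hz', mem_singleton] at hzAB
    subst hzAB
    obtain ⟨hbB, hbA⟩ := mem_sdiff.1 (hb.symm ▸ mem_singleton_self b : b ∈ B \ A)
    have := dom b hbB hbA (A.erase z) (by rw [card_erase_add_one zA, cA]) (notMem_erase _ _)
      (fun h => hbA (mem_of_mem_erase h)) (by rwa [insert_erase zA])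
    refine fB (this.mono fun x hx => ?_)
    by_cases hxA : x ∈ A
    · exact mem_insert_of_mem (mem_erase.2 ⟨by rintro rfl; exact zB hx, hxA⟩)
    · have : x ∈ B \ A := mem_sdiff.2 ⟨hx, hxA⟩
      rw [hb, mem_singleton] at this
      exact this ▸ mem_insert_self _ _
  obtain ⟨a₀, ha₀, ha₀z⟩ := exists_mem_ne (by omega : 1 < #(A \ B)) z
  rw [mem_sdiff] at ha₀
  have hYbig : ∃ y ∈ vertices S \ core S, y ∉ A ∪ B := by
    by_contra! hcon
    have h1 := card_le_card (show vertices S \ core S ⊆ A ∪ B from hcon)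
    have h2 := card_union_le A B
    have h3 := h.large
    omega
  -- A point of `A \ B` other than `z` may be replaced by a cone point outside
  -- `A ∪ B`, so it lies outside the core.
  have haY : ∀ a ∈ A, a ≠ z → a ∉ B → a ∉ core S := by
    intro a ha haz haB hac
    obtain ⟨y, hy, hyAB⟩ := hYbig
    rw [mem_union, not_or] at hyAB
    have hya : a ≠ y := by rintro rfl; exact hyAB.1 ha
    have hc : #(insert y (A.erase a)) = r := by
      rw [card_insert_of_notMem (fun h => hyAB.1 (mem_of_mem_erase h)), card_erase_add_one ha, cA]
    have hI' : IsInversion r S (insert y (A.erase a)) B z := by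
      refine ⟨hc, cB, ?_, fB, mem_insert_of_mem (mem_erase.2 ⟨haz.symm, zA⟩), zB,
        fun b' hb' hb'A => dom b' hb' ?_⟩
      · refine (fA.mono (erase_subset a A)).of_sdiff_cone h.ext.1 (Y := {y})
          (by simpa using cone_of_mem_sdiff hy) (by omega) (by grind)
      · intro h
        exact hb'A (mem_insert_of_mem (mem_erase.2 ⟨by rintro rfl; exact haB hb', h⟩))
    rcases h.core_subset_of_inversion hI' hac with h1 | h1
    · simp [hya] at h1
    · exact haB h1
  have hAB : ∀ x ∈ A, x ∈ B → x ∉ core S := fun x hxA hxB hx =>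
    h.notMem_of_inversion hI hx hxA hxB
  have hJface : ∀ b ∈ B, b ∉ A → Face S (B.erase b) := fun b hb hbA =>
    (hswapB a₀ ha₀.1 ha₀z ha₀.2 b hb hbA).mono (subset_insert _ _)
  have hcone : ∀ b ∈ B, Cone S b → Face S (B.erase b) → False := by
    intro b hb hc hf
    have h1 := hc.face_insert h.ext.1 hf (by have := card_erase_add_one hb; omega)
    rw [insert_erase hb] at h1
    exact fB h1
  have hBcore : ∀ b ∈ B, b ∉ A → b ∈ core S := by
    intro b hb hbA
    rw [mem_core]
    exact ⟨hBv hb, fun hc => hcone b hb hc (hJface b hb hbA)⟩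
  obtain ⟨b₀, hb₀⟩ : (B \ A).Nonempty := by rw [← card_pos]; omega
  rw [mem_sdiff] at hb₀
  have hzcore : z ∈ core S := by
    rw [mem_core]
    refine ⟨hAv zA, fun hc => fB ?_⟩
    have h1 := hc.face_insert h.ext.1 (hJface b₀ hb₀.1 hb₀.2)
      (by have := card_erase_add_one hb₀.1; omega)
    have h2 := dom b₀ hb₀.1 hb₀.2 (B.erase b₀) (by rw [card_erase_add_one hb₀.1, cB])
      (fun h => zB (mem_of_mem_erase h)) (notMem_erase _ _) h1
    rwa [insert_erase hb₀.1] at h2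
  refine ⟨B \ A, z, by simp [zB], ?_, by omega, ?_, ?_, ?_, ?_⟩
  · ext x
    rw [mem_insert, mem_sdiff]
    constructor
    · intro hx
      have h1 := h.core_subset_of_inversion hI hx
      have h2 := hAB x
      have h3 := haY x
      tauto
    · rintro (rfl | hx)
      · exact hzcore
      · exact hBcore x hx.1 hx.2
  · rw [← cB]; exact card_le_card sdiff_subset
  · intro hf
    refine fB (h.face_of_inter_core (by omega) hBv hf fun x hx => ?_)
    have := hAB x
    grind
  · intro b hb
    rw [mem_sdiff] at hb
    refine (hJface b hb.1 hb.2).mono (by grind)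
  · intro b hb hf
    rw [mem_sdiff] at hb
    refine hswapA a₀ ha₀.1 ha₀z ha₀.2 b hb.1 hb.2 (h.face_of_inter_core ?_ ?_ hf ?_)
    · rw [card_insert_of_notMem (fun h => hb.2 (mem_of_mem_erase h)), card_erase_add_one ha₀.1]
      omega
    · exact insert_subset (hBv hb.1) ((erase_subset _ _).trans hAv)
    · intro x hx
      have h1 := hAB x
      have h2 := haY x
      grind

/-- Nonfaces of size at least three of the kind described in `exists_core_eq_insert` contradict
minimality: exchanging `b₀ ∈ J` with a cone point `y₀` inside the link of `z` changes neither the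
size of the family nor that of its shadow, and makes the link of `b₀` obstructed. -/
lemma card_lt_three (h : IsMinimal t d N k r S) (hN : 2 * r + k + 2 ≤ N) (hz : z ∉ J)
    (hcore : core S = insert z J) (hJr : #J ≤ r) (hJ : ¬ Face S J)
    (hJe : ∀ b ∈ J, Face S (J.erase b)) (hzJ : ∀ b ∈ J, ¬ Face S {z, b}) : #J < 3 := by
  by_contra! hJ3
  have hk := h.hk
  have hl := h.large
  obtain ⟨s, rfl⟩ : ∃ s, r = s + 1 := ⟨r - 1, by omega⟩
  obtain ⟨k, rfl⟩ : ∃ j, k = j + 1 := ⟨k - 1, by omega⟩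
  set Y := vertices S \ core S with hY
  have hYcone : ∀ y ∈ Y, Cone S y := fun _ hy => cone_of_mem_sdiff hy
  have hYcore : ∀ y ∈ Y, y ∉ core S := fun y hy => (mem_sdiff.1 hy).2
  have hYv : Y ⊆ vertices S := sdiff_subset
  have hJcore : J ⊆ core S := hcore ▸ subset_insert _ _
  have hzcore : z ∈ core S := hcore ▸ mem_insert_self _ _
  have hzY : z ∉ Y := fun hzY => hYcore z hzY hzcore
  have hzc := (mem_core.1 hzcore).2
  obtain ⟨b₀, hb₀⟩ : J.Nonempty := by rw [← card_pos]; omega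
  obtain ⟨y₀, hy₀⟩ : Y.Nonempty := by rw [← card_pos]; omega
  have hb₀Y : b₀ ∉ Y := fun hb => hYcore _ hb (hJcore hb₀)
  have hzb₀ : z ≠ b₀ := by rintro rfl; exact hz hb₀
  set V := insert b₀ (Y.erase y₀) with hV
  have hVcard : #V = #Y := by
    rw [hV, card_insert_of_notMem (fun h => hb₀Y (mem_of_mem_erase h)), card_erase_add_one hy₀]
  have hzV : z ∉ V := by simp [hV, hzb₀, hzY]
  have hVJ : ∀ x ∈ V, x ∈ core S → x = b₀ := by
    intro x hx hxc
    rcases mem_insert.1 hx with h1 | h1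
    · exact h1
    · exact (hYcore x (mem_of_mem_erase h1) hxc).elim
  have hVv : V ⊆ vertices S :=
    insert_subset (core_subset_vertices (hJcore hb₀)) ((erase_subset _ _).trans hYv)
  obtain ⟨s0, s1, s2, s3, s4⟩ := h.ext.split hzc
  -- the link of `z` consists of all sets of cone points
  have hlink : S.memberSubfamily z = Y.powersetCard (k + 1) := by
    ext A
    rw [mem_powersetCard, mem_memberSubfamily]
    constructor
    · rintro ⟨hA, hzA⟩
      have hAk := h.ext.1 hA
      rw [card_insert_of_notMem hzA] at hAk
      refine ⟨fun x hx => ?_, by omega⟩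
      have hxv := (face_of_mem hA).subset_vertices (mem_insert_of_mem hx)
      refine mem_sdiff.2 ⟨hxv, fun hxc => ?_⟩
      rw [hcore, mem_insert] at hxc
      rcases hxc with rfl | hxJ
      · exact hzA hx
      · exact hzJ x hxJ ((face_of_mem hA).mono (by grind))
    · rintro ⟨hA, hAk⟩
      have hzA : z ∉ A := fun h => hzY (hA h)
      refine ⟨?_, hzA⟩
      have hc : #(insert z A) = k + 1 + 1 := by rw [card_insert_of_notMem hzA, hAk]
      refine (face_iff_mem h.ext.1 hc).1 (h.face_of_inter_core (g' := {z}) (by omega)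
        (insert_subset (core_subset_vertices hzcore) (hA.trans hYv))
        (mem_vertices_iff_face.1 (core_subset_vertices hzcore)) ?_)
      intro x hx
      rw [mem_inter, mem_insert] at hx
      rcases hx.1 with rfl | hxA
      · simp
      · exact (hYcore x (hA hxA) hx.2).elim
  have hfaceV : ∀ A ⊆ V, #A ≤ k + 1 + 1 → Face S A := by
    intro A hA hAk
    refine h.face_of_inter_core (g' := {b₀}) hAk (hA.trans hVv)
      (mem_vertices_iff_face.1 (core_subset_vertices (hJcore hb₀))) fun x hx => ?_
    rw [mem_inter] at hx
    exact mem_singleton.2 (hVJ x (hA hx.1) hx.2)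
  -- the modified family
  set L := V.powersetCard (k + 1) with hL
  set T := S.nonMemberSubfamily z ∪ L.image (insert z) with hT
  have hzL : ∀ A ∈ L, z ∉ A := fun A hA hzA => hzV ((mem_powersetCard.1 hA).1 hzA)
  have hT0 : T.nonMemberSubfamily z = S.nonMemberSubfamily z := by
    ext A
    simp only [hT, mem_nonMemberSubfamily, mem_union, mem_image]
    constructor
    · rintro ⟨h | ⟨B, -, rfl⟩, hA⟩
      · exact h
      · exact (hA (mem_insert_self _ _)).elim
    · exact fun h => ⟨Or.inl h, h.2⟩
  have hT1 : T.memberSubfamily z = L := by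
    ext A
    simp only [hT, mem_memberSubfamily, mem_union, mem_image, mem_nonMemberSubfamily]
    constructor
    · rintro ⟨h | ⟨B, hB, h⟩, hA⟩
      · exact (h.2 (mem_insert_self _ _)).elim
      · rwa [← erase_insert hA, ← h, erase_insert (hzL B hB)]
    · exact fun h => ⟨Or.inr ⟨A, h, rfl⟩, hzL A h⟩
  have hLcard : #L = #(S.memberSubfamily z) := by
    rw [hlink, hL, card_powersetCard, card_powersetCard, hVcard]
  have hTcard : #T = #S := by
    rw [card_eq_add z T, card_eq_add z S, hT0, hT1, hLcard]
  have hLsub : L ⊆ ∂ (S.nonMemberSubfamily z) := by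
    intro A hA
    have hzA := hzL A hA
    rw [hL, mem_powersetCard] at hA
    rw [mem_shadow_iff_face s0.1, h.ext.face_nonMemberSubfamily hzc hzA]
    exact ⟨hA.2, hfaceV A hA.1 (by omega)⟩
  have hLshadow : #(∂ L) ≤ minShadow (k + 1) #(S.memberSubfamily z) := by
    rw [hlink, card_powersetCard, minShadow_choose (by omega), ← hVcard, ← card_powersetCard]
    refine card_le_card fun B hB => ?_
    obtain ⟨A, hA, a, ha, rfl⟩ := mem_shadow_iff.1 hB
    rw [hL, mem_powersetCard] at hA
    have := card_erase_add_one ha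
    exact mem_powersetCard.2 ⟨(erase_subset _ _).trans hA.1, by omega⟩
  have hTsized : (T : Set (Finset ℕ)).Sized (k + 1 + 1) := by
    intro A hA
    rw [mem_coe, hT, mem_union, mem_image] at hA
    rcases hA with hA | ⟨B, hB, rfl⟩
    · exact s0.1 hA
    · rw [card_insert_of_notMem (hzL B hB), (mem_powersetCard.1 hB).2]
  have hText : Extremal (k + 1 + 1) T := by
    refine ⟨hTsized, le_antisymm ?_ (minShadow_le_card_shadow _ _ hTsized)⟩
    rw [card_shadow z, hT0, hT1, union_eq_right.2 hLsub, s0.2, hTcard, ← s4]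
    omega
  -- the faces of the modified family
  have hTface : ∀ g, z ∉ g → Face S g → Face T g := by
    intro g hzg hf
    obtain ⟨A, hA, hgA⟩ := (h.ext.face_nonMemberSubfamily hzc hzg).2 hf
    exact ⟨A, mem_union_left _ hA, hgA⟩
  have hTface' : ∀ g, Face T g → Face S g ∧ z ∉ g ∨ g ⊆ insert z V := by
    rintro g ⟨A, hA, hgA⟩
    rw [hT, mem_union, mem_image, mem_nonMemberSubfamily] at hA
    rcases hA with hA | ⟨B, hB, rfl⟩
    · exact Or.inl ⟨⟨A, hA.1, hgA⟩, fun h => hA.2 (hgA h)⟩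
    · exact Or.inr (hgA.trans (insert_subset_insert _ (mem_powersetCard.1 hB).1))
  have hTv : vertices T ⊆ vertices S := by
    intro x hx
    rcases hTface' _ (mem_vertices_iff_face.1 hx) with h1 | h1
    · exact mem_vertices_iff_face.2 h1.1
    · exact insert_subset (core_subset_vertices hzcore) hVv (by simpa using h1)
  have hTcone : ∀ y ∈ Y.erase y₀, Cone T y := by
    intro y hy A hA hyA a ha
    have hyV : y ∈ V := mem_insert_of_mem hy
    have hyz : z ≠ y := by rintro rfl; exact hzV hyV
    have hAk := hTsized hA
    have hc : #(insert y (A.erase a)) = k + 1 + 1 := by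
      rw [card_insert_of_notMem (fun h => hyA (mem_of_mem_erase h)), card_erase_add_one ha, hAk]
    rw [← face_iff_mem hTsized hc]
    rw [hT, mem_union, mem_image, mem_nonMemberSubfamily] at hA
    rcases hA with hA | ⟨B, hB, rfl⟩
    · refine hTface _ ?_ (face_of_mem (hYcone y (mem_of_mem_erase hy) A hA.1 hyA a ha))
      rw [mem_insert, not_or]
      exact ⟨hyz, fun h => hA.2 (mem_of_mem_erase h)⟩
    · have hzB := hzL B hB
      rw [hL, mem_powersetCard] at hB
      rcases eq_or_ne a z with rfl | haz
      · rw [erase_insert hzB] at hc ⊢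
        exact hTface _ (by simp [hyz, hzB]) (hfaceV _ (insert_subset hyV hB.1) hc.le)
      · rw [erase_insert_of_ne haz.symm, Finset.insert_comm] at hc ⊢
        refine face_of_mem (mem_union_right _ (mem_image_of_mem _ (mem_powersetCard.2 ⟨?_, ?_⟩)))
        · exact insert_subset hyV ((erase_subset _ _).trans hB.1)
        · rw [card_insert_of_notMem (by
            simp only [mem_insert, mem_erase, not_or]; exact ⟨hyz, fun h => hzB h.2⟩)] at hc
          omega
  have hTcore : core T ⊆ insert y₀ (core S) := by
    intro x hx
    rw [mem_core] at hx
    by_contra hcon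
    rw [mem_insert, not_or] at hcon
    exact hx.2 (hTcone x (mem_erase.2 ⟨hcon.1, mem_sdiff.2 ⟨hTv hx.1, hcon.2⟩⟩))
  have hnJ : ¬ Face T J := by
    intro hf
    rcases hTface' _ hf with h1 | h1
    · exact hJ h1.1
    · have : J ⊆ {b₀} := fun x hx => by
        rcases mem_insert.1 (h1 hx) with rfl | hxV
        · exact (hz hx).elim
        · exact mem_singleton.2 (hVJ x hxV (hJcore hx))
      have := card_le_card this
      simp at this; omega
  have hnz : ∀ b ∈ J.erase b₀, ¬ Face T (insert b₀ {z, b}) := by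
    intro b hb hf
    rw [mem_erase] at hb
    rcases hTface' _ hf with h1 | h1
    · exact h1.2 (by simp)
    · have := h1 (show b ∈ insert b₀ {z, b} by simp)
      rcases mem_insert.1 this with rfl | hbV
      · exact hz hb.2
      · exact hb.1 (hVJ b hbV (hJcore hb.2))
  have hTz : Face T {b₀, z} := by
    obtain ⟨B, h1, h2, h3⟩ := exists_subsuperset_card_eq (s := {b₀}) (t := V) (n := k + 1)
      (by simp [hV]) (by simp) (by omega)
    refine ⟨insert z B, mem_union_right _ (mem_image_of_mem _ (mem_powersetCard.2 ⟨h2, h3⟩)), ?_⟩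
    rw [pair_comm]
    exact insert_subset_insert _ h1
  have hTb : ∀ b ∈ J.erase b₀, Face T {b₀, b} := by
    intro b hb
    rw [mem_erase] at hb
    obtain ⟨c, hc, hcb⟩ : ∃ c ∈ J, c ∉ ({b₀, b} : Finset ℕ) := by
      by_contra! hcon
      have h1 := card_le_card (show J ⊆ {b₀, b} from hcon)
      have h2 := card_le_two (a := b₀) (b := b)
      omega
    refine hTface _ ?_ ((hJe c hc).mono ?_)
    · simp only [mem_insert, mem_singleton, not_or]
      exact ⟨hzb₀, by rintro rfl; exact hz hb.2⟩
    · simp only [mem_insert, mem_singleton, not_or] at hcb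
      simp only [insert_subset_iff, singleton_subset_iff, mem_erase]
      exact ⟨⟨fun h => hcb.1 h.symm, hb₀⟩, fun h => hcb.2 h.symm, hb.2⟩
  have hb₀T : Face T {b₀} := hTz.mono (by simp)
  have hec := card_erase_add_one hb₀
  have hpl := h.below.link (r := s) (S := T) (x := b₀) (g := J.erase b₀) (k := k) (by omega) hText
    (by omega) (notMem_erase _ _)
    (hTface _ (fun h => hz (mem_of_mem_erase h)) (hJe b₀ hb₀)) (by rwa [insert_erase hb₀]) (by
      have h1 := card_le_card (erase_subset_erase b₀ hTcore)
      have h2 : b₀ ∈ insert y₀ (core S) := mem_insert_of_mem (hJcore hb₀)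
      have h3 := card_erase_add_one h2
      have h4 := card_insert_le y₀ (core S)
      omega)
    (obstructed_memberSubfamily (Y := Y.erase y₀) hText.1 (by omega) (by omega) hTcone (by
        have := card_erase_add_one hy₀; omega)
      (fun h => hb₀Y (mem_of_mem_erase h)) hb₀T fun w => by
        rcases eq_or_ne w z with rfl | hwz
        · exact ⟨J.erase b₀, by omega, fun h => hz (mem_of_mem_erase h), notMem_erase _ _, hTb,
            by rwa [insert_erase hb₀]⟩
        · obtain ⟨b, hb, hbw⟩ := exists_mem_ne (by omega : 1 < #(J.erase b₀)) w
          have hbz : z ≠ b := by rintro rfl; exact hz (mem_of_mem_erase hb)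
          refine ⟨{z, b}, by rw [card_pair hbz]; omega, by simp [hwz, hbw.symm], ?_, ?_, hnz b hb⟩
          · simp [hzb₀.symm, (mem_erase.1 hb).1.symm]
          · intro x hx
            rcases mem_insert.1 hx with rfl | hx
            · exact hTz
            · rw [mem_singleton.1 hx]; exact hTb b hb)
  rw [hTcard] at hpl
  exact h.not_plateau hpl

end IsMinimal

end

/-! ### The irreducible families -/

section

variable {S T : Finset (Finset ℕ)} {A B G H J Y g α β : Finset ℕ} {k r t d n N x y z b i j : ℕ}

/-- A family of `K`-subsets of `V` which is defined by a condition on the intersection with `C` is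
counted by the subsets of `C` satisfying this condition. -/
lemma card_filter_inter {ι : Type*} [DecidableEq ι] {V C : Finset ι} (hC : C ⊆ V) {K : ℕ}
    (P : Finset ι → Prop) [DecidablePred P] (hP : ∀ g ⊆ C, P g → #g ≤ K) :
    #{A ∈ V.powersetCard K | P (A ∩ C)}
      = ∑ n ∈ range (#C + 1), #{g ∈ C.powersetCard n | P g} * (#(V \ C)).choose (K - n) := by
  have hfib : ∀ g ∈ C.powerset, #{A ∈ {A ∈ V.powersetCard K | P (A ∩ C)} | A ∩ C = g}
      = if P g then (#(V \ C)).choose (K - #g) else 0 := by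
    intro g hg
    rw [mem_powerset] at hg
    split_ifs with hf
    · have hgk := hP g hg hf
      rw [← card_powersetCard]
      refine card_nbij' (fun A => A \ C) (fun B => g ∪ B) ?_ ?_ ?_ ?_
      · intro A hA
        obtain ⟨hA', rfl⟩ := mem_filter.1 (mem_coe.1 hA)
        rw [mem_filter, mem_powersetCard] at hA'
        have := card_sdiff_add_card_inter A C
        have hc : #(A \ C) = K - #(A ∩ C) := by omega
        exact mem_coe.2 <| mem_powersetCard.2 ⟨sdiff_subset_sdiff hA'.1.1 Subset.rfl, hc⟩
      · intro B hB
        obtain ⟨hB, hBc⟩ := mem_powersetCard.1 (mem_coe.1 hB)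
        have hdisj : Disjoint g B := disjoint_left.2 fun x hx hxB =>
          (mem_sdiff.1 (hB hxB)).2 (hg hx)
        have hc : #(g ∪ B) = K := by rw [card_union_of_disjoint hdisj]; omega
        have hsub : (g ∪ B) ∩ C = g := by
          ext x
          have h1 := @hg x
          have h2 := @hB x
          rw [mem_sdiff] at h2
          rw [mem_inter, mem_union]; tauto
        refine mem_coe.2 <| mem_filter.2 ⟨mem_filter.2 ⟨mem_powersetCard.2 ⟨?_, hc⟩, ?_⟩, hsub⟩
        · exact union_subset (hg.trans hC) (hB.trans sdiff_subset)
        · rwa [hsub]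
      · intro A hA
        obtain ⟨-, rfl⟩ := mem_filter.1 (mem_coe.1 hA)
        ext x; simp only [mem_union, mem_inter, mem_sdiff]; tauto
      · intro B hB
        obtain ⟨hB, hBc⟩ := mem_powersetCard.1 (mem_coe.1 hB)
        ext x
        have h1 := @hg x
        have h2 := @hB x
        rw [mem_sdiff] at h2
        simp only [mem_union, mem_sdiff]; tauto
    · rw [card_eq_zero, filter_eq_empty_iff]
      rintro A hA rfl
      exact hf (mem_filter.1 hA).2
  rw [card_eq_sum_card_fiberwise (f := fun A => A ∩ C) (t := C.powerset)
    (fun A _ => by simp), sum_congr rfl hfib, sum_powerset]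
  refine sum_congr rfl fun n _ => ?_
  rw [card_filter, sum_mul]
  refine sum_congr rfl fun g hg => ?_
  rw [(mem_powersetCard.1 hg).2]
  split_ifs <;> simp

namespace IsMinimal

open Classical in
/-- Since all vertices outside the core are cone points, a family is counted by the faces of its
core. -/
lemma card_eq_sum (h : IsMinimal t d N k r S) :
    #S = ∑ n ∈ range (#(core S) + 1), #{g ∈ (core S).powersetCard n | Face S g} *
      (#(vertices S \ core S)).choose (k + 1 - n) := by
  rw [← card_filter_inter core_subset_vertices]
  · congr 1
    ext A
    rw [mem_filter, mem_powersetCard]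
    constructor
    · exact fun hA => ⟨⟨(face_of_mem hA).subset_vertices, h.ext.1 hA⟩,
        (face_of_mem hA).mono inter_subset_left⟩
    · rintro ⟨⟨hA, hAk⟩, hf⟩
      exact (face_iff_mem h.ext.1 hAk).1 (h.face_of_inter_core hAk.le hA hf Subset.rfl)
  · rintro g - ⟨A, hA, hgA⟩
    rw [← h.ext.1 hA]; exact card_le_card hgA

lemma face_empty (h : IsMinimal t d N k r S) (hN : 1 ≤ N) : Face S ∅ := by
  have hl := h.large
  obtain ⟨y, hy⟩ : (vertices S \ core S).Nonempty := by rw [← card_pos]; omega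
  exact (mem_vertices_iff_face.1 (mem_sdiff.1 hy).1).mono (empty_subset _)

open Classical in
lemma card_faces_zero (h : IsMinimal t d N k r S) (hN : 1 ≤ N) :
    #{g ∈ (core S).powersetCard 0 | Face S g} = 1 := by
  rw [powersetCard_zero, filter_singleton, if_pos (h.face_empty hN), card_singleton]

open Classical in
lemma card_faces_one : #{g ∈ (core S).powersetCard 1 | Face S g} = #(core S) := by
  rw [filter_true_of_mem, card_powersetCard, Nat.choose_one_right]
  intro g hg
  rw [mem_powersetCard] at hg
  obtain ⟨x, rfl⟩ := card_eq_one.1 hg.2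
  exact mem_vertices_iff_face.1 (core_subset_vertices (hg.1 (mem_singleton_self x)))

open Classical in
lemma card_faces_eq_zero {m : ℕ} (h : ∀ g ⊆ core S, #g = m → ¬ Face S g) :
    #{g ∈ (core S).powersetCard m | Face S g} = 0 := by
  rw [card_eq_zero, filter_eq_empty_iff]
  intro g hg
  rw [mem_powersetCard] at hg
  exact h g hg.1 hg.2

/-- A minimal counterexample has one of three possible sizes for each number of cone points. With a
crossing, the core has four points, no face of size three, and `e` faces of size two. With an
inversion, it has three points and no face of size two; splitting one cone point off the count gives
the same form with `e = 3`. -/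
theorem exists_card_eq (h : IsMinimal t d N k r S) (hN : 2 * r + k + 2 ≤ N)
    (ho : Obstructed r S) : t + 2 ≤ k ∧ ∃ y e, N ≤ y + 1 ∧ 2 ≤ e ∧ e ≤ 4 ∧
      #S = y.choose (k + 1) + 4 * y.choose k + e * y.choose (k - 1) := by
  classical
  have hk := h.hk
  have hl := h.large
  rcases ho with ⟨i, j, A, B, hc⟩ | ⟨A, B, z, hI⟩
  · have hc := h.exists_coreCrossing hc
    obtain ⟨h1, h2⟩ := h.card_of_coreCrossing (by omega) hc
    obtain ⟨a, ha⟩ := card_eq_one.1 h1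
    obtain ⟨b, hb⟩ := card_eq_one.1 h2
    rw [ha, hb] at hc
    clear h1 h2 ha hb
    have hr := hc.card_left
    rw [card_singleton] at hr
    have hac : a ∈ core S := hc.subset_left (mem_singleton_self a)
    have hbc : b ∈ core S := hc.subset_right (mem_singleton_self b)
    have hia : i ≠ a := by simpa using hc.left_left
    have hja : j ≠ a := by simpa using hc.right_left
    have hib : i ≠ b := by simpa using hc.left_right
    have hjb : j ≠ b := by simpa using hc.right_right
    have hij := hc.ne
    have hab : a ≠ b := by
      have := (h.mem_iff_of_coreCrossing (by omega) hc hac hia.symm hja.symm).1 (by simp)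
      simpa using this
    have hcore : core S = {i, j, a, b} := by
      ext x
      simp only [mem_insert, mem_singleton]
      constructor
      · intro hx
        have := h.mem_iff_of_coreCrossing (by omega) hc hx
        simp only [mem_singleton] at this
        tauto
      · rintro (rfl | rfl | rfl | rfl)
        exacts [hc.mem_left, hc.mem_right, hac, hbc]
    have hcard : #(core S) = 4 := by
      rw [hcore, card_insert_of_notMem (by simp [*]), card_insert_of_notMem (by simp [*]),
        card_pair hab]
    have hbig : ∀ g ⊆ core S, 3 ≤ #g → ¬ Face S g := by
      intro g hg hg3 hf
      have hmiss : ∀ u v, u ≠ v → u ∈ core S → v ∈ core S → u ∉ g → v ∉ g → False := by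
        intro u v huv hu hv hug hvg
        have h1 := card_le_card (show insert u (insert v g) ⊆ core S from
          insert_subset hu (insert_subset hv hg))
        rw [card_insert_of_notMem (by simp [huv, hug]), card_insert_of_notMem hvg] at h1
        omega
      have hi := hc.mem_left
      have hj := hc.mem_right
      have n1 : ¬ (j ∈ g ∧ a ∈ g) := fun hh => hc.not_face_left (hf.mono (by grind))
      have n2 : ¬ (i ∈ g ∧ b ∈ g) := fun hh => hc.not_face_right (hf.mono (by grind))
      by_cases hjg : j ∈ g <;> by_cases hig : i ∈ g
      · exact hmiss a b hab hac hbc (by tauto) (by tauto)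
      · exact hmiss a i hia.symm hac hi (by tauto) (by tauto)
      · exact hmiss j b hjb hj hbc (by tauto) (by tauto)
      · exact hmiss j i hij.symm hj hi (by tauto) (by tauto)
    set e := #{g ∈ (core S).powersetCard 2 | Face S g} with he
    have he2 : 2 ≤ e := by
      have hsub : ({{i, a}, {j, b}} : Finset (Finset ℕ))
          ⊆ {g ∈ (core S).powersetCard 2 | Face S g} := by
        intro g hg
        rw [mem_filter, mem_powersetCard]
        rcases mem_insert.1 hg with rfl | hg
        · exact ⟨⟨by simp [hcore, insert_subset_iff], card_pair hia⟩, hc.face_left⟩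
        · rw [mem_singleton.1 hg]
          exact ⟨⟨by simp [hcore, insert_subset_iff], card_pair hjb⟩, hc.face_right⟩
      have := card_le_card hsub
      rwa [card_pair] at this
      intro heq
      have : i ∈ ({j, b} : Finset ℕ) := heq ▸ mem_insert_self _ _
      simp [hij, hib] at this
    have he4 : e ≤ 4 := by
      have hsub : {g ∈ (core S).powersetCard 2 | Face S g}
          ⊆ ((core S).powersetCard 2 \ {{j, a}, {i, b}}) := by
        intro g hg
        rw [mem_filter] at hg
        rw [mem_sdiff, mem_insert, mem_singleton]
        refine ⟨hg.1, ?_⟩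
        rintro (rfl | rfl)
        · exact hc.not_face_left hg.2
        · exact hc.not_face_right hg.2
      have h1 := card_le_card hsub
      have h2 : ({{j, a}, {i, b}} : Finset (Finset ℕ)) ⊆ (core S).powersetCard 2 := by
        intro g hg
        rw [mem_powersetCard]
        rcases mem_insert.1 hg with rfl | hg
        · exact ⟨by simp [hcore, insert_subset_iff], card_pair hja⟩
        · rw [mem_singleton.1 hg]
          exact ⟨by simp [hcore, insert_subset_iff], card_pair hib⟩
      rw [card_sdiff_of_subset h2, card_powersetCard, hcard, card_pair] at h1
      · have : Nat.choose 4 2 = 6 := rfl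
        omega
      · intro heq
        have : j ∈ ({i, b} : Finset ℕ) := heq ▸ mem_insert_self _ _
        simp [hij.symm, hjb] at this
    refine ⟨by omega, #(vertices S \ core S), e, by omega, he2, he4, ?_⟩
    rw [h.card_eq_sum, hcard]
    simp only [sum_range_succ, range_zero, sum_empty, zero_add]
    rw [h.card_faces_zero (by omega), card_faces_one,
      card_faces_eq_zero (m := 3) (fun g hg hg3 => hbig g hg (by omega)),
      card_faces_eq_zero (m := 4) (fun g hg hg3 => hbig g hg (by omega)), hcard]
    simp only [Nat.sub_zero, Nat.add_sub_cancel, one_mul, zero_mul, add_zero]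
    rw [show k + 1 - 2 = k - 1 by omega]
  · obtain ⟨J, z, hz, hcore, hJ2, hJr, hJ, hJe, hzJ⟩ := h.exists_core_eq_insert (by omega) hI
    have hJ3 := h.card_lt_three hN hz hcore hJr hJ hJe hzJ
    have hJ2 : #J = 2 := by omega
    have hcard : #(core S) = 3 := by rw [hcore, card_insert_of_notMem hz, hJ2]
    have hbig : ∀ g ⊆ core S, 2 ≤ #g → ¬ Face S g := by
      intro g hg hg2 hf
      by_cases hzg : z ∈ g
      · obtain ⟨b, hb, hbz⟩ := exists_mem_ne (by omega : 1 < #g) z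
        have hbJ : b ∈ J := by
          have := hg hb
          rw [hcore, mem_insert] at this
          tauto
        exact hzJ b hbJ (hf.mono (by simp [insert_subset_iff, hzg, hb]))
      · have hgJ : g ⊆ J := fun x hx => by
          have := hg hx
          rw [hcore, mem_insert] at this
          rcases this with rfl | hxJ
          · exact (hzg hx).elim
          · exact hxJ
        rw [eq_of_subset_of_card_le hgJ (by omega)] at hf
        exact hJ hf
    obtain ⟨y, hy⟩ : ∃ y, #(vertices S \ core S) = y + 1 :=
      ⟨#(vertices S \ core S) - 1, by omega⟩
    obtain ⟨k, rfl⟩ : ∃ l, k = l + 1 := ⟨k - 1, by omega⟩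
    refine ⟨by omega, y, 3, by omega, by omega, by omega, ?_⟩
    rw [h.card_eq_sum, hcard]
    simp only [sum_range_succ, range_zero, sum_empty, zero_add]
    rw [h.card_faces_zero (by omega), card_faces_one,
      card_faces_eq_zero (m := 2) (fun g hg hg2 => hbig g hg (by omega)),
      card_faces_eq_zero (m := 3) (fun g hg hg3 => hbig g hg (by omega)), hcard, hy]
    simp only [Nat.sub_zero, Nat.add_sub_cancel, one_mul, zero_mul, add_zero]
    rw [Nat.choose_succ_succ y (k + 1), Nat.choose_succ_succ y k]
    simp only [Nat.succ_eq_add_one]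
    ring

end IsMinimal

/-- For `r ≤ 1` all families of `r`-sets are initial segments up to a permutation. -/
lemma Obstructed.two_le (h : Obstructed r S) : 2 ≤ r := by
  by_contra! hr
  rcases h with ⟨i, j, A, B, h⟩ | ⟨A, B, z, h⟩
  · have h1 := h.card_left
    have h2 := h.card_right
    obtain rfl : A = ∅ := card_eq_zero.1 (by omega)
    obtain rfl : B = ∅ := card_eq_zero.1 (by omega)
    exact h.not_face_left h.face_right
  · have h1 := h.card_left
    have h2 := h.card_right
    have h3 := card_pos.2 ⟨z, h.mem_left⟩
    obtain ⟨a, rfl⟩ := card_eq_one.1 (show #A = 1 by omega)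
    obtain ⟨b, rfl⟩ := card_eq_one.1 (show #B = 1 by omega)
    obtain rfl := mem_singleton.1 h.mem_left
    have hzb : b ≠ z := fun hb => h.notMem_right (by simp [hb])
    exact h.not_face (h.dominates b (mem_singleton_self b) (by simpa using hzb) ∅
      (by simpa using h1) (notMem_empty _) (notMem_empty _) h.face)

/-- If the sizes of the irreducible families start plateaus of length `d`, then so do the sizes of
all obstructed extremal families. -/
theorem plateau_of_obstructed
    (hbase : ∀ k, t + 2 ≤ k → ∃ N, ∀ y e : ℕ, N ≤ y → 2 ≤ e → e ≤ 4 →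
      Plateau (k + 1) (y.choose (k + 1) + 4 * y.choose k + e * y.choose (k - 1)) d)
    (hk : k = r + t) (hS : Extremal (k + 1) S) (ho : Obstructed r S) :
    Plateau (k + 1) #S d := by
  suffices h : ∀ n, PlateauBelow t d n from h _ k r S hk hS ho (Nat.lt_succ_self _)
  intro n
  induction n with
  | zero => intro k r S _ _ _ h; omega
  | succ n ih =>
    intro k r S hk hS ho hn
    by_contra hnp
    have hr := ho.two_le
    obtain ⟨N, hN⟩ : ∃ N, t + 2 ≤ k → ∀ y e : ℕ, N ≤ y → 2 ≤ e → e ≤ 4 →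
        Plateau (k + 1) (y.choose (k + 1) + 4 * y.choose k + e * y.choose (k - 1)) d := by
      by_cases hkt : t + 2 ≤ k
      · obtain ⟨N, hN⟩ := hbase k hkt
        exact ⟨N, fun _ => hN⟩
      · exact ⟨0, fun h => (hkt h).elim⟩
    obtain ⟨W, hW⟩ := ho.exists_finset hS.1 (by omega)
    obtain ⟨T, Y, h1, h2, h3, h4, h5, h6, h7, h8⟩ := exists_saturated hS (by omega) (W ∪ core S)
      (N + 2 * r + k + 2)
    have hoT := hW T Y (disjoint_of_subset_right subset_union_left h4) h8
    have hmin : IsMinimal t d (N + 2 * r + k + 2) k r T := by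
      refine ⟨hk, h1, h2, ?_, fun hp => hnp (h7 d hp), ?_⟩
      · rw [← h3]
        refine card_le_card fun y hy => mem_sdiff.2 ⟨?_, fun hyc => (mem_core.1 hyc).2 (h5 y hy)⟩
        rw [mem_vertices_iff_face, h8 _ (by simp; omega), sdiff_eq_empty_iff_subset.2 (by simpa)]
        rcases hoT with ⟨i, j, A, B, hc⟩ | ⟨A, B, z, hI⟩
        · have := hc.face_left.mono (empty_subset _)
          rwa [h8 _ (by simp), empty_sdiff] at this
        · have := hI.face.mono (empty_subset _)
          rwa [h8 _ (by simp), empty_sdiff] at this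
      · intro k' r' S' hk' hS' ho' hn'
        have := card_le_card h6
        exact ih k' r' S' hk' hS' ho' (by omega)
    obtain ⟨h9, y, e, h10, h11, h12, h13⟩ := hmin.exists_card_eq (by omega) hoT
    refine hmin.not_plateau ?_
    rw [h13]
    exact hN h9 y e (by omega) h11 h12

end

/-! ### Hamilton's numbers -/

lemma choose_neg_int (r : ℤ) (n : ℕ) :
    Ring.choose (-r) n = (-1) ^ n * Ring.choose (r + n - 1) n := by
  rw [Ring.choose_neg, Units.smul_def, Int.negOnePow_def]
  simp

lemma choose_natCast_eq {m k c : ℕ} (h : m.choose k = c) : Ring.choose (m : ℤ) k = c := by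
  rw [Ring.choose_natCast, h]

lemma hamilton_zero : hamilton 0 = 1 := by rw [hamilton]

lemma hamilton_succ (n : ℕ) : hamilton (n + 1) = 2 + ∑ j ∈ range n,
    (-1) ^ (n - j + 1) * Ring.choose (hamilton (j + 1)) (n - j + 1) := by
  rw [hamilton, Fin.sum_univ_eq_sum_range
    (fun j => (-1 : ℤ) ^ (n - j + 1) * Ring.choose (hamilton (j + 1)) (n - j + 1))]

lemma hamilton_one : hamilton 1 = 2 := by rw [hamilton_succ]; simp

/-- The identity behind the binomial decompositions with entries given by Hamilton's numbers. Both
sides have the same differences in `M`, and for `M = q` the identity is the recursion for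
Hamilton's numbers. -/
theorem choose_sub_choose_eq_sum (q : ℕ) : ∀ M : ℤ, Ring.choose M (q + 1) - Ring.choose M q
    = ∑ p ∈ range (q + 1 + 1), Ring.choose (M - hamilton (p + 1) - p) (q + 1 - p) := by
  induction q with
  | zero =>
    intro M
    simp only [zero_add, sum_range_succ, range_zero, sum_empty, Ring.choose_one_right,
      Ring.choose_zero_right, Nat.sub_zero, Nat.sub_self, hamilton_one]
    push_cast; ring
  | succ q ih =>
    set f : ℤ → ℤ := fun M => Ring.choose M (q + 1 + 1) - Ring.choose M (q + 1)
      - ∑ p ∈ range (q + 1 + 1 + 1), Ring.choose (M - hamilton (p + 1) - p) (q + 1 + 1 - p) with hf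
    have hper : Function.Periodic f 1 := by
      intro M
      have h1 := Ring.choose_succ_succ M (q + 1)
      have h2 := Ring.choose_succ_succ M q
      have h3 : ∑ p ∈ range (q + 1 + 1 + 1),
            Ring.choose (M + 1 - hamilton (p + 1) - p) (q + 1 + 1 - p)
          = ∑ p ∈ range (q + 1 + 1 + 1), Ring.choose (M - hamilton (p + 1) - p) (q + 1 + 1 - p)
            + ∑ p ∈ range (q + 1 + 1), Ring.choose (M - hamilton (p + 1) - p) (q + 1 - p) := by
        have h5 : ∑ p ∈ range (q + 1 + 1),
              Ring.choose (M + 1 - hamilton (p + 1) - p) (q + 1 + 1 - p)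
            = ∑ p ∈ range (q + 1 + 1), Ring.choose (M - hamilton (p + 1) - p) (q + 1 + 1 - p)
              + ∑ p ∈ range (q + 1 + 1), Ring.choose (M - hamilton (p + 1) - p) (q + 1 - p) := by
          rw [← sum_add_distrib]
          refine sum_congr rfl fun p hp => ?_
          rw [mem_range] at hp
          rw [show q + 1 + 1 - p = q + 1 - p + 1 by omega,
            show M + 1 - hamilton (p + 1) - p = M - hamilton (p + 1) - p + 1 by ring,
            Ring.choose_succ_succ, add_comm]
        rw [sum_range_succ _ (q + 1 + 1), sum_range_succ _ (q + 1 + 1), h5, Nat.sub_self,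
          Ring.choose_zero_right, Ring.choose_zero_right]
        ring
      have h4 := ih M
      simp only [hf]
      rw [h1, h2, h3, ← h4]; ring
    have hval : f ((q + 1 : ℕ) : ℤ) = 0 := by
      simp only [hf]
      rw [Ring.choose_natCast, Ring.choose_natCast, Nat.choose_succ_self, Nat.choose_self,
        sum_range_succ, sum_range_succ, Nat.sub_self, Ring.choose_zero_right,
        show q + 1 + 1 - (q + 1) = 1 by omega, Ring.choose_one_right, hamilton_succ (q + 1)]
      have h5 : ∑ p ∈ range (q + 1), Ring.choose
            (((q + 1 : ℕ) : ℤ) - hamilton (p + 1) - p) (q + 1 + 1 - p)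
          = ∑ p ∈ range (q + 1), (-1) ^ (q + 1 - p + 1)
            * Ring.choose (hamilton (p + 1)) (q + 1 - p + 1) := by
        refine sum_congr rfl fun p hp => ?_
        rw [mem_range] at hp
        rw [show q + 1 + 1 - p = q + 1 - p + 1 by omega,
          show ((q + 1 : ℕ) : ℤ) - hamilton (p + 1) - p
            = -(hamilton (p + 1) - ((q + 1 - p : ℕ) : ℤ)) by
              rw [Nat.cast_sub (by omega)]; ring, choose_neg_int]
        congr 2
        push_cast; ring
      rw [h5]; push_cast; ring
    intro M
    have h1 := hper.int_mul_eq M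
    have h2 := hper.int_mul_eq ((q + 1 : ℕ) : ℤ)
    simp only [mul_one, Int.cast_id] at h1 h2
    rw [← h2, hval] at h1
    simp only [hf] at h1
    linarith

/-- Comparison of consecutive terms in the recursion for Hamilton's numbers. -/
lemma choose_le_choose_of_sq {a b i : ℕ} (hi : 1 ≤ i) (h : (a - 1) * (a - 2) ≤ 6 * (b - a))
    (hab : a ≤ b) : a.choose (i + 2) ≤ b.choose (i + 1) := by
  have h1 : (b - a) * a.choose i ≤ b.choose (i + 1) := by
    obtain ⟨c, rfl⟩ := Nat.exists_eq_add_of_le hab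
    rw [Nat.add_sub_cancel_left, add_comm a c, Nat.add_choose_eq]
    have := single_le_sum (f := fun ij : ℕ × ℕ => c.choose ij.1 * a.choose ij.2)
      (fun _ _ => Nat.zero_le _) (mem_antidiagonal.2 (add_comm 1 i) : (1, i) ∈ antidiagonal (i + 1))
    simpa using this
  have h2 := Nat.choose_succ_right_eq a i
  have h3 := Nat.choose_succ_right_eq a (i + 1)
  have h4 : a.choose (i + 2) * ((i + 2) * (i + 1)) = a.choose i * ((a - i) * (a - (i + 1))) := by
    rw [← mul_assoc, h3, mul_right_comm, h2, mul_assoc]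
  have h5 : (a - i) * (a - (i + 1)) ≤ (a - 1) * (a - 2) :=
    Nat.mul_le_mul (by omega) (by omega)
  have h6 : 6 ≤ (i + 2) * (i + 1) := by nlinarith
  have h7 : a.choose (i + 2) * 6 ≤ b.choose (i + 1) * 6 := by
    calc a.choose (i + 2) * 6 ≤ a.choose (i + 2) * ((i + 2) * (i + 1)) := Nat.mul_le_mul_left _ h6
      _ ≤ a.choose i * (6 * (b - a)) := by
        rw [h4]; exact Nat.mul_le_mul_left _ (h5.trans h)
      _ ≤ b.choose (i + 1) * 6 := by nlinarith
  omega

lemma alternating_sum_mem (n : ℕ) : ∀ f : ℕ → ℤ, (∀ i, i + 1 < n → f (i + 1) ≤ f i) →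
    (∀ i < n, 0 ≤ f i) → 1 ≤ n →
    0 ≤ ∑ i ∈ range n, (-1) ^ i * f i ∧ ∑ i ∈ range n, (-1) ^ i * f i ≤ f 0 := by
  induction n with
  | zero => intro f _ _ h; omega
  | succ n ih =>
    intro f h1 h2 _
    rw [sum_range_succ']
    rcases Nat.eq_zero_or_pos n with rfl | hn
    · simpa using h2 0 (by omega)
    · obtain ⟨h3, h4⟩ := ih (fun i => f (i + 1)) (fun i hi => h1 (i + 1) (by omega))
        (fun i hi => h2 (i + 1) (by omega)) hn
      have h5 : ∑ i ∈ range n, (-1 : ℤ) ^ (i + 1) * f (i + 1)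
          = -∑ i ∈ range n, (-1 : ℤ) ^ i * f (i + 1) := by
        rw [← sum_neg_distrib]; exact sum_congr rfl fun i _ => by ring
      rw [h5]
      have h6 := h1 0 (by omega)
      simp only [zero_add, pow_zero, one_mul] at *
      constructor <;> linarith

lemma hamilton_two : hamilton 2 = 3 := by
  rw [hamilton_succ]
  simp [hamilton_one,
    show Ring.choose (2 : ℤ) 2 = 1 from choose_natCast_eq rfl]

lemma hamilton_three : hamilton 3 = 5 := by
  rw [hamilton_succ]
  simp [sum_range_succ, hamilton_one, hamilton_two,
    show Ring.choose (2 : ℤ) 3 = 0 from choose_natCast_eq rfl,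
    show Ring.choose (3 : ℤ) 2 = 3 from choose_natCast_eq rfl]

lemma hamilton_four : hamilton 4 = 11 := by
  rw [hamilton_succ]
  simp [sum_range_succ, hamilton_one, hamilton_two, hamilton_three,
    show Ring.choose (2 : ℤ) 4 = 0 from choose_natCast_eq rfl,
    show Ring.choose (3 : ℤ) 3 = 1 from choose_natCast_eq rfl,
    show Ring.choose (5 : ℤ) 2 = 10 from choose_natCast_eq rfl]

lemma hamilton_five : hamilton 5 = 47 := by
  rw [hamilton_succ]
  simp [sum_range_succ, hamilton_one, hamilton_two, hamilton_three, hamilton_four,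
    show Ring.choose (2 : ℤ) 5 = 0 from choose_natCast_eq rfl,
    show Ring.choose (3 : ℤ) 4 = 0 from choose_natCast_eq rfl,
    show Ring.choose (5 : ℤ) 3 = 10 from choose_natCast_eq rfl,
    show Ring.choose (11 : ℤ) 2 = 55 from choose_natCast_eq rfl]

/-- Hamilton's numbers grow at least quadratically. The recursion is an alternating sum with
decreasing terms, so that `hamilton (n + 2)` is at least
`2 + C(hamilton (n + 1), 2) - C(hamilton n, 3)`; that the terms decrease follows from the last
inequality for smaller `n`. -/
lemma sq_le_hamilton_sub (n : ℕ) : 2 ≤ hamilton (n + 1) ∧ hamilton (n + 1) < hamilton (n + 2) ∧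
    (hamilton (n + 1) - 1) * (hamilton (n + 1) - 2)
      ≤ 6 * (hamilton (n + 2) - hamilton (n + 1)) := by
  induction n using Nat.strong_induction_on with
  | _ n ih =>
  rcases Nat.lt_or_ge n 4 with hn | hn
  · interval_cases n <;> simp [hamilton_one, hamilton_two, hamilton_three, hamilton_four,
      hamilton_five]
  obtain ⟨n, rfl⟩ : ∃ l, n = l + 2 := ⟨n - 2, by omega⟩
  have hmono : ∀ p q, p ≤ q → q ≤ n + 2 → hamilton (p + 1) ≤ hamilton (q + 1) := by
    intro p q hpq hq
    induction q, hpq using Nat.le_induction with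
    | base => exact le_rfl
    | succ q _ ihq => exact (ihq (by omega)).trans (ih q (by omega)).2.1.le
  obtain ⟨h1, h2, h3⟩ := ih (n + 1) (by omega)
  have h11 : 11 ≤ hamilton (n + 1 + 1) := by
    have := hmono 3 (n + 1) (by omega) (by omega)
    rwa [hamilton_four] at this
  -- the terms of the alternating sum, from the largest index downwards
  have hterm : ∀ i ≤ n + 2, 0 ≤ Ring.choose (hamilton (n + 2 - i + 1)) (i + 2) ∧
      (i + 1 ≤ n + 2 → Ring.choose (hamilton (n + 2 - (i + 1) + 1)) (i + 1 + 2)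
        ≤ Ring.choose (hamilton (n + 2 - i + 1)) (i + 2)) := by
    intro i hi
    have hpos : ∀ p ≤ n + 2, 2 ≤ hamilton (p + 1) := fun p hp => by
      rw [← hamilton_one]; exact hmono 0 p (by omega) hp
    have h4 := hpos (n + 2 - i) (by omega)
    obtain ⟨b, hb⟩ := Int.eq_ofNat_of_zero_le (show 0 ≤ hamilton (n + 2 - i + 1) by omega)
    refine ⟨by rw [hb, Ring.choose_natCast]; positivity, fun hi' => ?_⟩
    obtain ⟨h5, h6, h7⟩ := ih (n + 2 - (i + 1)) (by omega)
    obtain ⟨a, ha⟩ := Int.eq_ofNat_of_zero_le (show 0 ≤ hamilton (n + 2 - (i + 1) + 1) by omega)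
    rw [show n + 2 - (i + 1) + 2 = n + 2 - i + 1 by omega, hb, ha] at h7
    rw [show n + 2 - (i + 1) + 2 = n + 2 - i + 1 by omega, hb, ha] at h6
    rw [ha] at h5
    rw [hb, ha, Ring.choose_natCast, Ring.choose_natCast]
    refine Int.ofNat_le.2 (choose_le_choose_of_sq (by omega) ?_ (by omega))
    zify [show 1 ≤ a by omega, show 2 ≤ a by omega, show a ≤ b by omega]
    exact h7
  set f : ℕ → ℤ := fun i => Ring.choose (hamilton (n + 2 - i + 1)) (i + 2) with hf
  have hrec : hamilton (n + 2 + 2) = 2 + ∑ i ∈ range (n + 2 + 1), (-1) ^ i * f i := by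
    rw [hamilton_succ, ← sum_range_reflect]
    congr 1
    refine sum_congr rfl fun i hi => ?_
    rw [mem_range] at hi
    rw [show n + 2 + 1 - (n + 2 + 1 - 1 - i) + 1 = i + 2 by omega,
      show n + 2 + 1 - 1 - i = n + 2 - i by omega, pow_add]
    simp [hf]
  have halt := (alternating_sum_mem (n + 2) (fun i => f (i + 1))
    (fun i hi => (hterm (i + 1) (by omega)).2 (by omega)) (fun i hi => (hterm (i + 1) (by omega)).1)
    (by omega)).2
  have hneg : ∑ i ∈ range (n + 2), (-1 : ℤ) ^ (i + 1) * f (i + 1)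
      = -∑ i ∈ range (n + 2), (-1 : ℤ) ^ i * f (i + 1) := by
    rw [← sum_neg_distrib]; exact sum_congr rfl fun i _ => by ring
  rw [sum_range_succ', hneg] at hrec
  have e0 : f 0 = Ring.choose (hamilton (n + 2 + 1)) 2 := rfl
  have e1 : f (0 + 1) = Ring.choose (hamilton (n + 1 + 1)) 3 := rfl
  simp only [pow_zero, one_mul] at hrec halt
  obtain ⟨g, hg⟩ := Int.eq_ofNat_of_zero_le (show 0 ≤ hamilton (n + 1 + 1) by omega)
  obtain ⟨h, hh⟩ := Int.eq_ofNat_of_zero_le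
    (show 0 ≤ hamilton (n + 2 + 1) by rw [show n + 1 + 2 = n + 2 + 1 by omega] at h2; omega)
  rw [show n + 1 + 2 = n + 2 + 1 by omega, hg, hh] at h2 h3
  rw [hg] at h11
  rw [e1, hg, Ring.choose_natCast] at halt
  rw [e0, hh, Ring.choose_natCast] at hrec
  rw [hh]
  have c1 := Nat.choose_succ_right_eq h 1
  have c2 := Nat.choose_succ_right_eq g 1
  have c3 := Nat.choose_succ_right_eq g 2
  rw [Nat.choose_one_right] at c1 c2
  simp only [Nat.reduceAdd] at c1 c2 c3
  zify [show 1 ≤ h by omega, show 1 ≤ g by omega, show 2 ≤ g by omega] at c1 c2 c3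
  have hX : 2 + ((h.choose 2 : ℕ) : ℤ) - ((g.choose 3 : ℕ) : ℤ) ≤ hamilton (n + 2 + 2) := by
    linarith
  have hg3 : 6 * ((g.choose 3 : ℕ) : ℤ) ≤ g * (6 * (h - g)) := by
    have : 6 * ((g.choose 3 : ℕ) : ℤ) = g * ((g - 1) * (g - 2)) := by
      linear_combination 2 * c3 + ((g : ℤ) - 2) * c2
    rw [this]
    exact mul_le_mul_of_nonneg_left h3 (by omega)
  have hQ : ((h : ℤ) - 1) * (h - 2) ≤ 6 * (hamilton (n + 2 + 2) - h) := by
    nlinarith [sq_nonneg (2 * (h : ℤ) - 3 - 3 * g),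
      mul_nonneg (sub_nonneg.2 h11) (sub_nonneg.2 h11)]
  refine ⟨by omega, ?_, hQ⟩
  nlinarith

lemma hamilton_mono {p q : ℕ} (h : p ≤ q) : hamilton p ≤ hamilton q := by
  induction q, h using Nat.le_induction with
  | base => exact le_rfl
  | succ q _ ih =>
    refine ih.trans ?_
    cases q with
    | zero => simp [hamilton_zero, hamilton_one]
    | succ q => exact (sq_le_hamilton_sub q).2.1.le

lemma hamilton_lt (p : ℕ) : hamilton p < hamilton (p + 1) := by
  cases p with
  | zero => simp [hamilton_zero, hamilton_one]
  | succ q => exact (sq_le_hamilton_sub q).2.1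

lemma hamilton_sub_mono {p q : ℕ} (h : p ≤ q) :
    hamilton (p + 1) - hamilton p ≤ hamilton (q + 1) - hamilton q := by
  induction q, h using Nat.le_induction with
  | base => exact le_rfl
  | succ q _ ih =>
    refine ih.trans ?_
    rcases Nat.lt_or_ge q 3 with hq | hq
    · interval_cases q <;> simp [hamilton_zero, hamilton_one, hamilton_two, hamilton_three,
        hamilton_four]
    · have h1 := (sq_le_hamilton_sub q).2.2
      have h2 := hamilton_mono (show 4 ≤ q + 1 by omega)
      rw [hamilton_four] at h2
      have h3 := hamilton_mono (show 1 ≤ q by omega)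
      rw [hamilton_one] at h3
      nlinarith

lemma hypotenusal_natCast (p : ℕ) : hypotenusal p = hamilton (p + 1) - hamilton p := by
  rcases Nat.eq_zero_or_pos p with rfl | hp
  · simp [hypotenusal, hamilton_zero, hamilton_one]
  · rw [hypotenusal, if_neg (by omega), Int.toNat_natCast]

lemma one_le_hypotenusal (p : ℕ) : 1 ≤ hypotenusal p := by
  have := hamilton_lt p
  rw [hypotenusal_natCast]; omega

/-! ### The sizes of the irreducible families start long plateaus -/

/-- The numbers `M + 1 - h[i] - i`, which are the entries of the binomial decompositions attached
to Hamilton's numbers. -/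
def hamiltonSeq (M i : ℕ) : ℕ := (M + 1 - hamilton i - i : ℤ).toNat

lemma one_le_hamilton (i : ℕ) : 1 ≤ hamilton i := by
  rw [← hamilton_zero]; exact hamilton_mono (Nat.zero_le i)

lemma hamiltonSeq_cast {M i q : ℕ} (hM : hamilton q + q ≤ M + 1) (hi : i ≤ q) :
    (hamiltonSeq M i : ℤ) = M + 1 - hamilton i - i := by
  have := hamilton_mono hi
  rw [hamiltonSeq, Int.toNat_of_nonneg (by omega)]

lemma hamiltonSeq_zero (M : ℕ) : hamiltonSeq M 0 = M := by simp [hamiltonSeq, hamilton_zero]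

lemma hamiltonSeq_one (M : ℕ) : hamiltonSeq M 1 = M - 2 := by
  rw [hamiltonSeq, hamilton_one]; omega

lemma hamiltonSeq_le (M i : ℕ) : hamiltonSeq M i ≤ M := by
  have := one_le_hamilton i
  rw [hamiltonSeq]; omega

lemma hamiltonSeq_succ_lt {M i q : ℕ} (hM : hamilton q + q ≤ M + 1) (hi : i + 1 ≤ q) :
    hamiltonSeq M (i + 1) < hamiltonSeq M i := by
  have h1 := hamiltonSeq_cast hM hi
  have h2 := hamiltonSeq_cast hM (show i ≤ q by omega)
  have h3 := hamilton_mono (Nat.le_succ i)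
  rw [Nat.succ_eq_add_one] at h3
  push_cast at h1
  omega

/-- The identity `choose_sub_choose_eq_sum` for natural numbers, when all entries are nonnegative.
The terms with lower index one and zero are written as the entry with index `q + 1` and the constant
`1`. -/
lemma sum_choose_hamiltonSeq {M q : ℕ} (hM : hamilton (q + 1) + (q + 1 : ℕ) ≤ M + 1) :
    ∑ i ∈ range (q + 1), (hamiltonSeq M i).choose (q + 2 - i) + (hamiltonSeq M (q + 1) + 1)
      + M.choose q = M.choose (q + 1) + M.choose (q + 2) := by
  have h := choose_sub_choose_eq_sum q M
  rw [Ring.choose_natCast, Ring.choose_natCast, sum_range_succ, sum_range_succ, Nat.sub_self,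
    Ring.choose_zero_right, Nat.add_sub_cancel_left, Ring.choose_one_right] at h
  have h1 : ∑ p ∈ range q, Ring.choose ((M : ℤ) - hamilton (p + 1) - p) (q + 1 - p)
      = ((∑ p ∈ range q, (hamiltonSeq M (p + 1)).choose (q + 2 - (p + 1)) : ℕ) : ℤ) := by
    push_cast
    refine sum_congr rfl fun p hp => ?_
    rw [mem_range] at hp
    have h2 := hamiltonSeq_cast hM (show p + 1 ≤ q + 1 by omega)
    rw [show (M : ℤ) - hamilton (p + 1) - p = (hamiltonSeq M (p + 1) : ℕ) by
      rw [h2]; push_cast; ring, Ring.choose_natCast]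
  have h3 := hamiltonSeq_cast hM (show q + 1 ≤ q + 1 from le_rfl)
  rw [h1] at h
  push_cast at h3
  rw [sum_range_succ', hamiltonSeq_zero, Nat.sub_zero]
  omega

/-- The binomial decomposition, without its last entry, of the size of an irreducible family with
`4 - s` faces of size two in its core. -/
def irreducibleSeq (y s n : ℕ) : ℕ := if n = 0 then y + 3 else hamiltonSeq (y + s) (n - 1 + s)

lemma irreducibleSeq_succ (y s n : ℕ) :
    irreducibleSeq y s (n + 1) = hamiltonSeq (y + s) (n + s) := by
  rw [irreducibleSeq, if_neg (Nat.succ_ne_zero n), Nat.add_sub_cancel]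

lemma irreducibleSeq_succ_lt {y s l n : ℕ} (hs : s ≤ 2)
    (hy : hamilton (l + s + 1) + (l + s + 1 : ℕ) ≤ y + s + 1) (hn : n ≤ l + 1) :
    irreducibleSeq y s (n + 1) < irreducibleSeq y s n := by
  rw [irreducibleSeq_succ]
  cases n with
  | zero =>
    have := hamiltonSeq_le (y + s) (0 + s)
    rw [irreducibleSeq, if_pos rfl]; omega
  | succ n =>
    rw [irreducibleSeq_succ, add_right_comm]
    exact hamiltonSeq_succ_lt (q := l + s + 1) (by push_cast at hy ⊢; omega) (by omega)

lemma sum_choose_irreducibleSeq {y s l : ℕ} (hs : s ≤ 2)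
    (hy : hamilton (l + s + 1) + (l + s + 1 : ℕ) ≤ y + s + 1) :
    ∑ n ∈ range (l + 1 + 1), (irreducibleSeq y s n).choose (l + 1 + 1 + 1 - n)
        + (hamiltonSeq (y + s) (l + 1 + s) + 1)
      = y.choose (l + 1 + 1 + 1) + 4 * y.choose (l + 1 + 1) + (4 - s) * y.choose (l + 1) := by
  have h := sum_choose_hamiltonSeq (M := y + s) (q := l + s) (by push_cast at hy ⊢; omega)
  have e1 : ∀ a b : ℕ, (a + 1).choose (b + 1) = a.choose b + a.choose (b + 1) :=
    Nat.choose_succ_succ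
  rw [sum_range_succ', show irreducibleSeq y s 0 = y + 3 from if_pos rfl, Nat.sub_zero,
    show y + 3 = y + 1 + 1 + 1 from rfl]
  simp only [irreducibleSeq_succ, e1]
  interval_cases s
  · have e : ∑ n ∈ range (l + 1), (hamiltonSeq (y + 0) (n + 0)).choose (l + 1 + 1 + 1 - (n + 1))
        = ∑ n ∈ range (l + 0 + 1), (hamiltonSeq (y + 0) n).choose (l + 0 + 2 - n) :=
      sum_congr rfl fun n _ => by congr 1; omega
    rw [e]
    simp only [add_zero, add_assoc, Nat.reduceAdd] at h ⊢
    omega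
  · have e : ∑ n ∈ range (l + 1), (hamiltonSeq (y + 1) (n + 1)).choose (l + 1 + 1 + 1 - (n + 1))
        = ∑ n ∈ range (l + 1), (hamiltonSeq (y + 1) (n + 1)).choose (l + 1 + 2 - (n + 1)) :=
      sum_congr rfl fun n _ => by congr 1
    rw [e]
    rw [sum_range_succ', hamiltonSeq_zero] at h
    simp only [e1, Nat.sub_zero, show l + 1 + 2 = l + 1 + 1 + 1 from rfl] at h ⊢
    simp only [add_assoc, Nat.reduceAdd] at h ⊢
    omega
  · have e : ∑ n ∈ range (l + 1), (hamiltonSeq (y + 2) (n + 2)).choose (l + 1 + 1 + 1 - (n + 1))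
        = ∑ n ∈ range (l + 1), (hamiltonSeq (y + 2) (n + 1 + 1)).choose (l + 2 + 2 - (n + 1 + 1)) :=
      sum_congr rfl fun n _ => by congr 1; omega
    rw [e]
    rw [show l + 2 + 1 = l + 1 + 1 + 1 from rfl, sum_range_succ', sum_range_succ', hamiltonSeq_zero,
      hamiltonSeq_one, Nat.add_sub_cancel, show y + 2 = y + 1 + 1 from rfl] at h
    simp only [e1, Nat.sub_zero, show l + 2 + 2 = l + 1 + 1 + 1 + 1 from rfl, zero_add,
      Nat.add_sub_cancel, show l + 1 + 2 = l + 1 + 1 + 1 from rfl,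
      show y + 2 = y + 1 + 1 from rfl, show l + 2 = l + 1 + 1 from rfl] at h ⊢
    simp only [add_assoc, Nat.reduceAdd] at h ⊢
    omega

/-- The sizes found in `IsMinimal.exists_card_eq` start plateaus of the length given by the
hypotenusal numbers. -/
theorem plateau_irreducible {t k : ℕ} (hk : t + 2 ≤ k) : ∃ N, ∀ y e : ℕ, N ≤ y → 2 ≤ e → e ≤ 4 →
    Plateau (k + 1) (y.choose (k + 1) + 4 * y.choose k + e * y.choose (k - 1))
      (hypotenusal t).toNat := by
  obtain ⟨l, rfl⟩ : ∃ l, k = l + 1 + 1 := ⟨k - 2, by omega⟩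
  refine ⟨(hamilton (l + 3) + (l + 3 : ℕ)).toNat, fun y e hy he2 he4 => ?_⟩
  obtain ⟨s, hs, rfl⟩ : ∃ s ≤ 2, e = 4 - s := ⟨4 - e, by omega, by omega⟩
  have h1 := hamilton_mono (show l + s + 1 ≤ l + 3 by omega)
  have hy' : hamilton (l + s + 1) + (l + s + 1 : ℕ) ≤ y + s + 1 := by push_cast at *; omega
  have h2 := sum_choose_irreducibleSeq hs hy'
  have h3 := hamilton_sub_mono (show t ≤ l + s by omega)
  rw [← hypotenusal_natCast] at h3
  have h4 := hamiltonSeq_cast (M := y + s) (i := l + s) (q := l + s + 1)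
    (by push_cast at hy' ⊢; omega) (by omega)
  have h5 := hamiltonSeq_cast (M := y + s) (i := l + s + 1) (q := l + s + 1)
    (by push_cast at hy' ⊢; omega) le_rfl
  have h6 := one_le_hypotenusal t
  have ha : ∀ i < l + 1, irreducibleSeq y s (i + 1) < irreducibleSeq y s i := fun i hi =>
    irreducibleSeq_succ_lt hs hy' hi.le
  have h7 : hamiltonSeq (y + s) (l + 1 + s) + 1 + (hypotenusal t).toNat
      ≤ irreducibleSeq y s (l + 1) := by
    rw [irreducibleSeq_succ, add_right_comm l 1 s]
    push_cast at h5
    omega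
  unfold Plateau
  rw [Nat.add_sub_cancel, ← h2, add_assoc (∑ n ∈ range (l + 1 + 1), _),
    minShadow_sum_choose_add ha (by omega) h7, minShadow_sum_choose_add ha (by omega) (by omega)]

/-! ### Initial segments of the colex order -/

section

variable {n k r t : ℕ}

/-- A family of subsets of `Fin n`, regarded as a family of sets of natural numbers. -/
def toNat (S : Finset (Finset (Fin n))) : Finset (Finset ℕ) :=
  S.map (mapEmbedding Fin.valEmbedding).toEmbedding

lemma card_toNat (S : Finset (Finset (Fin n))) : #(toNat S) = #S := card_map _

lemma mem_toNat {S : Finset (Finset (Fin n))} {B : Finset ℕ} :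
    B ∈ toNat S ↔ ∃ A ∈ S, A.map Fin.valEmbedding = B := by
  simp [toNat]

lemma sized_toNat {S : Finset (Finset (Fin n))} (hS : (S : Set (Finset (Fin n))).Sized k) :
    (toNat S : Set (Finset ℕ)).Sized k := by
  intro B hB
  obtain ⟨A, hA, rfl⟩ := mem_toNat.1 (mem_coe.1 hB)
  rw [card_map, hS hA]

lemma face_toNat_iff_mem {S : Finset (Finset (Fin n))}
    (hS : (S : Set (Finset (Fin n))).Sized k) {G : Finset (Fin n)} (hG : #G = k) :
    Face (toNat S) (G.map Fin.valEmbedding) ↔ G ∈ S := by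
  rw [face_iff_mem (sized_toNat hS) (by rw [card_map, hG]), mem_toNat]
  simp

lemma toNat_shadow (S : Finset (Finset (Fin n))) : toNat (∂ S) = ∂ (toNat S) := by
  ext B
  simp only [mem_toNat, mem_shadow_iff]
  constructor
  · rintro ⟨_, ⟨A, hA, a, ha, rfl⟩, rfl⟩
    exact ⟨_, ⟨A, hA, rfl⟩, _, mem_map_of_mem _ ha, (map_erase _ _ _).symm⟩
  · rintro ⟨_, ⟨A, hA, rfl⟩, b, hb, rfl⟩
    obtain ⟨a, ha, rfl⟩ := mem_map.1 hb
    exact ⟨_, ⟨A, hA, a, ha, rfl⟩, map_erase _ _ _⟩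

lemma toNat_iterate_shadow (t : ℕ) (S : Finset (Finset (Fin n))) :
    toNat (shadow^[t] S) = shadow^[t] (toNat S) := by
  induction t generalizing S with
  | zero => rfl
  | succ t ih => rw [Function.iterate_succ_apply, Function.iterate_succ_apply, ih, toNat_shadow]

/-- Without obstructions, sorting the points by how many points they can be replaced by turns the
family into an initial segment. -/
theorem isColexInitSeg_of_not_obstructed {T : Finset (Finset (Fin n))}
    (hT : (T : Set (Finset (Fin n))).Sized r) (h : ¬ Obstructed r (toNat T)) :
    IsColexInitSeg r T := by
  classical
  let f : Fin n → ℕ := fun i => #{j : Fin n | Dominates r (toNat T) i j}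
  have hf : ∀ z b, f b ≤ f z → Dominates r (toNat T) z b := by
    intro z b hbz
    rcases dominates_total h z b with h1 | h1
    · exact h1
    have h2 : ({j | Dominates r (toNat T) z j} : Finset (Fin n))
        ⊆ ({j | Dominates r (toNat T) b j} : Finset (Fin n)) := by
      intro c hc
      rw [mem_filter] at hc ⊢
      exact ⟨hc.1, h1.trans hc.2⟩
    have h3 : b ∈ ({j | Dominates r (toNat T) b j} : Finset (Fin n)) :=
      mem_filter.2 ⟨mem_univ _, fun _ _ _ _ h => h⟩
    rw [← eq_of_subset_of_card_le h2 hbz, mem_filter] at h3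
    exact h3.2
  refine ⟨(Tuple.sort f).symm, ?_, ?_⟩
  · intro A hA
    obtain ⟨B, hB, rfl⟩ := mem_image.1 (mem_coe.1 hA)
    rw [card_image_of_injective _ (Equiv.injective _), hT hB]
  rintro s t hs ⟨hlt, ht⟩
  obtain ⟨A, hA, rfl⟩ := mem_image.1 hs
  by_contra hnt
  obtain ⟨a, has, hat, hab⟩ := Colex.toColex_lt_toColex_iff_exists_forall_lt.1 hlt
  obtain ⟨z, hz, rfl⟩ := mem_image.1 has
  set B := t.image (Tuple.sort f) with hB
  have hBt : B.image (Tuple.sort f).symm = t := by rw [hB, image_image]; simp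
  have hBr : #B = r := by rw [hB, card_image_of_injective _ (Equiv.injective _), ht]
  have hmem : ∀ b, b ∈ B ↔ (Tuple.sort f).symm b ∈ t := by
    intro b
    rw [hB, mem_image]
    exact ⟨by rintro ⟨c, hc, rfl⟩; simpa using hc, fun hb => ⟨_, hb, by simp⟩⟩
  refine h (Or.inr ⟨A.map Fin.valEmbedding, B.map Fin.valEmbedding, z, ?_, ?_, ?_, ?_, ?_, ?_, ?_⟩)
  · rw [card_map, hT hA]
  · rw [card_map, hBr]
  · exact (face_toNat_iff_mem hT (hT hA)).2 hA
  · rw [face_toNat_iff_mem hT hBr]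
    exact fun hBT => hnt (mem_image.2 ⟨B, hBT, hBt⟩)
  · exact mem_map_of_mem _ hz
  · intro hzB
    obtain ⟨b, hb, hbz⟩ := mem_map.1 hzB
    rw [Fin.val_injective hbz] at hb
    exact hat ((hmem z).1 hb)
  · intro b' hb' hb'A
    obtain ⟨b, hb, rfl⟩ := mem_map.1 hb'
    refine hf z b ?_
    have h1 := hab _ ((hmem b).1 hb) (fun hc => hb'A ?_)
    · simpa using Tuple.monotone_sort f h1.le
    · obtain ⟨c, hc, hcb⟩ := mem_image.1 hc
      rw [(Tuple.sort f).symm.injective hcb] at hc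
      exact mem_map_of_mem _ hc

/-- In an initial segment of colex, a point may be replaced by any smaller one, so there are no
crossings. -/
theorem not_isColexInitSeg {T : Finset (Finset (Fin n))} {i j : Fin n} {A B : Finset (Fin n)}
    (hA : #A + 1 = r) (hB : #B + 1 = r) (hiA : i ∉ A) (hjA : j ∉ A) (hiB : i ∉ B) (hjB : j ∉ B)
    (h1 : insert i A ∈ T) (h2 : insert j A ∉ T) (h3 : insert j B ∈ T) (h4 : insert i B ∉ T) :
    ¬ IsColexInitSeg r T := by
  rintro ⟨σ, -, h⟩
  have key : ∀ (i j : Fin n) (A : Finset (Fin n)), #A + 1 = r → i ∉ A → j ∉ A → insert i A ∈ T →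
      insert j A ∉ T → σ i ≤ σ j := by
    intro i j A hA hiA hjA h1 h2
    by_contra! hlt
    have h5 := h (mem_image_of_mem _ h1) (t := (insert j A).image σ) ⟨?_, ?_⟩
    · obtain ⟨C, hC, hCj⟩ := mem_image.1 h5
      rw [image_injective σ.injective hCj] at hC
      exact h2 hC
    · rw [Colex.toColex_lt_toColex_iff_exists_forall_lt]
      have hij : i ≠ j := by rintro rfl; exact hlt.false
      refine ⟨σ i, by simp, by simp [hij, hiA], ?_⟩
      intro b hb hbA
      simp only [image_insert, mem_insert] at hb hbA
      rcases hb with rfl | hb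
      · exact hlt
      · exact (hbA (Or.inr hb)).elim
    · rw [card_image_of_injective _ σ.injective, card_insert_of_notMem hjA, hA]
  have h5 := key i j A hA hiA hjA h1 h2
  have h6 := key j i B hB hjB hiB h3 h4
  rw [σ.injective (le_antisymm h5 h6)] at h1
  exact h2 h1

/-! ### Lower bounds for the gaps -/

lemma Dominates.congr {S T : Finset (Finset ℕ)} {z b : ℕ}
    (hST : ∀ g, #g ≤ r → (Face T g ↔ Face S g)) (h : Dominates r S z b) : Dominates r T z b := by
  intro G hG hz hb hf
  rw [hST _ (by rw [card_insert_of_notMem ‹_›, hG])] at hf ⊢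
  exact h G hG hz hb hf

lemma Obstructed.congr {S T : Finset (Finset ℕ)} (hST : ∀ g, #g ≤ r → (Face T g ↔ Face S g))
    (h : Obstructed r S) : Obstructed r T := by
  rcases h with ⟨i, j, A, B, h⟩ | ⟨A, B, z, h⟩
  · obtain ⟨h1, h2, h3, h4, h5, h6, h7, h8, h9, h10⟩ := h
    refine Or.inl ⟨i, j, A, B, h1, h2, h3, h4, h5, h6, ?_, ?_, ?_, ?_⟩ <;>
    rw [hST _ (by rw [card_insert_of_notMem ‹_›]; omega)] <;> assumption
  · obtain ⟨h1, h2, h3, h4, h5, h6, h7⟩ := h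
    refine Or.inr ⟨A, B, z, h1, h2, ?_, ?_, h5, h6, fun b hb hbA => (h7 b hb hbA).congr hST⟩ <;>
    rw [hST _ (by omega)] <;> assumption

lemma Obstructed.of_iterate_shadow {S : Finset (Finset ℕ)}
    (hS : (S : Set (Finset ℕ)).Sized (r + t)) (h : Obstructed r (shadow^[t] S)) :
    Obstructed r S := by
  induction t generalizing S with
  | zero => exact h
  | succ t ih =>
    rw [Function.iterate_succ_apply] at h
    exact (ih hS.shadow h).congr fun g hg => (face_shadow_iff (k := r + t) hS (by omega)).symm

lemma Extremal.iterate_shadow {S : Finset (Finset ℕ)} (hS : Extremal (k + t) S) :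
    Extremal k (Finset.shadow^[t] S) := by
  induction t generalizing S with
  | zero => exact hS
  | succ t ih =>
    rw [Function.iterate_succ_apply]
    exact ih (Extremal.shadow hS)

lemma extremal_toNat {S : Finset (Finset (Fin n))} (hS : IsExtremal k S) :
    Extremal k (toNat S) := by
  obtain ⟨h1, l, a, ⟨h2, h3, h4, h5, h6⟩, h7⟩ := hS
  refine ⟨sized_toNat h1, ?_⟩
  rw [← toNat_shadow, card_toNat, card_toNat, h7, h6,
    (minShadow_sum_choose l k a h2 h3 (fun i hi => Or.inl (h4 i hi)) h5).2.2.2]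

/-- In the decomposition of the size of the shadow, the last entry `w` disappears and contributes
`1` to the new last entry `a q + 1`. -/
lemma Extremal.card_shadow {S : Finset (Finset ℕ)} {a : ℕ → ℕ} {q w : ℕ}
    (hS : Extremal (q + 1 + 1) S) (ha : ∀ i < q, a (i + 1) < a i) (h1 : 1 ≤ w) (hw : w ≤ a q)
    (hcard : #S = ∑ i ∈ range (q + 1), (a i).choose (q + 1 + 1 - i) + w) :
    #(∂ S) = ∑ i ∈ range q, (a i).choose (q + 1 - i) + (a q + 1) := by
  rw [hS.2, hcard, minShadow_sum_choose_add ha h1 hw, sum_range_succ, Nat.add_sub_cancel_left,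
    Nat.choose_one_right, add_assoc]

/-- The sizes of the iterated shadows of an extremal family whose size has a binomial decomposition
of full length. -/
lemma Extremal.card_iterate_shadow {S : Finset (Finset ℕ)} {a : ℕ → ℕ} {q j w : ℕ}
    (hS : Extremal (q + j + 1 + 1) S) (ha : ∀ i < q + j, a (i + 1) < a i) (h1 : 1 ≤ w)
    (hw : w ≤ a (q + j))
    (hcard : #S = ∑ i ∈ range (q + j + 1), (a i).choose (q + j + 1 + 1 - i) + w) :
    #(Finset.shadow^[j + 1] S) = ∑ i ∈ range q, (a i).choose (q + 1 - i) + (a q + 1) := by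
  induction j generalizing S w with
  | zero => exact Extremal.card_shadow hS ha h1 hw hcard
  | succ j ih =>
    rw [Function.iterate_succ_apply]
    exact ih (Extremal.shadow hS) (fun i hi => ha i (by omega)) (by omega) (ha _ (by omega))
      (Extremal.card_shadow hS ha h1 hw hcard)

/-- An obstruction forces the last but one entry `a q` of the binomial decomposition to exceed the
last entry `w` by a hypotenusal number. -/
lemma Obstructed.add_hypotenusal_le {S : Finset (Finset ℕ)} {a : ℕ → ℕ} {q w : ℕ}
    (ho : Obstructed r S) (hS : Extremal (q + 1 + 1) S) (hq : q + 1 = r + t)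
    (ha : ∀ i < q, a (i + 1) < a i) (h1 : 1 ≤ w) (hw : w ≤ a q)
    (hcard : #S = ∑ i ∈ range (q + 1), (a i).choose (q + 1 + 1 - i) + w) :
    (w : ℤ) + hypotenusal t ≤ a q := by
  have h := plateau_of_obstructed (fun k hk => plateau_irreducible hk) hq hS ho
  unfold Plateau at h
  rw [hcard] at h
  have h2 := add_le_of_plateau ha h1 hw h
  omega

/-- The bound for the last gap comes from the family itself, and those for the other gaps from its
iterated shadows. -/
theorem hypotenusal_le_sub {S : Finset (Finset (Fin n))} {a : ℕ → ℕ} (hS : IsExtremal k S)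
    (ht : t < k) (hnot : ¬ IsColexInitSeg (k - t) (shadow^[t] S))
    (ha : IsBinomialDecomposition k #S k a) :
    (∀ i : ℕ, 1 ≤ i → i < t →
        (a (k - 2 - t + i) : ℤ) - (a (k - 1 - t + i) : ℤ) ≥ hypotenusal ((i : ℤ) - 1) + 1) ∧
      (a (k - 2) : ℤ) - (a (k - 1) : ℤ) ≥ hypotenusal ((t : ℤ) - 1) := by
  obtain ⟨-, -, hdec, hlast, hcard⟩ := ha
  obtain ⟨r, rfl⟩ : ∃ r, k = r + t := ⟨k - t, by omega⟩
  rw [Nat.add_sub_cancel] at hnot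
  have hE := extremal_toNat hS
  have hsz : ((shadow^[t] S : Finset (Finset (Fin n))) : Set (Finset (Fin n))).Sized r := by
    simpa using hS.1.shadow_iterate (k := t)
  have ho : Obstructed r (shadow^[t] (toNat S)) := by
    rw [← toNat_iterate_shadow]
    by_contra h
    exact hnot (isColexInitSeg_of_not_obstructed hsz h)
  have hr := ho.two_le
  obtain ⟨r, rfl⟩ : ∃ s, r = s + 2 := ⟨r - 2, by omega⟩
  rw [← card_toNat] at hcard
  have hE' : Extremal (r + t + 1 + 1) (toNat S) := by convert hE using 1; omega
  rw [show r + 2 + t - 1 = r + t + 1 by omega] at hlast ⊢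
  rw [show r + 2 + t = r + t + 1 + 1 by omega, sum_range_succ, Nat.add_sub_cancel_left,
    Nat.choose_one_right] at hcard
  have hlt := hdec (r + t) (by omega)
  constructor
  · intro i hi hit
    obtain ⟨i, rfl⟩ : ∃ j, i = j + 1 := ⟨i - 1, by omega⟩
    obtain ⟨j, rfl⟩ : ∃ j, t = i + 1 + (j + 1) := ⟨t - (i + 2), by omega⟩
    have e : r + (i + 1 + (j + 1)) = r + i + 1 + 1 + j := by omega
    rw [e] at hE' hcard hlast hlt
    have h1 := hE'.card_iterate_shadow (fun l hl => hdec l (by omega)) (by omega) hlt.le hcard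
    have h2 : Extremal (r + i + 1 + 1 + 1) (Finset.shadow^[j + 1] (toNat S)) :=
      Extremal.iterate_shadow (by convert hE' using 1; omega)
    have h3 : Obstructed (r + 2) (Finset.shadow^[j + 1] (toNat S)) := by
      rw [Function.iterate_add_apply] at ho
      refine ho.of_iterate_shadow ?_
      convert h2.1 using 1
      omega
    have h4 := h3.add_hypotenusal_le (t := i) h2 (by omega) (fun l hl => hdec l (by omega))
      (by omega) (hdec _ (by omega)) h1
    rw [show r + 2 + (i + 1 + (j + 1)) - 2 - (i + 1 + (j + 1)) + (i + 1) = r + i + 1 by omega,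
      show r + (i + 1 + (j + 1)) + 1 - (i + 1 + (j + 1)) + (i + 1) = r + i + 1 + 1 by omega]
    push_cast at h4 ⊢
    rw [add_sub_cancel_right]
    omega
  · rw [show r + 2 + t - 2 = r + t by omega]
    cases t with
    | zero =>
      have : hypotenusal (((0 : ℕ) : ℤ) - 1) = 1 := rfl
      omega
    | succ t =>
      have h1 := (ho.of_iterate_shadow hE.1).add_hypotenusal_le (t := t) hE' (by omega)
        (fun l hl => hdec l (by omega)) (by omega) hlt.le hcard
      push_cast
      rw [add_sub_cancel_right]
      omega

end

/-! ### Families attaining the bounds -/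

section

variable {K y l t : ℕ}

/-- `A` contains neither of the two disjoint pairs `{0, 1}` and `{2, 3}`. -/
def AvoidsPairs {n : ℕ} (A : Finset (Fin (4 + n))) : Prop :=
  ¬ (Fin.castAdd n 0 ∈ A ∧ Fin.castAdd n 1 ∈ A) ∧ ¬ (Fin.castAdd n 2 ∈ A ∧ Fin.castAdd n 3 ∈ A)

instance {n : ℕ} : DecidablePred (AvoidsPairs (n := n)) := fun A => by
  unfold AvoidsPairs; infer_instance

/-- The `K`-subsets of a set of size `4 + y` which contain neither of the pairs `{0, 1}` and
`{2, 3}`. The other `y` points are cone points. -/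
def avoidFamily (y K : ℕ) : Finset (Finset (Fin (4 + y))) :=
  {A ∈ (univ : Finset (Fin (4 + y))).powersetCard K | AvoidsPairs A}

lemma mem_avoidFamily {A : Finset (Fin (4 + y))} :
    A ∈ avoidFamily y K ↔ #A = K ∧ AvoidsPairs A := by
  simp [avoidFamily, mem_powersetCard]

lemma sized_avoidFamily : (avoidFamily y K : Set (Finset (Fin (4 + y)))).Sized K :=
  fun _ hA => (mem_avoidFamily.1 (mem_coe.1 hA)).1

lemma card_avoidFamily (K : ℕ) :
    #(avoidFamily y (K + 2)) = y.choose (K + 2) + 4 * y.choose (K + 1) + 4 * y.choose K := by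
  have h0 : ∀ g : Finset (Fin 4), AvoidsPairs (g.map (Fin.castAddEmb y))
      ↔ ¬ (0 ∈ g ∧ 1 ∈ g) ∧ ¬ (2 ∈ g ∧ 3 ∈ g) := by
    intro g
    have h : ∀ i : Fin 4, Fin.castAdd y i ∈ g.map (Fin.castAddEmb y) ↔ i ∈ g :=
      fun i => mem_map' (Fin.castAddEmb y)
    simp only [AvoidsPairs, h]
  have h1 : ∀ m, #{g ∈ (univ.map (Fin.castAddEmb y) : Finset (Fin (4 + y))).powersetCard m |
      AvoidsPairs g} = #{g ∈ (univ : Finset (Fin 4)).powersetCard m |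
        ¬ (0 ∈ g ∧ 1 ∈ g) ∧ ¬ (2 ∈ g ∧ 3 ∈ g)} := by
    intro m
    rw [powersetCard_map, filter_map, card_map]
    exact congrArg card (filter_congr fun g _ => h0 g)
  have h2 : ∀ A : Finset (Fin (4 + y)),
      AvoidsPairs (A ∩ univ.map (Fin.castAddEmb y)) ↔ AvoidsPairs A := by
    intro A
    have h : ∀ i : Fin 4, Fin.castAdd y i ∈ A ∩ univ.map (Fin.castAddEmb y) ↔ Fin.castAdd y i ∈ A :=
      fun i => by
        rw [mem_inter, and_iff_left]
        exact mem_map_of_mem (Fin.castAddEmb y) (mem_univ i)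
    simp only [AvoidsPairs, h]
  have h3 := card_filter_inter (V := univ) (C := univ.map (Fin.castAddEmb y)) (subset_univ _)
    (K := K + 2) AvoidsPairs (by
      intro g hg hgP
      obtain ⟨g, -, rfl⟩ := subset_map_iff.1 hg
      rw [h0] at hgP
      have h : ∀ g : Finset (Fin 4), ¬ (0 ∈ g ∧ 1 ∈ g) ∧ ¬ (2 ∈ g ∧ 3 ∈ g) → #g ≤ 2 := by decide
      have := h g hgP
      rw [card_map]
      omega)
  simp only [h2, h1] at h3
  have hc : #(univ \ univ.map (Fin.castAddEmb y) : Finset (Fin (4 + y))) = y := by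
    rw [card_sdiff_of_subset (subset_univ _), card_map, card_univ, card_univ, Fintype.card_fin,
      Fintype.card_fin, Nat.add_sub_cancel_left]
  have hn : ∀ m < 5, #{g ∈ (univ : Finset (Fin 4)).powersetCard m |
      ¬ (0 ∈ g ∧ 1 ∈ g) ∧ ¬ (2 ∈ g ∧ 3 ∈ g)} = ![1, 4, 4, 0, 0] (Fin.ofNat 5 m) := by decide
  rw [avoidFamily, h3, hc, card_map, card_univ, Fintype.card_fin,
    sum_congr rfl fun m hm => by rw [hn m (mem_range.1 hm)]]
  simp [sum_range_succ, Fin.ofNat]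

lemma shadow_avoidFamily (hK : K < y) : ∂ (avoidFamily y (K + 1)) = avoidFamily y K := by
  ext A
  simp only [mem_shadow_iff_insert_mem, mem_avoidFamily]
  constructor
  · rintro ⟨x, hx, h1, h2⟩
    rw [card_insert_of_notMem hx] at h1
    refine ⟨by omega, fun h => h2.1 ?_, fun h => h2.2 ?_⟩ <;>
    exact ⟨mem_insert_of_mem h.1, mem_insert_of_mem h.2⟩
  · rintro ⟨h1, h2⟩
    obtain ⟨x, hx, hxA⟩ : ∃ x ∈ (univ.map (Fin.natAddEmb 4) : Finset (Fin (4 + y))), x ∉ A := by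
      refine exists_mem_notMem_of_card_lt_card ?_
      rw [card_map, card_univ, Fintype.card_fin]; omega
    obtain ⟨x, -, rfl⟩ := mem_map.1 hx
    have h : ∀ i : Fin 4, Fin.castAdd y i ≠ Fin.natAddEmb 4 x := fun i hi => by
      have := congrArg Fin.val hi
      simp at this
      omega
    refine ⟨_, hxA, by rw [card_insert_of_notMem hxA, h1], ?_⟩
    simpa only [AvoidsPairs, mem_insert, h, false_or] using h2

lemma iterate_shadow_avoidFamily (t : ℕ) (hK : K + t ≤ y) :
    shadow^[t] (avoidFamily y (K + t)) = avoidFamily y K := by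
  induction t with
  | zero => rfl
  | succ t ih => rw [Function.iterate_succ_apply, ← add_assoc, shadow_avoidFamily (by omega),
      ih (by omega)]

lemma not_isColexInitSeg_avoidFamily : ¬ IsColexInitSeg 2 (avoidFamily y 2) := by
  have h : ∀ i j : Fin 4, Fin.castAdd y i = Fin.castAdd y j ↔ i = j := fun i j =>
    (Fin.castAdd_injective 4 y).eq_iff
  refine not_isColexInitSeg (i := Fin.castAdd y 0) (j := Fin.castAdd y 2) (A := {Fin.castAdd y 3})
    (B := {Fin.castAdd y 1}) (by simp) (by simp) ?_ ?_ ?_ ?_ ?_ ?_ ?_ ?_ <;>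
  simp [mem_avoidFamily, AvoidsPairs, h, card_insert_of_notMem]

/-- The decomposition of the size of `avoidFamily y (l + 3)` is `irreducibleSeq y 0`, with the last
entry increased by one. -/
theorem exists_eq_hypotenusal_of_pos (l : ℕ) :
    ∃ (n k : ℕ) (S : Finset (Finset (Fin n))) (a : ℕ → ℕ),
      IsExtremal k S ∧ l + 1 < k ∧ ¬ IsColexInitSeg (k - (l + 1)) (shadow^[l + 1] S) ∧
      IsBinomialDecomposition k #S k a ∧
      (∀ i : ℕ, 1 ≤ i → i < l + 1 → (a (k - 2 - (l + 1) + i) : ℤ) - (a (k - 1 - (l + 1) + i) : ℤ)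
        = hypotenusal ((i : ℤ) - 1) + 1) ∧
      (a (k - 2) : ℤ) - (a (k - 1) : ℤ) = hypotenusal (((l + 1 : ℕ) : ℤ) - 1) := by
  obtain ⟨y, hy, hyl⟩ : ∃ y : ℕ, hamilton (l + 1) + (l + 1 : ℕ) ≤ y + 1 ∧ l + 3 ≤ y :=
    ⟨(hamilton (l + 1)).toNat + l + 3, by omega, by omega⟩
  obtain ⟨a, ha⟩ : ∃ a : ℕ → ℕ, ∀ n, a n = irreducibleSeq y 0 n + if n = l + 2 then 1 else 0 :=
    ⟨_, fun _ => rfl⟩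
  have ha0 : ∀ n, n ≠ l + 2 → a n = irreducibleSeq y 0 n := fun n hn => by rw [ha, if_neg hn]; rfl
  have ha1 : a (l + 2) = hamiltonSeq y (l + 1) + 1 := by
    rw [ha, if_pos rfl, irreducibleSeq_succ]; rfl
  have hcast : ∀ i ≤ l, (a (i + 1) : ℤ) = y + 1 - hamilton i - i := fun i hi => by
    rw [ha0 _ (by omega), irreducibleSeq_succ]
    exact hamiltonSeq_cast hy (by omega)
  have hcast1 : (a (l + 2) : ℤ) = y + 1 - hamilton (l + 1) - (l + 1 : ℕ) + 1 := by
    rw [ha1, Nat.cast_succ, hamiltonSeq_cast hy le_rfl]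
  have hgap : (a (l + 1) : ℤ) - a (l + 2) = hypotenusal l := by
    rw [hcast l le_rfl, hcast1, hypotenusal_natCast]; push_cast; ring
  have hS : #(avoidFamily y (l + 3)) = ∑ i ∈ range (l + 3), (a i).choose (l + 3 - i) := by
    have h := sum_choose_irreducibleSeq (y := y) (s := 0) (l := l) (by omega) (by simpa using hy)
    rw [card_avoidFamily (l + 1), sum_range_succ, ha1, show l + 3 - (l + 2) = 1 by omega,
      Nat.choose_one_right, ← h]
    refine congrArg₂ _ (sum_congr rfl fun i hi => ?_) rfl
    rw [mem_range] at hi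
    rw [ha0 _ (by omega)]
  have hS' : #(avoidFamily y (l + 2)) = ∑ i ∈ range (l + 3), (a i).choose (l + 3 - 1 - i) := by
    rw [card_avoidFamily l, sum_range_succ, show l + 3 - 1 - (l + 2) = 0 by omega,
      Nat.choose_zero_right, show l + 3 - 1 = l + 2 by omega]
    have h0 : ∑ i ∈ range (l + 2), (a i).choose (l + 2 - i)
        = ∑ i ∈ range (l + 2), (irreducibleSeq y 0 i).choose (l + 2 - i) :=
      sum_congr rfl fun i hi => by rw [mem_range] at hi; rw [ha0 _ (by omega)]
    rw [h0]
    cases l with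
    | zero =>
      rw [sum_range_succ, sum_range_one, irreducibleSeq_succ, hamiltonSeq_zero,
        show irreducibleSeq y 0 0 = y + 3 from if_pos rfl]
      have h : (y + 3).choose 2 = y.choose 2 + 3 * y + 3 := by
        have h1 := Nat.choose_succ_succ' (y + 2) 1
        have h2 := Nat.choose_succ_succ' (y + 1) 1
        have h3 := Nat.choose_succ_succ' y 1
        simp only [Nat.choose_one_right, add_assoc, Nat.reduceAdd] at h1 h2 h3
        omega
      simp only [zero_add, Nat.sub_zero, Nat.reduceSub, Nat.choose_one_right, Nat.choose_zero_right]
      omega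
    | succ l =>
      have hm := hamilton_mono (Nat.le_succ (l + 1))
      have h := sum_choose_irreducibleSeq (y := y) (s := 0) (l := l) (by omega)
        (by push_cast at hy ⊢; simp at hm ⊢; omega)
      rw [sum_range_succ, irreducibleSeq_succ, show l + 1 + 2 - (l + 1 + 1) = 1 by omega,
        Nat.choose_one_right]
      exact h.symm
  have hD : IsBinomialDecomposition (l + 3) #(avoidFamily y (l + 3)) (l + 3) a := by
    refine ⟨by omega, le_rfl, fun i hi => ?_, ?_, hS⟩
    · rcases Nat.lt_or_ge i (l + 1) with h | h
      · rw [ha0 _ (by omega), ha0 _ (by omega)]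
        exact irreducibleSeq_succ_lt (l := l) (by omega) (by simpa using hy) h.le
      · obtain rfl : i = l + 1 := by omega
        have := one_le_hypotenusal l
        show a (l + 2) < a (l + 1)
        omega
    · show l + 3 - (l + 2) ≤ a (l + 2)
      omega
  refine ⟨4 + y, l + 3, avoidFamily y (l + 3), a, ⟨sized_avoidFamily, l + 3, a, hD, ?_⟩, by omega,
    ?_, hD, ?_, ?_⟩
  · rw [shadow_avoidFamily (by omega), hS']
  · rw [show l + 3 = 2 + (l + 1) by omega, iterate_shadow_avoidFamily _ (by omega),
      Nat.add_sub_cancel]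
    exact not_isColexInitSeg_avoidFamily
  · intro i hi hil
    obtain ⟨i, rfl⟩ : ∃ j, i = j + 1 := ⟨i - 1, by omega⟩
    rw [show l + 3 - 2 - (l + 1) + (i + 1) = i + 1 by omega,
      show l + 3 - 1 - (l + 1) + (i + 1) = i + 1 + 1 by omega, hcast i (by omega),
      hcast (i + 1) (by omega), Nat.cast_succ, add_sub_cancel_right, hypotenusal_natCast]
    ring
  · rw [Nat.cast_succ, add_sub_cancel_right]
    exact hgap

/-- Six of the ten triples in a set of five points; the decomposition is
`C(4, 3) + C(2, 2) + C(1, 1)`. -/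
theorem exists_eq_hypotenusal_zero :
    ∃ (n k : ℕ) (S : Finset (Finset (Fin n))) (a : ℕ → ℕ),
      IsExtremal k S ∧ 0 < k ∧ ¬ IsColexInitSeg k S ∧
      IsBinomialDecomposition k #S k a ∧
      (a (k - 2) : ℤ) - (a (k - 1) : ℤ) = 1 := by
  have hD : IsBinomialDecomposition 3
      #{A ∈ (univ : Finset (Fin 5)).powersetCard 3 | ¬ {3, 4} ⊆ A ∧ A ≠ {0, 1, 2}} 3
      (fun i => if i = 0 then 4 else if i = 1 then 2 else 1) :=
    ⟨by decide, le_rfl, fun i hi => by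
      obtain rfl | rfl : i = 0 ∨ i = 1 := by omega
      all_goals decide, by decide, by decide⟩
  refine ⟨5, 3, _, _, ⟨fun A hA => ?_, 3, _, hD, ?_⟩, by omega, ?_, hD, rfl⟩
  · exact (mem_powersetCard.1 (mem_filter.1 (mem_coe.1 hA)).1).2
  · decide
  · refine not_isColexInitSeg (i := 3) (j := 2) (A := {0, 1}) (B := {0, 4}) ?_ ?_ ?_ ?_ ?_ ?_ ?_ ?_
      ?_ ?_ <;> decide

end

end KruskalKatona

theorem theorem6 :
    (∀ (n k : ℕ) (S : Finset (Finset (Fin n))) (t : ℕ) (a : ℕ → ℕ),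
      IsExtremal k S → t < k → ¬ IsColexInitSeg (k - t) (shadow^[t] S) →
      IsBinomialDecomposition k S.card k a →
      (∀ i : ℕ, 1 ≤ i → i < t →
        (a (k - 2 - t + i) : ℤ) - (a (k - 1 - t + i) : ℤ) ≥ hypotenusal ((i : ℤ) - 1) + 1) ∧
      (a (k - 2) : ℤ) - (a (k - 1) : ℤ) ≥ hypotenusal ((t : ℤ) - 1)) ∧
    (∀ t : ℕ, ∃ (n k : ℕ) (S : Finset (Finset (Fin n))) (a : ℕ → ℕ),
      IsExtremal k S ∧ t < k ∧ ¬ IsColexInitSeg (k - t) (shadow^[t] S) ∧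
      IsBinomialDecomposition k S.card k a ∧
      (∀ i : ℕ, 1 ≤ i → i < t →
        (a (k - 2 - t + i) : ℤ) - (a (k - 1 - t + i) : ℤ) = hypotenusal ((i : ℤ) - 1) + 1) ∧
      (a (k - 2) : ℤ) - (a (k - 1) : ℤ) = hypotenusal ((t : ℤ) - 1)) := by
  refine ⟨fun n k S t a hS ht hnot ha => KruskalKatona.hypotenusal_le_sub hS ht hnot ha,
    fun t => ?_⟩
  cases t with
  | zero =>
    obtain ⟨n, k, S, a, h1, h2, h3, h4, h5⟩ := KruskalKatona.exists_eq_hypotenusal_zero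
    exact ⟨n, k, S, a, h1, h2, h3, h4, fun i _ hi => (Nat.not_lt_zero i hi).elim, h5⟩
  | succ l => exact KruskalKatona.exists_eq_hypotenusal_of_pos l
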